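/- **Setting.** Let $k$ be a finite field. A variety over $k$ is a geometrically integral separated scheme of finite type over $k$; divisors are Weil divisors over $k$. Let $X$ be a smooth projective variety over $k$ of dimension $r$. Let $\mathcal D=(D_1,\dots,D_r)$ be effective divisors on $X$ that intersect properly, i.e. every point of the set-theoretic intersection $\bigcap_l D_l$ of their supports is closed. Let $\mathcal P=(P_1,\dots,P_n)$ be distinct $k$-rational points in $\bigcap_l D_l$, and let $G$ be a divisor whose support contains no $P_i$. For a divisor $B$ let $\Omega^r(B)$ be the set of rational differential $r$-forms $\omega$ on $X$ over $k$ with $\omega=0$ or $(\omega)+B\ge 0$. For a divisor $B$, $B^+$ is its positive part. *Local data.* For $p\in\bigcap_l D_l$ choose generators $x_1,\dots,x_r$ of the maximal ideal of $\mathcal O_p$, local equations $f_l\in\mathcal O_p$ of $D_l$, an integer $a\ge1$ and $R_{ij}\in\mathcal O_p$ with $x_i^a=\sum_j R_{ij}f_j$. *Residues.* Let $P\in\bigcap_l D_l$ be $k$-rational and let $\omega$ be a rational $r$-form with $f_1\cdots f_r\,\omega=h\,dx_1\wedge\dots\wedge dx_r$, $h\in\mathcal O_P$. Then $\mathrm{Res}_P\left[\begin{smallmatrix}\omega\\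 D_1,\dots,D_r\end{smallmatrix}\right]\in k$ is the coefficient of $x_1^{a-1}\cdots x_r^{a-1}$ in the power series expansion of $\det(R_{ij})\,h$ in $x_1,\dots,x_r$. *Rectifying functions.* A function $\theta\in k(X)$ that is regular at every point of $\bigcap_l D_l$ is $(\mathcal D,\mathcal P)$-rectifying if at each $p\in\bigcap_l D_l$ there is $c_p\in k$ with $\det(R_{ij})\,\theta\equiv c_p\,x_1^{a-1}\cdots x_r^{a-1} \pmod{(x_1^a,\dots,x_r^a)}$, where one can take $c_p=0$ if $p\notin\mathcal P$. It is strictly rectifying if moreover $c_p\ne0$ for all $p\in\mathcal P$. (Residues and these two notions do not depend on the choice of local data.) For rectifying $\theta\neq0$, the rectified differential code $C_\Omega(\mathcal D,\mathcal P,\theta,G)\subseteq k^n$ is the image of $\Omega^r(\sum_l D_l-G-(\theta)^+)$ under $\omega\mapsto\left(\mathrm{Res}_{P_i}\left[\begin{smallmatrix}\omega\\ D_1,\dots,D_r\end{smallmatrix}\right]\right)_{1\le i\le n}$. Let $Y$, $s$, $\mathcal E=(E_1,\dots,E_s)$, $\mathcal Q=(Q_1,\dots,Q_m)$, $H$ be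 data of the same kind ($Y$ smooth projective of dimension $s$, and so on). On $X\times Y$, with projections $pr_X$, $pr_Y$, put $\mathcal D\times Y\cup X\times\mathcal E=(D_1\times Y,\dots,D_r\times Y,X\times E_1,\dots,X\times E_s)$ and $\mathcal P\times\mathcal Q=(P_i\times Q_j)$, ordered lexicographically. **Theorem.** Suppose that $\theta\in k(X)$ is $(\mathcal D,\mathcal P)$-rectifying and $\lambda\in k(Y)$ is $(\mathcal E,\mathcal Q)$-rectifying, and let $\mu=pr_X^*(\theta)\,pr_Y^*(\lambda)$. In (a), (c) and (d) suppose also that $\theta\ne0$ and $\lambda\neq0$. (a) If $\omega\in\Omega^r(\sum_i D_i-G-(\theta)^+)$, $\chi\in\Omega^s(\sum_j E_j-H-(\lambda)^+)$ and $\psi=pr_X^*(\omega)\wedge pr_Y^*(\chi)$, then $$\psi\in\Omega^{r+s}\Big(\sum_i (D_i\times Y)+\sum_j (X\times E_j)-G\times Y-X\times H-(\mu)^+\Big).$$ (b) $\mu$ is $(\mathcal D\times Y\cup X\times\mathcal E,\ \mathcal P\times\mathcal Q)$-rectifying on $X\times Y$. If $\theta$ and $\lambda$ are strictly rectifying, then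 so is $\mu$. (c) For $\omega,\chi,\psi$ as in (a) and all $P\in\mathcal P$, $Q\in\mathcal Q$, $$\mathrm{Res}_{P\times Q}\left[\begin{smallmatrix}\psi\\ D_1\times Y,\dots,D_r\times Y,X\times E_1,\dots,X\times E_s\end{smallmatrix}\right]=\mathrm{Res}_P\left[\begin{smallmatrix}\omega\\ D_1,\dots,D_r\end{smallmatrix}\right]\,\mathrm{Res}_Q\left[\begin{smallmatrix}\chi\\ E_1,\dots,E_s\end{smallmatrix}\right].$$ (d) $C_\Omega(\mathcal D\times Y\cup X\times\mathcal E,\ \mathcal P\times\mathcal Q,\ \mu,\ G\times Y+X\times H)=C_\Omega(\mathcal D,\mathcal P,\theta,G)\otimes C_\Omega(\mathcal E,\mathcal Q,\lambda,H)$ in $k^{nm}$, where $C\otimes C'$ is the span of the Kronecker products $u\otimes v$ with $u\in C$, $v\in C'$. -/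

import Mathlib

universe u

open AlgebraicGeometry CategoryTheory Limits Order
open scoped KaehlerDifferential

/-! ### Differential forms of a field extension -/

namespace RatForm

/-- `Ω^r` of the field `K` over `k`: the `K`-vector space `⋀^r Ω_{K/k}`. -/
abbrev Form (k K : Type u) [Field k] [Field K] [Algebra k K] (r : ℕ) : Type u :=
  ⋀[K]^r Ω[K⁄k]

/-- The form `dx₁ ∧ ⋯ ∧ dx_r`. -/
noncomputable def dWedge (k : Type u) {K : Type u} [Field k] [Field K] [Algebra k K] {r : ℕ}
    (x : Fin r → K) : Form k K r :=
  exteriorPower.ιMulti K r (fun i => KaehlerDifferential.D k K (x i))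

/-- The wedge product of an `r`-form and an `s`-form. -/
noncomputable def wedge {k K : Type u} [Field k] [Field K] [Algebra k K] {r s : ℕ}
    (ω : Form k K r) (χ : Form k K s) : Form k K (r + s) :=
  ⟨ω.1 * χ.1, by
    have h := Submodule.mul_mem_mul ω.2 χ.2
    rwa [← pow_add] at h⟩

/-- Pull-back of `r`-forms along a homomorphism `φ : K → L` of field extensions of `k`, that is
`g dx₁ ∧ ⋯ ∧ dx_r ↦ φ(g) dφ(x₁) ∧ ⋯ ∧ dφ(x_r)`. -/
noncomputable def pull {k K L : Type u} [Field k] [Field K] [Field L] [Algebra k K] [Algebra k L]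
    (φ : K →ₐ[k] L) (r : ℕ) : Form k K r → Form k L r :=
  letI := φ.toRingHom.toAlgebra
  haveI : IsScalarTower k K L := IsScalarTower.of_algebraMap_eq (fun a => (φ.commutes a).symm)
  let A : (Ω[L⁄k]) [⋀^Fin r]→ₗ[K] Form k L r :=
    { (exteriorPower.ιMulti L r (M := Ω[L⁄k])).toMultilinearMap.restrictScalars K with
      map_eq_zero_of_eq' := fun v _ _ h hij =>
        (exteriorPower.ιMulti L r (M := Ω[L⁄k])).map_eq_zero_of_eq v h hij }
  fun ω => exteriorPower.alternatingMapLinearEquiv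
    (A.compLinearMap (KaehlerDifferential.map k k K L)) ω

theorem pull_smul_dWedge {k K L : Type u} [Field k] [Field K] [Field L] [Algebra k K] [Algebra k L]
    (φ : K →ₐ[k] L) {r : ℕ} (g : K) (x : Fin r → K) :
    pull φ r (g • dWedge k x) = φ g • dWedge k (fun i => φ (x i)) := by
  let _ := φ.toRingHom.toAlgebra
  have : IsScalarTower k K L := IsScalarTower.of_algebraMap_eq (fun a => (φ.commutes a).symm)
  have h : φ g • dWedge k (fun i => φ (x i)) = g • dWedge k (fun i => φ (x i)) :=
    algebraMap_smul L g _
  rw [h]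
  simp only [pull, dWedge, map_smul, exteriorPower.alternatingMapLinearEquiv_apply_ιMulti]
  congr 1
  change exteriorPower.ιMulti L r _ = _
  congr 1
  funext i
  exact KaehlerDifferential.map_D k k K L (x i)

theorem wedge_dWedge {k K : Type u} [Field k] [Field K] [Algebra k K] {r s : ℕ}
    (x : Fin r → K) (y : Fin s → K) :
    wedge (dWedge k x) (dWedge k y) = dWedge k (Fin.append x y) := by
  apply Subtype.ext
  simp only [wedge, dWedge, exteriorPower.ιMulti_apply_coe, ExteriorAlgebra.ιMulti_apply]
  rw [List.ofFn_add, List.prod_append]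
  simp

end RatForm

/-! ### Varieties -/

/-- A variety over the field `k`: a geometrically integral separated scheme of finite type
over `k`. -/
structure Variety (k : Type u) [Field k] where
  /-- The underlying scheme. -/
  carrier : Scheme.{u}
  /-- The structure morphism. -/
  str : carrier ⟶ Spec (CommRingCat.of k)
  geometricallyIntegral : GeometricallyIntegral str
  isSeparated : IsSeparated str
  locallyOfFiniteType : LocallyOfFiniteType str
  quasiCompact : QuasiCompact str

namespace Variety

variable {k : Type u} [Field k]

instance (X : Variety k) : GeometricallyIntegral X.str := X.geometricallyIntegral
instance (X : Variety k) : IsSeparated X.str := X.isSeparated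
instance (X : Variety k) : LocallyOfFiniteType X.str := X.locallyOfFiniteType
instance (X : Variety k) : QuasiCompact X.str := X.quasiCompact
instance (X : Variety k) : IsIntegral X.carrier :=
  GeometricallyIntegral.isIntegral_of_subsingleton X.str
instance (X : Variety k) : IsLocallyNoetherian X.carrier :=
  LocallyOfFiniteType.isLocallyNoetherian X.str
instance (X : Variety k) : CompactSpace X.carrier :=
  (quasiCompact_iff_compactSpace X.str).mp X.quasiCompact
instance (X : Variety k) : IsNoetherian X.carrier := {}

/-- `X` is projective over `k`: it is a closed subscheme of some `ℙ^N` over `k`. -/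
def IsProjective (X : Variety k) : Prop :=
  ∃ N : ℕ,
    letI : GradedAlgebra (MvPolynomial.homogeneousSubmodule (Fin (N + 1)) k) :=
      MvPolynomial.gradedAlgebra
    ∃ i : X.carrier ⟶ Proj (MvPolynomial.homogeneousSubmodule (Fin (N + 1)) k),
      IsClosedImmersion i ∧
      i ≫ Proj.toSpecZero (MvPolynomial.homogeneousSubmodule (Fin (N + 1)) k) ≫
        Spec.map (CommRingCat.ofHom
          (algebraMap k (MvPolynomial.homogeneousSubmodule (Fin (N + 1)) k 0))) = X.str

/-- The product variety `X × Y`. -/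
noncomputable def prod (X Y : Variety k) : Variety k where
  carrier := pullback X.str Y.str
  str := pullback.fst X.str Y.str ≫ X.str
  geometricallyIntegral := by
    refine ⟨fun K _ x Z fst snd h => ?_⟩
    have : IsIntegral (pullback (pullback.fst X.str Y.str) (pullback.fst X.str x)) := by
      have := GeometricallyIntegral.isIntegral_of_subsingleton (pullback.snd X.str x)
      have : IsLocallyNoetherian (pullback X.str x) :=
        LocallyOfFiniteType.isLocallyNoetherian (pullback.snd X.str x)
      infer_instance
    have : Nonempty Z := (h.isoPullback ≪≫
      (pullbackRightPullbackFstIso X.str x (pullback.fst X.str Y.str)).symm).hom.homeomorph.surjective.nonempty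
    exact isIntegral_of_isOpenImmersion (h.isoPullback ≪≫
      (pullbackRightPullbackFstIso X.str x (pullback.fst X.str Y.str)).symm).hom
  isSeparated := inferInstance
  locallyOfFiniteType := inferInstance
  quasiCompact := inferInstance

/-- The projection `X × Y → X`. -/
noncomputable def prX (X Y : Variety k) : (X.prod Y).carrier ⟶ X.carrier :=
  pullback.fst X.str Y.str

/-- The projection `X × Y → Y`. -/
noncomputable def prY (X Y : Variety k) : (X.prod Y).carrier ⟶ Y.carrier :=
  pullback.snd X.str Y.str

theorem prX_str (X Y : Variety k) : prX X Y ≫ X.str = (X.prod Y).str := rfl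

theorem prY_str (X Y : Variety k) : prY X Y ≫ Y.str = (X.prod Y).str :=
  pullback.condition.symm

instance (X Y : Variety k) : GeometricallyIntegral (prX X Y) :=
  inferInstanceAs (GeometricallyIntegral (pullback.fst X.str Y.str))
instance (X Y : Variety k) : GeometricallyIntegral (prY X Y) :=
  inferInstanceAs (GeometricallyIntegral (pullback.snd X.str Y.str))

/-! ### Local rings and function fields as `k`-algebras -/

/-- The local ring of `X` at `x`. -/
abbrev localRing (X : Variety k) (x : X.carrier) : Type u := X.carrier.presheaf.stalk x

/-- The function field `k(X)`. -/
abbrev funField (X : Variety k) : Type u := X.carrier.functionField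

/-- The constants in a local ring. -/
noncomputable def const (X : Variety k) (x : X.carrier) : k →+* X.carrier.presheaf.stalk x :=
  ((Scheme.ΓSpecIso (CommRingCat.of k)).inv ≫ X.str.appTop ≫
    X.carrier.presheaf.germ ⊤ x (TopologicalSpace.Opens.mem_top x)).hom

noncomputable instance (X : Variety k) (x : X.carrier) :
    Algebra k (X.carrier.presheaf.stalk x) := (X.const x).toAlgebra

/-- A `k`-rational point of `X`. -/
structure RatPoint (X : Variety k) where
  /-- The point as a section of the structure morphism. -/
  hom : Spec (CommRingCat.of k) ⟶ X.carrier
  w : hom ≫ X.str = 𝟙 _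

/-- The point of the scheme `X` underlying a `k`-rational point. -/
noncomputable def RatPoint.pt {X : Variety k} (P : X.RatPoint) : X.carrier :=
  P.hom (IsLocalRing.closedPoint k)

/-- The point `P × Q` of `X × Y`. -/
noncomputable def RatPoint.prod {X Y : Variety k} (P : X.RatPoint) (Q : Y.RatPoint) :
    (X.prod Y).RatPoint where
  hom := pullback.lift P.hom Q.hom (by rw [P.w, Q.w])
  w := by
    change pullback.lift P.hom Q.hom _ ≫ pullback.fst X.str Y.str ≫ X.str = _
    rw [pullback.lift_fst_assoc, P.w]

/-- A dominant morphism maps the generic point to the generic point. -/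
theorem map_genericPoint {X Z : Variety k} (φ : Z.carrier ⟶ X.carrier) [IsDominant φ] :
    φ (genericPoint Z.carrier) = genericPoint X.carrier := by
  have h := (genericPoint_spec Z.carrier).image φ.continuous
  rw [Set.image_univ, φ.denseRange.closure_range] at h
  exact h.eq (genericPoint_spec X.carrier)

/-- The pull-back `φ^* : k(X) → k(Z)` along a dominant `k`-morphism `φ : Z → X`. -/
noncomputable def funPull {X Z : Variety k} (φ : Z.carrier ⟶ X.carrier) [IsDominant φ]
    (hφ : φ ≫ X.str = Z.str) : X.funField →ₐ[k] Z.funField where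
  toRingHom := (X.carrier.presheaf.stalkSpecializes
    (specializes_of_eq (map_genericPoint φ)) ≫ φ.stalkMap (genericPoint Z.carrier)).hom
  commutes' := by
    intro a
    have h : X.carrier.presheaf.germ ⊤ (genericPoint X.carrier)
          (TopologicalSpace.Opens.mem_top _) ≫
        X.carrier.presheaf.stalkSpecializes (specializes_of_eq (map_genericPoint φ)) ≫
        φ.stalkMap (genericPoint Z.carrier) =
        φ.appTop ≫ Z.carrier.presheaf.germ ⊤ (genericPoint Z.carrier)
          (TopologicalSpace.Opens.mem_top _) := by
      rw [TopCat.Presheaf.germ_stalkSpecializes_assoc]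
      exact Scheme.Hom.germ_stalkMap φ ⊤ (genericPoint Z.carrier)
          (TopologicalSpace.Opens.mem_top _)
    have h2 : (Scheme.ΓSpecIso (CommRingCat.of k)).inv ≫ X.str.appTop ≫
        X.carrier.presheaf.germ ⊤ (genericPoint X.carrier)
          (TopologicalSpace.Opens.mem_top _) ≫
        X.carrier.presheaf.stalkSpecializes (specializes_of_eq (map_genericPoint φ)) ≫
        φ.stalkMap (genericPoint Z.carrier) =
        (Scheme.ΓSpecIso (CommRingCat.of k)).inv ≫ Z.str.appTop ≫
          Z.carrier.presheaf.germ ⊤ (genericPoint Z.carrier)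
          (TopologicalSpace.Opens.mem_top _) := by
      rw [h, ← hφ, Scheme.Hom.comp_appTop]
      simp
    exact congrArg (fun q => q.hom a) h2

/-! ### Divisors -/

/-- The points of codimension one; they are the generic points of the prime divisors of `X`. -/
abbrev PrimeDiv (X : Variety k) : Type u := {z : X.carrier // coheight z = 1}

/-- The group of (`k`-rational, Weil) divisors on `X`. -/
abbrev Divisor (X : Variety k) : Type u := X.PrimeDiv →₀ ℤ

/-- The support of a divisor as a subset of `X`. -/
def Divisor.supp {X : Variety k} (D : X.Divisor) : Set X.carrier :=
  {x | ∃ z : X.PrimeDiv, D z ≠ 0 ∧ z.1 ⤳ x}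

theorem eq_genericPoint_of_lt (X : Variety k) (z : X.PrimeDiv) {x : X.carrier} (h : z.1 < x) :
    x = genericPoint X.carrier := by
  have h1 : coheight x < 1 := by
    have hle := coheight_anti h.le
    rw [z.2] at hle
    have := coheight_strictAnti h (lt_of_le_of_lt hle (by decide))
    rwa [z.2] at this
  have h0 : coheight x = 0 := by rwa [Order.lt_one_iff] at h1
  rw [coheight_eq_zero] at h0
  have hs : genericPoint X.carrier ⤳ x := genericPoint_specializes x
  exact (Specializes.antisymm (h0 hs) hs).eq

/-- Only finitely many prime divisors lie outside a non-empty open set. -/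
theorem finite_primeDiv_not_mem (X : Variety k) (U : X.carrier.Opens)
    (hU : genericPoint X.carrier ∈ U) : {z : X.PrimeDiv | z.1 ∉ U}.Finite := by
  obtain ⟨S, hSf, hSc, hSi, hS⟩ :=
    TopologicalSpace.NoetherianSpace.exists_finite_set_isClosed_irreducible
      U.isOpen.isClosed_compl
  have hex : ∀ z : X.PrimeDiv, z.1 ∉ U → ∃ T ∈ S, T = closure {z.1} := by
    intro z hz
    have hzC : z.1 ∈ ⋃₀ S := by rw [← hS]; exact hz
    obtain ⟨T, hT, hzT⟩ := hzC
    refine ⟨T, hT, ?_⟩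
    have hTi := hSi T hT
    have hg := hTi.isGenericPoint_genericPoint (hSc T hT)
    have hgz : hTi.genericPoint ⤳ z.1 := hg.specializes hzT
    have hgC : hTi.genericPoint ∉ U := by
      have h : hTi.genericPoint ∈ ⋃₀ S := ⟨T, hT, hg.mem⟩
      rw [← hS] at h
      exact h
    have hzg : z.1 ⤳ hTi.genericPoint := by
      by_contra hcon
      have hlt : z.1 < hTi.genericPoint := ⟨hgz, hcon⟩
      exact hgC (by rw [eq_genericPoint_of_lt X z hlt]; exact hU)
    rw [← (Specializes.antisymm hgz hzg).eq]
    exact hg.symm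
  choose! F hF hFc using hex
  refine Set.Finite.of_finite_image (f := F) (hSf.subset ?_) ?_
  · rintro _ ⟨z, hz, rfl⟩
    exact hF z hz
  · intro z hz w hw h
    have : closure {z.1} = closure {w.1} := by rw [← hFc z hz, ← hFc w hw, h]
    exact Subtype.ext (IsGenericPoint.eq (S := closure {w.1}) this rfl)

theorem finite_ord (X : Variety k) (f : X.funField) :
    {z : X.PrimeDiv | Scheme.ord f z.1 ≠ 0}.Finite := by
  by_cases hf : f = 0
  · subst hf
    simp
  obtain ⟨U, -, f', hne, rfl, hu⟩ := exists_isUnit_germ_eq X.carrier f hf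
  refine (X.finite_primeDiv_not_mem U
    (((genericPoint_spec X.carrier).mem_open_set_iff U.isOpen).mpr (by simpa using hne))).subset ?_
  intro z hz
  exact fun hzU => hz (Scheme.ord_of_isUnit hu hzU)

/-- The principal divisor `(f)` of a rational function `f ≠ 0` (with `(0) = 0` as a convention). -/
noncomputable def div (X : Variety k) (f : X.funField) : X.Divisor :=
  Finsupp.ofSupportFinite (fun z => Scheme.ord f z.1) (X.finite_ord f)

open Classical in
/-- The value of a divisor at an arbitrary point, zero away from codimension one. -/
noncomputable def Divisor.coeff {X : Variety k} (D : X.Divisor) (x : X.carrier) : ℤ :=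
  if h : coheight x = 1 then D ⟨x, h⟩ else 0

theorem finite_pullback {X Z : Variety k} (φ : Z.carrier ⟶ X.carrier) [GeometricallyIntegral φ]
    (D : X.Divisor) : {w : Z.PrimeDiv | D.coeff (φ w.1) ≠ 0}.Finite := by
  have hc : ∀ w : Z.PrimeDiv, D.coeff (φ w.1) ≠ 0 → ∃ z : X.PrimeDiv, z ∈ D.support ∧ z.1 = φ w.1 := by
    intro w hw
    unfold Divisor.coeff at hw
    split_ifs at hw with h
    · exact ⟨⟨φ w.1, h⟩, by simpa using hw, rfl⟩
    · exact absurd rfl hw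
  refine Set.Finite.of_finite_image (f := fun w : Z.PrimeDiv => φ w.1)
    ((D.support.finite_toSet.image Subtype.val).subset ?_) ?_
  · rintro _ ⟨w, hw, rfl⟩
    obtain ⟨z, hz, hzw⟩ := hc w hw
    exact ⟨z, hz, hzw⟩
  · intro w hw v hv hwv
    obtain ⟨z, -, hzw⟩ := hc w hw
    have hzv : z.1 = φ v.1 := hzw.trans hwv
    have key : ∀ u : Z.PrimeDiv, z.1 = φ u.1 →
        φ.fiberι z.1 (genericPoint (φ.fiber z.1)) = u.1 := by
      intro u hu
      have hmem : u.1 ∈ Set.range (φ.fiberι z.1) := by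
        rw [φ.range_fiberι]; exact hu.symm
      obtain ⟨y, hy⟩ := hmem
      have hs : φ.fiberι z.1 (genericPoint (φ.fiber z.1)) ⤳ u.1 := by
        rw [← hy]
        exact (genericPoint_specializes y).map (φ.fiberι z.1).continuous
      by_contra hne
      have hlt : u.1 < φ.fiberι z.1 (genericPoint (φ.fiber z.1)) :=
        ⟨hs, fun h => hne (Specializes.antisymm hs h).eq⟩
      have h1 := eq_genericPoint_of_lt Z u hlt
      have h2 : φ (φ.fiberι z.1 (genericPoint (φ.fiber z.1))) = z.1 := by
        have : φ.fiberι z.1 (genericPoint (φ.fiber z.1)) ∈ Set.range (φ.fiberι z.1) := ⟨_, rfl⟩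
        rw [φ.range_fiberι] at this
        exact this
      rw [h1, map_genericPoint φ] at h2
      have h3 := z.2
      rw [← h2, (coheight_eq_zero).mpr
        (fun b _ => (genericPoint_specializes b : genericPoint X.carrier ⤳ b))] at h3
      exact zero_ne_one h3
    exact Subtype.ext ((key w hzw).symm.trans (key v hzv))

/-- The divisor `D × Y = ∑ n_Z (Z × Y)` for `D = ∑ n_Z Z`. Since `Y` is geometrically integral,
`Z × Y` is a prime divisor; a point `w` of codimension one is its generic point if and only if `w`
maps to the generic point of `Z`. -/
noncomputable def timesY {X : Variety k} (D : X.Divisor) (Y : Variety k) : (X.prod Y).Divisor :=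
  Finsupp.ofSupportFinite (fun w => D.coeff (prX X Y w.1)) (finite_pullback (prX X Y) D)

/-- The divisor `X × E = ∑ n_W (X × W)` for `E = ∑ n_W W`. -/
noncomputable def Xtimes (X : Variety k) {Y : Variety k} (E : Y.Divisor) : (X.prod Y).Divisor :=
  Finsupp.ofSupportFinite (fun w => E.coeff (prY X Y w.1)) (finite_pullback (prY X Y) E)

/-- The divisors `D₁, …, D_r` on an `r`-dimensional variety intersect properly: their
set-theoretic intersection has dimension zero (or is empty), i.e. all its points are closed. -/
def IntersectProperly {X : Variety k} {r : ℕ} (D : Fin r → X.Divisor) : Prop :=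
  ∀ x : X.carrier, (∀ l, x ∈ (D l).supp) → IsClosed {x}

/-! ### Rational differential forms -/

/-- The rational differential `r`-forms on `X`, as elements of `⋀^r Ω_{k(X)/k}`. -/
abbrev RForm (X : Variety k) (r : ℕ) : Type u := RatForm.Form k X.funField r

/-- A germ of a regular function, as a rational function. -/
noncomputable abbrev toFun (X : Variety k) (x : X.carrier) : X.localRing x →+* X.funField :=
  algebraMap (X.carrier.presheaf.stalk x) X.carrier.functionField

/-- The form `dx₁ ∧ ⋯ ∧ dx_r` for germs `x₁, …, x_r` at a point. -/
noncomputable def dx (X : Variety k) {z : X.carrier} {r : ℕ} (x : Fin r → X.localRing z) :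
    X.RForm r :=
  RatForm.dWedge k (fun i => X.toFun z (x i))

/-- `x₁, …, x_r` are local coordinates at the point `z` of the smooth `r`-dimensional variety `X`:
their differentials generate (hence form a basis of) the module of differentials
`Ω_{𝒪_z/k}`, which is free of rank `r`. -/
def IsCoordinates (X : Variety k) (z : X.carrier) {r : ℕ} (x : Fin r → X.localRing z) : Prop :=
  Submodule.span (X.localRing z)
    (Set.range fun i => KaehlerDifferential.D k (X.localRing z) (x i)) = ⊤

open Classical in
/-- The coefficient at the prime divisor `z` of the divisor `(ω)` of a rational `r`-form `ω ≠ 0`: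
the order of vanishing of `g`, where `ω = g dx₁ ∧ ⋯ ∧ dx_r` with local coordinates `x` at `z`. -/
noncomputable def formOrd {X : Variety k} {r : ℕ} (ω : X.RForm r) (z : X.PrimeDiv) : ℤ :=
  if h : ∃ (g : X.funField) (x : Fin r → X.localRing z.1),
      X.IsCoordinates z.1 x ∧ ω = g • X.dx x
  then Scheme.ord h.choose z.1 else 0

/-- `Ω^r(D)`: the rational `r`-forms `ω` with `ω = 0` or `(ω) + D ≥ 0`. -/
def formSpace {X : Variety k} (r : ℕ) (D : X.Divisor) : Set (X.RForm r) :=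
  {ω | ω = 0 ∨ ∀ z : X.PrimeDiv, 0 ≤ formOrd ω z + D z}

/-! ### Residues -/

/-- `f` is a local equation at the point `x` of the effective divisor `D`. -/
def IsLocalEquation {X : Variety k} (D : X.Divisor) (x : X.carrier) (f : X.localRing x) : Prop :=
  f ≠ 0 ∧ ∀ z : X.PrimeDiv, z.1 ⤳ x → Scheme.ord (X.toFun x f) z.1 = D z

/-- The local data at a point `p` of `⋂ D_l` that enter the residue: generators `x` of the maximal
ideal, local equations `f_l` of the divisors `D_l`, an exponent `a > 0` and
`x_i^a = ∑_j R_{ij} f_j`. -/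
structure LocalData {X : Variety k} {r : ℕ} (D : Fin r → X.Divisor) (p : X.carrier) where
  /-- The generators `x₁, …, x_r` of the maximal ideal. -/
  x : Fin r → X.localRing p
  span_x : Ideal.span (Set.range x) = IsLocalRing.maximalIdeal (X.localRing p)
  /-- The local equations `f₁, …, f_r`. -/
  f : Fin r → X.localRing p
  isLocalEquation : ∀ l, IsLocalEquation (D l) p (f l)
  /-- The exponent. -/
  a : ℕ
  a_pos : 0 < a
  /-- The coefficients `R_{ij}`. -/
  R : Matrix (Fin r) (Fin r) (X.localRing p)
  pow_eq : ∀ i, x i ^ a = ∑ j, R i j * f j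

/-- `c ∈ k` is the coefficient of the monomial `x^I` in the power series expansion of `g` in the
generators `x` of the maximal ideal at a `k`-rational point: `g` agrees with a polynomial
in `x` up to terms of total degree more than `|I|`, and `c` is the coefficient of `x^I` in
that polynomial. -/
def IsExpansionCoeff {X : Variety k} {r : ℕ} {p : X.carrier} (x : Fin r → X.localRing p)
    (g : X.localRing p) (I : Fin r →₀ ℕ) (c : k) : Prop :=
  ∃ F : MvPolynomial (Fin r) k,
    g - MvPolynomial.aeval x F ∈ IsLocalRing.maximalIdeal (X.localRing p) ^ (I.degree + 1) ∧
    F.coeff I = c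

/-- `c` is the residue at the rational point `P` of `ω` relative to `D₁, …, D_r`: in terms of some
local data, `f₁ ⋯ f_r ω = h dx₁ ∧ ⋯ ∧ dx_r` with `h` regular at `P`, and `c` is the
coefficient of `x₁^{a-1} ⋯ x_r^{a-1}` in the expansion of `det(R) h`. -/
def IsResidue {X : Variety k} {r : ℕ} (D : Fin r → X.Divisor) (P : X.RatPoint) (ω : X.RForm r)
    (c : k) : Prop :=
  ∃ (L : LocalData D P.pt) (h : X.localRing P.pt),
    X.toFun P.pt (∏ l, L.f l) • ω = X.toFun P.pt h • X.dx L.x ∧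
    IsExpansionCoeff L.x (L.R.det * h) (Finsupp.equivFunOnFinite.symm fun _ => L.a - 1) c

open Classical in
/-- The Grothendieck residue of `ω` at the `k`-rational point `P` relative to `D₁, …, D_r`;
the value does not depend on the choices (and is `0` by convention if `f₁ ⋯ f_r ω` is not
regular at `P`). -/
noncomputable def residue {X : Variety k} {r : ℕ} (D : Fin r → X.Divisor) (P : X.RatPoint)
    (ω : X.RForm r) : k :=
  if h : ∃ c, IsResidue D P ω c then h.choose else 0

/-! ### Rectifying functions and rectified differential codes -/

/-- `θ` is regular at `p` and, in terms of some local data at `p`,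
`det(R) θ ≡ c x₁^{a-1} ⋯ x_r^{a-1}` modulo the ideal `(x₁^a, …, x_r^a)`. -/
def RectifiesAt {X : Variety k} {r : ℕ} (D : Fin r → X.Divisor) (p : X.carrier) (θ : X.funField)
    (c : k) : Prop :=
  ∃ (L : LocalData D p) (t : X.localRing p), X.toFun p t = θ ∧
    L.R.det * t - algebraMap k (X.localRing p) c * ∏ i, L.x i ^ (L.a - 1) ∈
      Ideal.span (Set.range fun i => L.x i ^ L.a)

/-- `θ` is `(𝒟, 𝒫)`-rectifying. -/
def IsRectifying {X : Variety k} {r n : ℕ} (D : Fin r → X.Divisor) (P : Fin n → X.RatPoint)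
    (θ : X.funField) : Prop :=
  ∀ p : X.carrier, (∀ l, p ∈ (D l).supp) →
    ((∃ i, (P i).pt = p) → ∃ c : k, RectifiesAt D p θ c) ∧
    ((¬ ∃ i, (P i).pt = p) → RectifiesAt D p θ 0)

/-- `θ` is strictly `(𝒟, 𝒫)`-rectifying. -/
def IsStrictlyRectifying {X : Variety k} {r n : ℕ} (D : Fin r → X.Divisor)
    (P : Fin n → X.RatPoint) (θ : X.funField) : Prop :=
  ∀ p : X.carrier, (∀ l, p ∈ (D l).supp) →
    ((∃ i, (P i).pt = p) → ∃ c : k, c ≠ 0 ∧ RectifiesAt D p θ c) ∧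
    ((¬ ∃ i, (P i).pt = p) → RectifiesAt D p θ 0)

/-- The rectified differential code `C_Ω(𝒟, 𝒫, θ, G)`: the image of
`Ω^r(∑ D_l - G - (θ)⁺)` under `ω ↦ (Res_{P_1} ω, …, Res_{P_n} ω)`. -/
def code {X : Variety k} {r n : ℕ} (D : Fin r → X.Divisor) (P : Fin n → X.RatPoint)
    (θ : X.funField) (G : X.Divisor) : Set (Fin n → k) :=
  (fun ω i => residue D (P i) ω) '' formSpace r ((∑ l, D l) - G - (X.div θ ⊔ 0))

/-! ### Products -/

/-- The family `D₁ × Y, …, D_r × Y, X × E₁, …, X × E_s`. -/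
noncomputable def prodDiv {X Y : Variety k} {r s : ℕ} (D : Fin r → X.Divisor)
    (E : Fin s → Y.Divisor) : Fin (r + s) → (X.prod Y).Divisor :=
  Fin.append (fun l => timesY (D l) Y) (fun l => Xtimes X (E l))

/-- The points `P_i × Q_j`, ordered lexicographically. -/
noncomputable def prodPts {X Y : Variety k} {n m : ℕ} (P : Fin n → X.RatPoint)
    (Q : Fin m → Y.RatPoint) : Fin (n * m) → (X.prod Y).RatPoint :=
  fun l => (P (finProdFinEquiv.symm l).1).prod (Q (finProdFinEquiv.symm l).2)

/-- The rational function `pr_X^*(θ) pr_Y^*(λ)` on `X × Y`. -/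
noncomputable def prodFun {X Y : Variety k} (θ : X.funField) (lam : Y.funField) :
    (X.prod Y).funField :=
  funPull (prX X Y) (prX_str X Y) θ * funPull (prY X Y) (prY_str X Y) lam

/-- The form `pr_X^*(ω) ∧ pr_Y^*(χ)` on `X × Y`. -/
noncomputable def prodForm {X Y : Variety k} {r s : ℕ} (ω : X.RForm r) (χ : Y.RForm s) :
    (X.prod Y).RForm (r + s) :=
  RatForm.wedge (RatForm.pull (funPull (prX X Y) (prX_str X Y)) r ω)
    (RatForm.pull (funPull (prY X Y) (prY_str X Y)) s χ)

end Variety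

/-- The tensor product `C ⊗ C'` of codes of length `n` and `m` in `k^{nm}` (lexicographic order
of coordinates): the span of the Kronecker products `u ⊗ v`. -/
def tensorCode {k : Type u} [Field k] {n m : ℕ} (C : Set (Fin n → k)) (C' : Set (Fin m → k)) :
    Set (Fin (n * m) → k) :=
  (Submodule.span k (Set.image2 (fun (u : Fin n → k) (v : Fin m → k) (l : Fin (n * m)) =>
    u (finProdFinEquiv.symm l).1 * v (finProdFinEquiv.symm l).2) C C') : Set (Fin (n * m) → k))

/-!
The rational functions and forms involved are studied on the local rings of the product, and all
four claims come from three facts: residues do not depend on local data, every prime divisor of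
`X × Y` is generic over one of the factors, and forms on the product whose poles are bounded by a
divisor `B × Y + X × B'` are sums of product forms.

*Residues.* Let `f` be local equations of the `D_l` at a rational point `P`, let `x^a = R f`, and
let `A = 𝒪_P / (f)`, a finite algebra. The functional `ρ` on `A` that takes `h` to the coefficient
of `x^(a-1)` in `det R · h` is recognized by its value on one element of `𝒪_P ⊗ A`: writing
`f_l ⊗ 1 = ∑ M_lj (x_j ⊗ 1 - 1 ⊗ x_j)`, one has `(ρ ⊗ 1)(det M) = 1`
(`PowerExpansion.coeffExt_det_mul_det`), and this property determines `ρ`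
(`LinearMap.eq_of_extendScalarsTensor_eq_one`), because `det M` is killed by the diagonal ideal.
The value is computed by replacing `R M` with a diagonal matrix that agrees with it on the sequence
`x ⊗ 1 - 1 ⊗ x`; the sequence has only Koszul relations, so that the determinants agree up to
negligible terms (`KoszulExact.det_sub_det_mem`). A change of the coordinates multiplies `det M`, on
the diagonal, by the Jacobian determinant, and the transformation law follows
(`PowerExpansion.coeff_det_mul_eq`). The argument divides by no integer, so it holds in every
characteristic. Power series expansions exist at rational points of a smooth variety because the
first-order Taylor expansion lifts by formal smoothness (`PowerExpansion.ofFormallySmooth`).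

The residue can therefore be computed from any local data (`Variety.residue_eq_coeff`). At a point
of `X × Y` over closed points, local data on the factors with a common exponent combine to local
data on the product (`Variety.LocalData.prod`); here the residue fields have to be separable over
`k`, for the two maximal ideals to generate the maximal ideal of the product
(`Variety.IsProduct.maximalIdeal_eq_sup`). The determinant is that of a block diagonal matrix, and
the expansion of a product of functions in separate variables is the product of the expansions. So
residues of product forms (`Variety.residue_prodForm`) and the congruences that define rectifying
functions (`Variety.RectifiesAt.prod`) are multiplicative. The only point over a pair of rational
points is the rational one (`Variety.RatPoint.eq_pt_prod`), so that no point of the product other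
than the `P_i × Q_j` needs a nonzero constant.

*Divisors.* The local ring of `X × Y` at `z` is a localization of `𝒪_x ⊗ 𝒪_y`, where `z` lies over
`x` and `y` (`Variety.IsProduct.isLocalization`). Since primes of `𝒪_x` extend to primes of this
tensor product, a prime divisor that does not dominate `X` lies over a prime divisor of `X`, and is
generic over `Y` (`Variety.IsProduct.coheight_fst`, `Variety.IsProduct.snd_eq_genericPoint`). The
order of a pulled back function along it is the order on `X` (`Variety.IsProduct.ord_pullFst`), and
the divisor of a product form is the sum of the two pulled back divisors
(`Variety.formOrd_prodForm`). The positive part of the divisor of `μ` likewise splits, since at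
each prime divisor at most one of the two summands is nonzero (`Variety.formDivisor_prod`).

*Künneth formula* (`Variety.exists_eq_sum_prodForm`). Relative to a product of coordinate forms,
a form in `Ω^{r+s}(B × Y + X × B')` is a rational function `g` with poles only along divisors
`D × Y` and `X × E`. Such a function lies in `k(X) ⊗ k(Y)`, because the local rings of the product
at the points that are generic over both factors are normal, and are the localizations of
`k(X) ⊗ k(Y)` at its primes (`Variety.IsProduct.exists_funTensor_eq`). If `g = ∑ h_i ⊗ b_i` with linearly independent `b_i`, its
order along `D × Y` bounds the orders of all `h_i` along `D` from below, by a form of Gauss' lemma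
(`Variety.IsProduct.ord_nonneg_of_sum`); the same holds with the factors exchanged. Hence the left
and right components of `g` satisfy the conditions for `B` and for `B'`, and linear algebra over `k`
writes `g` as a sum of products of such components (`TensorProduct.exists_sum_tmul_mem`). As the
residue is linear and multiplicative, the code on the product is the tensor product of the codes.
-/

open scoped TensorProduct

/-! ### Koszul relations and determinants -/

/-- A family `ξ` of ring elements has only Koszul relations: every linear relation `∑ c_p ξ_p = 0`
comes from an alternating matrix. -/
def KoszulExact {S : Type*} [CommRing S] {r : ℕ} (ξ : Fin r → S) : Prop :=
  ∀ c : Fin r → S, ∑ p, c p * ξ p = 0 →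
    ∃ t : Matrix (Fin r) (Fin r) S, (∀ p, t p p = 0) ∧ (∀ p q, t p q = -t q p) ∧
      ∀ p, c p = ∑ q, t p q * ξ q

/-- A weakly regular sequence has only Koszul relations. -/
theorem KoszulExact.of_regular {S : Type*} [CommRing S] {r : ℕ} (ξ : Fin r → S)
    (h : ∀ p : Fin r, ∀ c : S, c * ξ p ∈ Ideal.span (ξ '' {q | q < p}) →
      c ∈ Ideal.span (ξ '' {q | q < p})) : KoszulExact ξ := by
  induction r with
  | zero => exact fun c _ => ⟨0, fun p => p.elim0, fun p => p.elim0, fun p => p.elim0⟩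
  | succ r ih =>
    intro c hc
    have himg : ∀ p : Fin (r + 1), ∀ (p' : Fin r), p = p'.castSucc →
        ξ '' {q | q < p} = (fun i : Fin r => ξ i.castSucc) '' {q | q < p'} := by
      rintro _ p' rfl
      ext y
      constructor
      · rintro ⟨q, hq, rfl⟩
        have hq' : q < p'.castSucc := hq
        have hne : q ≠ Fin.last r := (lt_of_lt_of_le hq' (Fin.le_last _)).ne
        obtain ⟨q', rfl⟩ := Fin.exists_castSucc_eq.mpr hne
        exact ⟨q', Fin.castSucc_lt_castSucc_iff.mp hq', rfl⟩
      · rintro ⟨q, hq, rfl⟩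
        exact ⟨q.castSucc, Fin.castSucc_lt_castSucc_iff.mpr hq, rfl⟩
    have hlast : ξ '' {q | q < Fin.last r} = Set.range (fun i : Fin r => ξ i.castSucc) := by
      ext y
      constructor
      · rintro ⟨q, hq, rfl⟩
        have hq' : q < Fin.last r := hq
        obtain ⟨q', rfl⟩ := Fin.exists_castSucc_eq.mpr hq'.ne
        exact ⟨q', rfl⟩
      · rintro ⟨q, rfl⟩
        exact ⟨q.castSucc, Fin.castSucc_lt_last q, rfl⟩
    rw [Fin.sum_univ_castSucc] at hc
    have hmem : c (Fin.last r) ∈ Ideal.span (ξ '' {q | q < Fin.last r}) := by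
      apply h
      rw [eq_neg_of_add_eq_zero_right hc]
      refine neg_mem (Ideal.sum_mem _ fun i _ => Ideal.mul_mem_left _ _ (Ideal.subset_span ?_))
      exact ⟨i.castSucc, Fin.castSucc_lt_last i, rfl⟩
    rw [hlast, Ideal.mem_span_range_iff_exists_fun] at hmem
    obtain ⟨s, hs⟩ := hmem
    obtain ⟨t, ht0, hta, ht⟩ := ih (fun i => ξ i.castSucc)
      (fun p c hc => by
        rw [← himg _ p rfl] at hc ⊢
        exact h _ c hc) (fun i => c i.castSucc + s i * ξ (Fin.last r)) (by
          rw [← hc, ← hs, Finset.sum_mul, ← Finset.sum_add_distrib]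
          exact Finset.sum_congr rfl fun i _ => by ring)
    refine ⟨fun p q => Fin.lastCases (Fin.lastCases 0 (fun j => s j) q)
      (fun i => Fin.lastCases (-s i) (fun j => t i j) q) p, ?_, ?_, ?_⟩
    · intro p
      refine Fin.lastCases ?_ (fun i => ?_) p
      · simp
      · simp [ht0]
    · intro p q
      refine Fin.lastCases ?_ (fun i => ?_) p <;> refine Fin.lastCases ?_ (fun j => ?_) q
      · simp
      · simp
      · simp
      · simpa using hta i j
    · intro p
      rw [Fin.sum_univ_castSucc]
      refine Fin.lastCases ?_ (fun i => ?_) p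
      · simp [hs]
      · have := ht i
        simp only [Fin.lastCases_castSucc, Fin.lastCases_last]
        rw [← this]
        ring

theorem KoszulExact.map_ringEquiv {S S' : Type*} [CommRing S] [CommRing S'] {r : ℕ}
    {ξ : Fin r → S} (h : KoszulExact ξ) (e : S ≃+* S') : KoszulExact (fun i => e (ξ i)) := by
  intro c hc
  obtain ⟨t, h0, ha, ht⟩ := h (fun i => e.symm (c i)) (by
    apply e.injective
    simpa using hc)
  refine ⟨t.map e, fun p => by simp [h0], fun p q => by
    rw [Matrix.map_apply, Matrix.map_apply, ha p q, map_neg], ?_⟩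
  intro p
  have := congrArg e (ht p)
  simpa using this

theorem MvPolynomial.koszulExact_X {A : Type*} [CommRing A] {r : ℕ} :
    KoszulExact (fun i : Fin r => (MvPolynomial.X i : MvPolynomial (Fin r) A)) := by
  apply KoszulExact.of_regular
  intro p c hc
  rw [MvPolynomial.mem_ideal_span_X_image] at hc ⊢
  intro m hm
  obtain ⟨q, hq, hne⟩ := hc (m + Finsupp.single p 1) (by
    rw [MvPolynomial.mem_support_iff, MvPolynomial.coeff_mul_X]
    exact MvPolynomial.mem_support_iff.mp hm)
  refine ⟨q, hq, ?_⟩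
  have : q ≠ p := ne_of_lt hq
  simpa [Finsupp.single_apply, this.symm] using hne

theorem MvPolynomial.koszulExact_X_sub_C {A : Type*} [CommRing A] {r : ℕ} (t : Fin r → A) :
    KoszulExact (fun i : Fin r => (MvPolynomial.X i - MvPolynomial.C (t i) :
      MvPolynomial (Fin r) A)) := by
  let f : MvPolynomial (Fin r) A →ₐ[A] MvPolynomial (Fin r) A :=
    MvPolynomial.aeval fun i => MvPolynomial.X i - MvPolynomial.C (t i)
  let g : MvPolynomial (Fin r) A →ₐ[A] MvPolynomial (Fin r) A :=
    MvPolynomial.aeval fun i => MvPolynomial.X i + MvPolynomial.C (t i)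
  let e : MvPolynomial (Fin r) A ≃ₐ[A] MvPolynomial (Fin r) A :=
    AlgEquiv.ofAlgHom f g (by ext i; simp [f, g]) (by ext i; simp [f, g])
  have := (MvPolynomial.koszulExact_X (A := A) (r := r)).map_ringEquiv e.toRingEquiv
  convert this using 2 with i
  simp [e, f]

/-- An alternating form paired with a symmetric one gives zero, in every characteristic. -/
theorem sum_alternating_mul_symmetric {S : Type*} [CommRing S] {r : ℕ}
    (t s : Matrix (Fin r) (Fin r) S) (h0 : ∀ p, t p p = 0) (ha : ∀ p q, t p q = -t q p)
    (hs : ∀ p q, s p q = s q p) : ∑ p, ∑ q, t p q * s p q = 0 := by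
  rw [← Finset.sum_product']
  refine Finset.sum_involution (fun a _ => a.swap) ?_ ?_ ?_ ?_
  · rintro ⟨p, q⟩ -
    simp only [Prod.swap]
    rw [ha p q, hs p q]; ring
  · rintro ⟨p, q⟩ - hne heq
    simp only [Prod.swap, Prod.mk.injEq] at heq
    apply hne
    simp [heq.1, h0]
  · simp
  · simp

open Matrix in
/-- Cramer's rule for two matrices that differ in one row, by a Koszul relation of `ξ`. -/
theorem det_updateRow_mem_of_koszul {S : Type*} [CommRing S] {r : ℕ} (ξ : Fin r → S)
    (H : Matrix (Fin r) (Fin r) S) (I : Ideal S) (hH : ∀ i, (H *ᵥ ξ) i ∈ I) (i : Fin r)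
    (t : Matrix (Fin r) (Fin r) S) (h0 : ∀ p, t p p = 0) (ha : ∀ p q, t p q = -t q p) :
    (H.updateRow i (fun p => ∑ q, t p q * ξ q)).det ∈ I := by
  classical
  have hcof : ∀ c : Fin r → S, (H.updateRow i c).det =
      ∑ p, c p * (H.updateRow i (Pi.single p 1)).det := by
    intro c
    conv_lhs => rw [show c = ∑ p, c p • (Pi.single p 1 : Fin r → S) by
      ext j; simp [Finset.sum_apply, Pi.single_apply]]
    have := (Matrix.detRowAlternating (R := S) (n := Fin r)).toMultilinearMap.map_update_sum
      (t := Finset.univ) i (fun p => c p • (Pi.single p 1 : Fin r → S)) H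
    refine this.trans (Finset.sum_congr rfl fun p _ => ?_)
    exact (Matrix.detRowAlternating (R := S) (n := Fin r)).toMultilinearMap.map_update_smul H i _ _
  have key : ∀ p q, (H.updateRow i (Pi.single p 1)).det * ξ q -
      (H.updateRow i (Pi.single q 1)).det * ξ p ∈ I := by
    intro p q
    have h1 : (H.updateRow i (Pi.single p 1)).det * ξ q = ∑ l,
        (H.updateRow i (Pi.single p 1)).adjugate q l *
          ((H.updateRow i (Pi.single p 1)) *ᵥ ξ) l := by
      have := congrFun (congrArg (· *ᵥ ξ) (Matrix.adjugate_mul (H.updateRow i (Pi.single p 1)))) q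
      simp only [← Matrix.mulVec_mulVec] at this
      rw [Matrix.smul_mulVec, Matrix.one_mulVec] at this
      simpa [Matrix.mulVec, dotProduct] using this.symm
    have h2 : (H.updateRow i (Pi.single p 1)).adjugate q i *
          ((H.updateRow i (Pi.single p 1)) *ᵥ ξ) i =
        (H.updateRow i (Pi.single q 1)).det * ξ p := by
      rw [Matrix.adjugate_apply, Matrix.updateRow_idem]
      congr 1
      simp [Matrix.mulVec, dotProduct, Pi.single_apply]
    rw [h1, ← h2, ← Finset.add_sum_erase _ _ (Finset.mem_univ i), add_sub_cancel_left]
    refine Ideal.sum_mem _ fun l hl => Ideal.mul_mem_left _ _ ?_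
    have hli : l ≠ i := (Finset.mem_erase.mp hl).1
    have := hH l
    simpa [Matrix.mulVec, Matrix.updateRow_ne hli] using this
  rw [hcof, ← Ideal.Quotient.eq_zero_iff_mem, map_sum]
  have := sum_alternating_mul_symmetric (S := S ⧸ I)
    (fun p q => Ideal.Quotient.mk I (t p q))
    (fun p q => Ideal.Quotient.mk I ((H.updateRow i (Pi.single p 1)).det * ξ q))
    (fun p => by simp [h0]) (fun p q => by rw [ha p q, map_neg])
    (fun p q => by rw [Ideal.Quotient.eq]; exact key p q)
  rw [← this]
  refine Finset.sum_congr rfl fun p _ => ?_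
  rw [Finset.sum_mul, map_sum]
  refine Finset.sum_congr rfl fun q _ => ?_
  rw [← map_mul]
  congr 1
  ring

open Matrix in
/-- If `ξ` has only Koszul relations, the determinant of a matrix `M` is determined by `M ξ`
modulo the ideal generated by the entries of `M ξ`. -/
theorem KoszulExact.det_sub_det_mem {S : Type*} [CommRing S] {r : ℕ} {ξ : Fin r → S}
    (hξ : KoszulExact ξ) (M N : Matrix (Fin r) (Fin r) S) (hMN : M *ᵥ ξ = N *ᵥ ξ) (I : Ideal S)
    (hI : ∀ i, (M *ᵥ ξ) i ∈ I) : N.det - M.det ∈ I := by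
  classical
  let Hyb : Finset (Fin r) → Matrix (Fin r) (Fin r) S := fun s =>
    Matrix.of fun i p => if i ∈ s then N i p else M i p
  have hHyb : ∀ s, Hyb s *ᵥ ξ = M *ᵥ ξ := by
    intro s
    ext i
    by_cases hi : i ∈ s
    · rw [hMN]; simp [Hyb, Matrix.mulVec, hi]
    · simp [Hyb, Matrix.mulVec, hi]
  suffices h : ∀ s : Finset (Fin r), (Hyb s).det - M.det ∈ I by
    have := h Finset.univ
    rwa [show Hyb Finset.univ = N by ext; simp [Hyb]] at this
  intro s
  induction s using Finset.induction_on with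
  | empty => rw [show Hyb ∅ = M by ext; simp [Hyb], sub_self]; exact I.zero_mem
  | insert i s hi ih =>
    obtain ⟨t, h0, ha, ht⟩ := hξ (fun p => N i p - M i p) (by
      have := congrFun hMN i
      simp only [Matrix.mulVec, dotProduct] at this
      simp [sub_mul, Finset.sum_sub_distrib, this])
    have h1 : Hyb (insert i s) = (Hyb s).updateRow i (M i + fun p => ∑ q, t p q * ξ q) := by
      ext j p
      by_cases hj : j = i
      · subst hj
        simp [Hyb, ← ht]
      · simp [Hyb, hj]
    have h2 : (Hyb s).updateRow i (M i) = Hyb s := by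
      ext j p
      by_cases hj : j = i
      · subst hj
        simp [Hyb, hi]
      · simp [Matrix.updateRow_apply, hj]
    rw [h1, Matrix.det_updateRow_add, h2, add_sub_right_comm]
    exact I.add_mem ih (det_updateRow_mem_of_koszul ξ (Hyb s) I
      (fun j => by rw [hHyb]; exact hI j) i t h0 ha)

/-! ### Power series expansions and residue functionals -/


/-- The data of a power series expansion in `x₁, …, x_r` of the elements of a `k`-algebra `O`:
the `J`-th coefficient as a `k`-linear functional on `O`. -/
structure PowerExpansion (k : Type*) {O : Type*} [Field k] [CommRing O] [Algebra k O] {r : ℕ}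
    (x : Fin r → O) where
  /-- The coefficient of `x^J`. -/
  coeff : (Fin r →₀ ℕ) → (O →ₗ[k] k)
  coeff_aeval : ∀ J F, coeff J (MvPolynomial.aeval x F) = MvPolynomial.coeff J F
  coeff_of_mem : ∀ J, ∀ g ∈ Ideal.span (Set.range x) ^ (J.degree + 1), coeff J g = 0
  exists_approx : ∀ (g : O) (N : ℕ), ∃ F : MvPolynomial (Fin r) k,
    g - MvPolynomial.aeval x F ∈ Ideal.span (Set.range x) ^ N

/-- The `A`-linear functional `O ⊗ A → A` obtained from a linear functional `τ` on `O` by extension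
of scalars. -/
noncomputable def LinearMap.extendScalarsTensor {k O : Type*} [Field k] [CommRing O] [Algebra k O]
    (A : Type*) [CommRing A] [Algebra k A] (τ : O →ₗ[k] k) : O ⊗[k] A →ₗ[k] A :=
  (TensorProduct.lid k A).toLinearMap ∘ₗ τ.rTensor A

section

variable {k O A : Type*} [Field k] [CommRing O] [Algebra k O] [CommRing A] [Algebra k A]
  (τ : O →ₗ[k] k)

@[simp]
theorem LinearMap.extendScalarsTensor_tmul (o : O) (a : A) :
    τ.extendScalarsTensor A (o ⊗ₜ a) = τ o • a := by
  simp [extendScalarsTensor]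

theorem LinearMap.extendScalarsTensor_mul_right (s : O ⊗[k] A) (a : A) :
    τ.extendScalarsTensor A (s * (1 ⊗ₜ a)) = τ.extendScalarsTensor A s * a := by
  induction s using TensorProduct.induction_on with
  | zero => simp
  | tmul o b => simp
  | add s t hs ht => rw [add_mul, map_add, hs, ht, map_add, add_mul]

theorem LinearMap.extendScalarsTensor_mul_left (s : O ⊗[k] A) (o : O) :
    τ.extendScalarsTensor A ((o ⊗ₜ 1) * s) =
      (τ ∘ₗ LinearMap.mulLeft k o).extendScalarsTensor A s := by
  induction s using TensorProduct.induction_on with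
  | zero => simp
  | tmul o b => simp
  | add s t hs ht => rw [mul_add, map_add, hs, ht, map_add]

end

namespace PowerExpansion

variable {k O : Type*} [Field k] [CommRing O] [Algebra k O] {r : ℕ} {x : Fin r → O}
  (E : PowerExpansion k x) (A : Type*) [CommRing A] [Algebra k A]

/-- The coefficient functional `O ⊗ A → A` obtained by extension of scalars. -/
noncomputable abbrev coeffExt (J : Fin r →₀ ℕ) : O ⊗[k] A →ₗ[k] A :=
  (E.coeff J).extendScalarsTensor A

variable (x) in
/-- Evaluation of polynomials over `A` at `x₁ ⊗ 1, …, x_r ⊗ 1`. -/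
noncomputable def evalExt : MvPolynomial (Fin r) A →+* O ⊗[k] A :=
  MvPolynomial.eval₂Hom (Algebra.TensorProduct.includeRight : A →ₐ[k] O ⊗[k] A).toRingHom
    (fun j => x j ⊗ₜ 1)

variable (k x) in
/-- The ideal of `O ⊗ A` generated by `x₁ ⊗ 1, …, x_r ⊗ 1`. -/
noncomputable def idealExt : Ideal (O ⊗[k] A) :=
  (Ideal.span (Set.range x)).map (Algebra.TensorProduct.includeLeft : O →ₐ[k] O ⊗[k] A)

variable {A}

theorem evalExt_C (a : A) : evalExt (k := k) x A (MvPolynomial.C a) = 1 ⊗ₜ a := by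
  simp [evalExt]

theorem evalExt_X (j : Fin r) : evalExt (k := k) x A (MvPolynomial.X j) = x j ⊗ₜ 1 := by
  simp [evalExt]

theorem evalExt_map (F : MvPolynomial (Fin r) k) :
    evalExt (k := k) x A (MvPolynomial.map (algebraMap k A) F) =
      MvPolynomial.aeval x F ⊗ₜ 1 := by
  induction F using MvPolynomial.induction_on with
  | C a =>
    rw [MvPolynomial.map_C, evalExt_C, MvPolynomial.aeval_C, Algebra.algebraMap_eq_smul_one,
      Algebra.algebraMap_eq_smul_one, TensorProduct.tmul_smul, TensorProduct.smul_tmul']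
  | add F G hF hG => rw [map_add, map_add, hF, hG, map_add, TensorProduct.add_tmul]
  | mul_X F i hF =>
    rw [map_mul, map_mul, hF, MvPolynomial.map_X, evalExt_X, map_mul, MvPolynomial.aeval_X,
      Algebra.TensorProduct.tmul_mul_tmul, mul_one]

theorem coeffExt_evalExt (J : Fin r →₀ ℕ) (G : MvPolynomial (Fin r) A) :
    E.coeffExt A J (evalExt x A G) = MvPolynomial.coeff J G := by
  induction G using MvPolynomial.induction_on' with
  | monomial m a =>
    have h : evalExt (k := k) x A (MvPolynomial.monomial m a) =
        MvPolynomial.aeval x (MvPolynomial.monomial m (1 : k)) ⊗ₜ a := by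
      rw [show MvPolynomial.monomial m a = MvPolynomial.map (algebraMap k A)
        (MvPolynomial.monomial m (1 : k)) * MvPolynomial.C a by
          rw [MvPolynomial.map_monomial, map_one, mul_comm, MvPolynomial.C_mul_monomial, mul_one],
        map_mul, evalExt_map, evalExt_C]
      simp
    rw [h, LinearMap.extendScalarsTensor_tmul, E.coeff_aeval, MvPolynomial.coeff_monomial, MvPolynomial.coeff_monomial]
    split_ifs <;> simp
  | add F G hF hG => rw [map_add, map_add, hF, hG, MvPolynomial.coeff_add]

theorem coeffExt_of_mem (J : Fin r →₀ ℕ) {s : O ⊗[k] A} (hs : s ∈ idealExt k x A ^ (J.degree + 1)) :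
    E.coeffExt A J s = 0 := by
  rw [idealExt, ← Ideal.map_pow] at hs
  suffices key : ∀ a : O ⊗[k] A, E.coeffExt A J (a * s) = 0 by simpa using key 1
  refine Submodule.span_induction ?_ (by simp)
    (fun a b _ _ ha hb c => by rw [mul_add, map_add, ha, hb, add_zero]) ?_ hs
  · rintro _ ⟨o, ho, rfl⟩ a
    induction a using TensorProduct.induction_on with
    | zero => simp
    | tmul b c => simp [E.coeff_of_mem J _ (Ideal.mul_mem_left _ b ho)]
    | add s t hs ht => rw [add_mul, map_add, hs, ht, add_zero]
  · intro a s _ h c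
    rw [smul_eq_mul, ← mul_assoc]
    exact h _

include E in
theorem exists_approxExt (s : O ⊗[k] A) (M : ℕ) :
    ∃ G : MvPolynomial (Fin r) A, s - evalExt x A G ∈ idealExt k x A ^ M := by
  induction s using TensorProduct.induction_on with
  | zero => exact ⟨0, by simp⟩
  | tmul o a =>
    obtain ⟨F, hF⟩ := E.exists_approx o M
    refine ⟨MvPolynomial.map (algebraMap k A) F * MvPolynomial.C a, ?_⟩
    rw [map_mul, evalExt_map, evalExt_C, Algebra.TensorProduct.tmul_mul_tmul, mul_one, one_mul,
      ← TensorProduct.sub_tmul, idealExt, ← Ideal.map_pow]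
    have := Ideal.mul_mem_right ((1 : O) ⊗ₜ[k] a) _ (Ideal.mem_map_of_mem
      (Algebra.TensorProduct.includeLeft : O →ₐ[k] O ⊗[k] A) hF)
    simpa using this
  | add s t hs ht =>
    obtain ⟨F, hF⟩ := hs
    obtain ⟨G, hG⟩ := ht
    refine ⟨F + G, ?_⟩
    rw [map_add, add_sub_add_comm]
    exact add_mem hF hG

include E in
theorem mem_pow_of_evalExt_mem {G : MvPolynomial (Fin r) A} {M : ℕ}
    (h : evalExt x A G ∈ idealExt k x A ^ M) : G ∈ MvPolynomial.idealOfVars (Fin r) A ^ M := by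
  rw [MvPolynomial.mem_pow_idealOfVars_iff']
  intro J hJ
  rw [← E.coeffExt_evalExt]
  exact E.coeffExt_of_mem J (Ideal.pow_le_pow_right hJ h)

end PowerExpansion

theorem Ideal.sup_pow_le_sup {S : Type*} [CommRing S] (I J : Ideal S) (n : ℕ) :
    (I ⊔ J) ^ n ≤ I ⊔ J ^ n := by
  induction n with
  | zero => simp
  | succ n ih =>
    rw [pow_succ]
    refine (Ideal.mul_mono_left ih).trans ?_
    rw [Ideal.sup_mul, Ideal.mul_sup (J ^ n)]
    refine sup_le (le_sup_of_le_left Ideal.mul_le_left) (sup_le ?_ ?_)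
    · exact le_sup_of_le_left Ideal.mul_le_right
    · rw [← pow_succ]
      exact le_sup_right

/-- The exponent vector `(b, …, b)`. -/
noncomputable abbrev constExp (r b : ℕ) : Fin r →₀ ℕ := Finsupp.equivFunOnFinite.symm fun _ => b

theorem MvPolynomial.coeff_prod_geom {A : Type*} [CommRing A] {r : ℕ} (t : Fin r → A) (a : ℕ)
    (ha : 0 < a) :
    MvPolynomial.coeff (constExp r (a - 1)) (∏ i : Fin r, ∑ u ∈ Finset.range a,
      (MvPolynomial.X i : MvPolynomial (Fin r) A) ^ u * MvPolynomial.C (t i) ^ (a - 1 - u)) = 1 := by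
  classical
  rw [Finset.prod_univ_sum, MvPolynomial.coeff_sum]
  have hterm : ∀ p : Fin r → ℕ, ∏ i : Fin r, ((MvPolynomial.X i : MvPolynomial (Fin r) A) ^ p i *
      MvPolynomial.C (t i) ^ (a - 1 - p i)) =
      MvPolynomial.monomial (Finsupp.equivFunOnFinite.symm p) (∏ i, t i ^ (a - 1 - p i)) := by
    intro p
    rw [Finset.prod_mul_distrib, mul_comm, MvPolynomial.monomial_eq, map_prod]
    congr 1
    · simp
    · rw [Finsupp.prod_fintype _ _ (by simp)]
      simp
  rw [Finset.sum_eq_single (fun _ => a - 1)]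
  · rw [hterm, MvPolynomial.coeff_monomial, if_pos rfl]
    simp
  · intro p _ hp
    rw [hterm, MvPolynomial.coeff_monomial, if_neg]
    intro h
    exact hp (Finsupp.equivFunOnFinite.symm.injective h)
  · intro h
    refine absurd (Fintype.mem_piFinset.mpr fun i => ?_) h
    simp only [Finset.mem_range]
    omega

open PowerExpansion in
/-- The key identity behind the independence of residues: if `x_i^a = ∑ R_ij f_j` and
`f_l ⊗ 1 = ∑ M_lj (x_j ⊗ 1 - 1 ⊗ t_j)`, the coefficient of `x^(a-1)` in `det R · det M` is `1`.
Indeed `R M` and the diagonal matrix with entries `∑_u x_i^u t_i^(a-1-u)` take the same value at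
the vector `x ⊗ 1 - 1 ⊗ t`, which has only Koszul relations. -/
theorem PowerExpansion.coeffExt_det_mul_det {k O : Type*} [Field k] [CommRing O] [Algebra k O]
    {r : ℕ} {x : Fin r → O} (E : PowerExpansion k x) {A : Type*} [CommRing A] [Algebra k A]
    (t : Fin r → A) (a : ℕ) (ha : 0 < a) (ht : ∀ i, t i ^ a = 0) (f : Fin r → O)
    (R : Matrix (Fin r) (Fin r) O) (hR : ∀ i, x i ^ a = ∑ j, R i j * f j)
    (M : Matrix (Fin r) (Fin r) (O ⊗[k] A))
    (hM : ∀ l, f l ⊗ₜ[k] (1 : A) = ∑ j, M l j * (x j ⊗ₜ[k] (1 : A) - (1 : O) ⊗ₜ[k] t j)) :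
    E.coeffExt A (constExp r (a - 1)) ((R.det ⊗ₜ 1) * M.det) = 1 := by
  classical
  set I := constExp r (a - 1) with hI
  let X' : Ideal (MvPolynomial (Fin r) A) := MvPolynomial.idealOfVars (Fin r) A
  let ξ : Fin r → MvPolynomial (Fin r) A := fun j => MvPolynomial.X j - MvPolynomial.C (t j)
  let Ξ : Ideal (MvPolynomial (Fin r) A) := Ideal.span (Set.range ξ)
  let 𝔫 : Ideal (MvPolynomial (Fin r) A) := Ideal.span (Set.range fun j => MvPolynomial.C (t j))
  obtain ⟨N, hN⟩ : ∃ N, 𝔫 ^ N = ⊥ := by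
    have : IsNilpotent 𝔫 := by
      rw [Ideal.FG.isNilpotent_iff_le_nilradical (Submodule.fg_span (Set.finite_range _)),
        Ideal.span_le]
      rintro _ ⟨j, rfl⟩
      exact ⟨a, by rw [← map_pow, ht, map_zero]; rfl⟩
    exact this
  set d := I.degree + 1 with hd
  have hpow : X' ^ (d + N) ≤ X' ^ d * Ξ := by
    rw [pow_add]
    refine Ideal.mul_mono_right ?_
    have h1 : X' ≤ Ξ ⊔ 𝔫 := by
      refine Ideal.span_le.mpr ?_
      rintro _ ⟨j, rfl⟩
      have := add_mem (S := Ideal (MvPolynomial (Fin r) A))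
        (Ideal.mem_sup_left (S := Ξ) (T := 𝔫) (Ideal.subset_span ⟨j, rfl⟩ : ξ j ∈ Ξ))
        (Ideal.mem_sup_right (S := Ξ) (T := 𝔫)
          (Ideal.subset_span ⟨j, rfl⟩ : MvPolynomial.C (t j) ∈ 𝔫))
      simpa [ξ] using this
    refine (Ideal.pow_right_mono h1 N).trans ((Ideal.sup_pow_le_sup _ _ _).trans ?_)
    rw [hN]
    simp
  choose M' hM' using fun i j => E.exists_approxExt (M i j) (d + N)
  choose R' hR' using fun i j => E.exists_approxExt (A := A) (R i j ⊗ₜ[k] (1 : A)) (d + N)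
  let Mp : Matrix (Fin r) (Fin r) (MvPolynomial (Fin r) A) := Matrix.of M'
  let Rp : Matrix (Fin r) (Fin r) (MvPolynomial (Fin r) A) := Matrix.of R'
  let q := Ideal.Quotient.mk (idealExt k x A ^ (d + N))
  have hMq : (Mp.map (evalExt (k := k) x A)).map q = M.map q := by
    ext i j
    exact (Ideal.Quotient.eq.mpr (hM' i j)).symm
  have hRq : (Rp.map (evalExt (k := k) x A)).map q =
      (R.map (Algebra.TensorProduct.includeLeftRingHom : O →+* O ⊗[k] A)).map q := by
    ext i j
    exact (Ideal.Quotient.eq.mpr (hR' i j)).symm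
  -- the discrepancy between `x_i^a` and `R M ξ`, after lifting to polynomials
  let u : Fin r → MvPolynomial (Fin r) A := fun i => MvPolynomial.X i ^ a - ((Rp * Mp).mulVec ξ) i
  have hξ : ∀ j, evalExt (k := k) x A (ξ j) = x j ⊗ₜ[k] (1 : A) - (1 : O) ⊗ₜ[k] t j := by
    intro j
    simp only [ξ, map_sub, evalExt_X, evalExt_C]
  have hu : ∀ i, u i ∈ X' ^ (d + N) := by
    intro i
    apply E.mem_pow_of_evalExt_mem
    rw [← Ideal.Quotient.eq_zero_iff_mem]
    change q _ = 0
    have h1 : q (evalExt (k := k) x A (((Rp * Mp).mulVec ξ) i)) = q ((x i ^ a) ⊗ₜ[k] (1 : A)) := by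
      have e1 : q (evalExt (k := k) x A (((Rp * Mp).mulVec ξ) i)) =
          (((Rp.map (evalExt (k := k) x A)).map q * (Mp.map (evalExt (k := k) x A)).map q).mulVec
            (fun j => q (evalExt (k := k) x A (ξ j)))) i := by
        rw [← Matrix.map_mul, ← Matrix.map_mul]
        simp only [Matrix.mulVec, dotProduct, map_sum, map_mul, Matrix.map_apply]
      rw [e1, hMq, hRq, ← Matrix.mulVec_mulVec]
      have e2 : (M.map q).mulVec (fun j => q (evalExt (k := k) x A (ξ j))) =
          fun l => q (f l ⊗ₜ[k] (1 : A)) := by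
        ext l
        rw [hM l, map_sum]
        simp [Matrix.mulVec, dotProduct, hξ]
      rw [e2, hR i, TensorProduct.sum_tmul, map_sum]
      simp only [Matrix.mulVec, dotProduct, Matrix.map_apply]
      refine Finset.sum_congr rfl fun j _ => ?_
      rw [← map_mul]
      simp
    simp only [u, map_sub]
    rw [h1]
    simp [evalExt_X]
  have hn : ∀ i, ∃ n : Fin r → MvPolynomial (Fin r) A, (∀ j, n j ∈ X' ^ d) ∧
      u i = ∑ j, n j * ξ j := by
    intro i
    have := hpow (hu i)
    rw [← smul_eq_mul, Submodule.mem_ideal_smul_span_iff_exists_sum] at this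
    obtain ⟨c, hc, hsum⟩ := this
    refine ⟨c, hc, ?_⟩
    rw [← hsum, Finsupp.sum_fintype _ _ (by simp)]
    rfl
  choose n hn hun using hn
  let e : Fin r → MvPolynomial (Fin r) A := fun i => ∑ u ∈ Finset.range a,
      MvPolynomial.X i ^ u * MvPolynomial.C (t i) ^ (a - 1 - u)
  have heξ : ∀ i, e i * ξ i = MvPolynomial.X i ^ a := by
    intro i
    have := (Commute.all (MvPolynomial.X i) (MvPolynomial.C (t i) :
      MvPolynomial (Fin r) A)).geom_sum₂_mul a
    rw [← map_pow, ht, map_zero, sub_zero] at this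
    exact this
  have hdet := (MvPolynomial.koszulExact_X_sub_C t).det_sub_det_mem (Matrix.diagonal e)
    (Rp * Mp + Matrix.of n) (by
      ext1 i
      rw [Matrix.mulVec_diagonal, heξ, Matrix.add_mulVec, Pi.add_apply]
      have : (Matrix.of n).mulVec ξ i = u i := by
        rw [hun]; rfl
      rw [this]
      simp [u, ξ]) (Ideal.span (Set.range fun i => MvPolynomial.X i ^ a)) (by
      intro i
      rw [Matrix.mulVec_diagonal, heξ]
      exact Ideal.subset_span ⟨i, rfl⟩)
  have hkill : ∀ G ∈ Ideal.span (Set.range fun i : Fin r =>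
      (MvPolynomial.X i : MvPolynomial (Fin r) A) ^ a), MvPolynomial.coeff I G = 0 := by
    intro G hG
    rw [Ideal.mem_span_range_iff_exists_fun] at hG
    obtain ⟨c, rfl⟩ := hG
    rw [MvPolynomial.coeff_sum]
    refine Finset.sum_eq_zero fun i _ => ?_
    rw [MvPolynomial.X_pow_eq_monomial, MvPolynomial.coeff_mul_monomial', if_neg]
    intro h
    have := h i
    simp [I] at this
    omega
  have h1 := hkill _ hdet
  rw [MvPolynomial.coeff_sub, Matrix.det_diagonal, MvPolynomial.coeff_prod_geom t a ha,
    sub_eq_zero] at h1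
  have h2 : (Rp * Mp + Matrix.of n).det - (Rp * Mp).det ∈ X' ^ d := by
    rw [← Ideal.Quotient.eq_zero_iff_mem, map_sub, RingHom.map_det, RingHom.map_det, sub_eq_zero]
    congr 1
    ext i j
    simp only [RingHom.mapMatrix_apply, Matrix.map_apply, Matrix.add_apply, map_add, Matrix.of_apply]
    rw [Ideal.Quotient.eq_zero_iff_mem.mpr (hn i j), add_zero]
  rw [MvPolynomial.mem_pow_idealOfVars_iff'] at h2
  have h3 := h2 I (by omega)
  rw [MvPolynomial.coeff_sub, h1, sub_eq_zero] at h3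
  refine Eq.trans ?_ h3.symm
  rw [← E.coeffExt_evalExt, ← sub_eq_zero, ← map_sub]
  apply E.coeffExt_of_mem
  refine Ideal.pow_le_pow_right (Nat.le_add_right d N) ?_
  rw [← Ideal.Quotient.eq]
  change q _ = q _
  have hRd : (R.det ⊗ₜ[k] (1 : A)) =
      (R.map (Algebra.TensorProduct.includeLeftRingHom : O →+* O ⊗[k] A)).det := by
    rw [← RingHom.mapMatrix_apply, ← RingHom.map_det]
    rfl
  rw [Matrix.det_mul, map_mul, map_mul (evalExt x A), map_mul q, hRd]
  simp only [RingHom.map_det, RingHom.mapMatrix_apply]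
  rw [hMq, hRq]

namespace PowerExpansion

variable {k O : Type*} [Field k] [CommRing O] [Algebra k O] {r : ℕ} {x : Fin r → O}

theorem coeff_constExp_pow_mul (E : PowerExpansion k x) {a : ℕ} (ha : 0 < a) (i : Fin r) (g : O) :
    E.coeff (constExp r (a - 1)) (x i ^ a * g) = 0 := by
  obtain ⟨F, hF⟩ := E.exists_approx g ((constExp r (a - 1)).degree + 1)
  have h1 : x i ^ a * g = MvPolynomial.aeval x (MvPolynomial.X i ^ a * F) +
      x i ^ a * (g - MvPolynomial.aeval x F) := by
    simp only [map_mul, map_pow, MvPolynomial.aeval_X]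
    ring
  rw [h1, map_add, E.coeff_aeval, E.coeff_of_mem _ _ (Ideal.mul_mem_left _ _ hF), add_zero,
    mul_comm, MvPolynomial.X_pow_eq_monomial, MvPolynomial.coeff_mul_monomial', if_neg]
  intro h
  have := h i
  simp at this
  omega

/-- The functional `h ↦ (coefficient of x^(a-1) in det R · h)` kills the ideal `(f)`. -/
theorem coeff_det_mul_mul_eq_zero (E : PowerExpansion k x) {a : ℕ} (ha : 0 < a) {f : Fin r → O}
    {R : Matrix (Fin r) (Fin r) O} (hR : ∀ i, x i ^ a = ∑ j, R i j * f j) (l : Fin r) (g : O) :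
    E.coeff (constExp r (a - 1)) (R.det * (f l * g)) = 0 := by
  have h1 : R.det * f l = ∑ i, R.adjugate l i * x i ^ a := by
    have h := congrFun (congrArg (fun M => M.mulVec f) R.adjugate_mul) l
    simp only [← Matrix.mulVec_mulVec] at h
    rw [Matrix.smul_mulVec, Matrix.one_mulVec] at h
    simp only [Pi.smul_apply, smul_eq_mul] at h
    rw [← h]
    simp only [Matrix.mulVec, dotProduct]
    exact Finset.sum_congr rfl fun i _ => by rw [hR i]
  rw [← mul_assoc, h1, Finset.sum_mul, map_sum]
  refine Finset.sum_eq_zero fun i _ => ?_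
  rw [mul_comm (R.adjugate l i), mul_assoc]
  exact E.coeff_constExp_pow_mul ha i _

/-- The kernel of `O ⊗ A → A` is generated by the elements `x_j ⊗ 1 - 1 ⊗ x_j`. -/
theorem tmul_sub_mem (E : PowerExpansion k x) {A : Type*} [CommRing A] [Algebra k A]
    (φ : O →ₐ[k] A) (hnil : ∀ j, IsNilpotent (φ (x j))) (o : O) :
    o ⊗ₜ[k] (1 : A) - (1 : O) ⊗ₜ[k] φ o ∈
      Ideal.span (Set.range fun j => x j ⊗ₜ[k] (1 : A) - (1 : O) ⊗ₜ[k] φ (x j)) := by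
  set Ξ := Ideal.span (Set.range fun j => x j ⊗ₜ[k] (1 : A) - (1 : O) ⊗ₜ[k] φ (x j)) with hΞ
  let 𝔫 : Ideal A := Ideal.span (Set.range fun j => φ (x j))
  obtain ⟨N, hN⟩ : ∃ N, 𝔫 ^ N = ⊥ := by
    have : IsNilpotent 𝔫 := by
      rw [Ideal.FG.isNilpotent_iff_le_nilradical (Submodule.fg_span (Set.finite_range _)),
        Ideal.span_le]
      rintro _ ⟨j, rfl⟩
      exact hnil j
    exact this
  obtain ⟨F, hF⟩ := E.exists_approx o N
  have hpoly : MvPolynomial.aeval x F ⊗ₜ[k] (1 : A) - (1 : O) ⊗ₜ[k] φ (MvPolynomial.aeval x F) ∈ Ξ := by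
    have : ((Ideal.Quotient.mkₐ k Ξ).comp Algebra.TensorProduct.includeLeft).comp
        (MvPolynomial.aeval x) = ((Ideal.Quotient.mkₐ k Ξ).comp
        ((Algebra.TensorProduct.includeRight : A →ₐ[k] O ⊗[k] A).comp φ)).comp
        (MvPolynomial.aeval x) := by
      ext j
      simp only [AlgHom.comp_apply, MvPolynomial.aeval_X]
      exact Ideal.Quotient.eq.mpr (Ideal.subset_span ⟨j, rfl⟩)
    exact Ideal.Quotient.eq.mp (DFunLike.congr_fun this F)
  have hφ : φ (o - MvPolynomial.aeval x F) = 0 := by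
    have h := Ideal.mem_map_of_mem φ hF
    rw [Ideal.map_pow, Ideal.map_span, ← Set.range_comp] at h
    change _ ∈ 𝔫 ^ N at h
    rw [hN] at h
    exact h
  have hrem : (o - MvPolynomial.aeval x F) ⊗ₜ[k] (1 : A) ∈ Ξ := by
    let il : O →ₐ[k] O ⊗[k] A := Algebra.TensorProduct.includeLeft
    let ir : A →ₐ[k] O ⊗[k] A := Algebra.TensorProduct.includeRight
    have h1 : (Ideal.span (Set.range x)).map il ≤ Ξ ⊔ 𝔫.map ir := by
      rw [Ideal.map_span, Ideal.span_le]
      rintro _ ⟨_, ⟨j, rfl⟩, rfl⟩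
      have := add_mem (S := Ideal (O ⊗[k] A))
        (Ideal.mem_sup_left (S := Ξ) (T := 𝔫.map ir) (Ideal.subset_span ⟨j, rfl⟩))
        (Ideal.mem_sup_right (S := Ξ) (T := 𝔫.map ir)
          (Ideal.mem_map_of_mem ir (Ideal.subset_span ⟨j, rfl⟩)))
      simpa [ir, il] using this
    have h2 := Ideal.mem_map_of_mem il hF
    rw [Ideal.map_pow] at h2
    have h3 := (Ideal.pow_right_mono h1 N).trans (Ideal.sup_pow_le_sup _ _ _) h2
    rw [← Ideal.map_pow, hN, Ideal.map_bot, sup_bot_eq] at h3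
    exact h3
  have : o ⊗ₜ[k] (1 : A) - (1 : O) ⊗ₜ[k] φ o =
      (MvPolynomial.aeval x F ⊗ₜ[k] (1 : A) - (1 : O) ⊗ₜ[k] φ (MvPolynomial.aeval x F)) +
      (o - MvPolynomial.aeval x F) ⊗ₜ[k] (1 : A) := by
    rw [map_sub, sub_eq_zero] at hφ
    rw [hφ, TensorProduct.sub_tmul]
    ring
  rw [this]
  exact add_mem hpoly hrem

theorem finite_of_isNilpotent (E : PowerExpansion k x) {A : Type*} [CommRing A] [Algebra k A]
    (φ : O →ₐ[k] A) (hφ : Function.Surjective φ) (hnil : ∀ j, IsNilpotent (φ (x j))) :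
    Module.Finite k A := by
  let 𝔫 : Ideal A := Ideal.span (Set.range fun j => φ (x j))
  obtain ⟨N, hN⟩ : ∃ N, 𝔫 ^ N = ⊥ := by
    have : IsNilpotent 𝔫 := by
      rw [Ideal.FG.isNilpotent_iff_le_nilradical (Submodule.fg_span (Set.finite_range _)),
        Ideal.span_le]
      rintro _ ⟨j, rfl⟩
      exact hnil j
    exact this
  have htop : Algebra.adjoin k (Set.range fun j => φ (x j)) = ⊤ := by
    rw [eq_top_iff]
    rintro b -
    obtain ⟨o, rfl⟩ := hφ b
    obtain ⟨F, hF⟩ := E.exists_approx o N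
    have h := Ideal.mem_map_of_mem φ hF
    rw [Ideal.map_pow, Ideal.map_span, ← Set.range_comp] at h
    change _ ∈ 𝔫 ^ N at h
    rw [hN, Ideal.mem_bot, map_sub, sub_eq_zero] at h
    rw [h, Algebra.adjoin_range_eq_range_aeval]
    have hcomp : φ.comp (MvPolynomial.aeval x) = MvPolynomial.aeval (fun j => φ (x j)) := by
      ext j
      simp
    exact ⟨F, (DFunLike.congr_fun hcomp F).symm⟩
  have := fg_adjoin_of_finite (Set.finite_range fun j => φ (x j)) (R := k) (by
    rintro _ ⟨j, rfl⟩
    obtain ⟨n, hn⟩ := hnil j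
    exact ⟨Polynomial.X ^ n, Polynomial.monic_X_pow n, by simp [hn]⟩)
  rw [htop] at this
  exact ⟨this⟩

end PowerExpansion

/-- A functional `ρ` on a finite algebra `A = O / 𝔞` is determined by `(ρ ⊗ 1)(Δ)` if `Δ ∈ O ⊗ A` is
killed by the diagonal ideal modulo `𝔞 ⊗ A`, and some `ρ` has `(ρ ⊗ 1)(Δ) = 1`. -/
theorem LinearMap.eq_of_extendScalarsTensor_eq_one {k O A : Type*} [Field k] [CommRing O]
    [Algebra k O] [CommRing A] [Algebra k A] [Module.Finite k A] (φ : O →ₐ[k] A)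
    (hφ : Function.Surjective φ) (Δ : O ⊗[k] A)
    (hΔ : ∀ (ρ : A →ₗ[k] k) (o : O), (ρ ∘ₗ φ.toLinearMap).extendScalarsTensor A
      ((o ⊗ₜ 1 - 1 ⊗ₜ φ o) * Δ) = 0)
    (ρ₁ ρ₂ : A →ₗ[k] k) (h₁ : (ρ₁ ∘ₗ φ.toLinearMap).extendScalarsTensor A Δ = 1)
    (h₂ : (ρ₂ ∘ₗ φ.toLinearMap).extendScalarsTensor A Δ = 1) : ρ₁ = ρ₂ := by
  let Φ : Module.Dual k A →ₗ[k] A :=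
    { toFun := fun ρ => (ρ ∘ₗ φ.toLinearMap).extendScalarsTensor A Δ
      map_add' := fun ρ ρ' => by
        simp [extendScalarsTensor, LinearMap.add_comp, LinearMap.rTensor_add]
      map_smul' := fun c ρ => by
        simp [extendScalarsTensor, LinearMap.smul_comp, LinearMap.rTensor_smul] }
  have hsurj : Function.Surjective Φ := by
    intro b
    obtain ⟨o, rfl⟩ := hφ b
    refine ⟨ρ₁ ∘ₗ LinearMap.mulLeft k (φ o), ?_⟩
    have h := hΔ ρ₁ o
    rw [sub_mul, map_sub, sub_eq_zero, mul_comm ((1 : O) ⊗ₜ[k] φ o),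
      extendScalarsTensor_mul_right, extendScalarsTensor_mul_left, h₁, one_mul] at h
    refine Eq.trans ?_ h
    change ((ρ₁ ∘ₗ LinearMap.mulLeft k (φ o)) ∘ₗ φ.toLinearMap).extendScalarsTensor A Δ = _
    congr 2
    ext o'
    simp
  have hinj : Function.Injective Φ :=
    (LinearMap.injective_iff_surjective_of_finrank_eq_finrank Subspace.dual_finrank_eq).mpr hsurj
  exact hinj (h₁.trans h₂.symm)

/-- Leibniz rule for the extension of a derivation of `O` to `O ⊗ A`, along the diagonal. -/
theorem Derivation.rTensor_diagonal_mul {k O A : Type*} [Field k] [CommRing O] [Algebra k O]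
    [CommRing A] [Algebra k A] (φ : O →ₐ[k] A) (d : Derivation k O O) (s t : O ⊗[k] A) :
    Algebra.TensorProduct.lift φ (AlgHom.id k A) (fun _ _ => Commute.all _ _)
      (d.toLinearMap.rTensor A (s * t)) =
    Algebra.TensorProduct.lift φ (AlgHom.id k A) (fun _ _ => Commute.all _ _) s *
      Algebra.TensorProduct.lift φ (AlgHom.id k A) (fun _ _ => Commute.all _ _)
        (d.toLinearMap.rTensor A t) +
    Algebra.TensorProduct.lift φ (AlgHom.id k A) (fun _ _ => Commute.all _ _) t *
      Algebra.TensorProduct.lift φ (AlgHom.id k A) (fun _ _ => Commute.all _ _)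
        (d.toLinearMap.rTensor A s) := by
  induction s using TensorProduct.induction_on with
  | zero => simp
  | add s s' hs hs' => simp only [add_mul, mul_add, map_add, hs, hs']; ring
  | tmul o a =>
    induction t using TensorProduct.induction_on with
    | zero => simp
    | add s s' hs hs' => simp only [add_mul, mul_add, map_add, hs, hs']; ring
    | tmul o' a' =>
      simp
      ring

namespace PowerExpansion

variable {k O : Type*} [Field k] [CommRing O] [Algebra k O] {r : ℕ} {x y : Fin r → O}

/-- Transformation law for residues: the coefficient of `x^(a-1)` in `det R · h`, where
`x^a = R f`, equals the coefficient of `y^(b-1)` in `det R' · J h`, where `y^b = R' f` and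
`J` is the Jacobian determinant of `x` with respect to `y`. -/
theorem coeff_det_mul_eq (E : PowerExpansion k x) (E' : PowerExpansion k y) {a b : ℕ} (ha : 0 < a)
    (hb : 0 < b) {f : Fin r → O} {R R' : Matrix (Fin r) (Fin r) O}
    (hR : ∀ i, x i ^ a = ∑ j, R i j * f j) (hR' : ∀ i, y i ^ b = ∑ j, R' i j * f j)
    (d : Fin r → Derivation k O O) (hd : ∀ j l, d l (y j) = if j = l then 1 else 0) (h : O) :
    E.coeff (constExp r (a - 1)) (R.det * h) = E'.coeff (constExp r (b - 1))
      (R'.det * ((Matrix.of fun i l => d l (x i)).det * h)) := by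
  classical
  let 𝔞 : Ideal O := Ideal.span (Set.range f)
  let A := O ⧸ 𝔞
  let φ : O →ₐ[k] A := Ideal.Quotient.mkₐ k 𝔞
  have hφ : Function.Surjective φ := Ideal.Quotient.mkₐ_surjective k 𝔞
  have hf : ∀ l, φ (f l) = 0 := fun l =>
    Ideal.Quotient.eq_zero_iff_mem.mpr (Ideal.subset_span ⟨l, rfl⟩)
  have hx0 : ∀ i, φ (x i) ^ a = 0 := fun i => by rw [← map_pow, hR]; simp [hf]
  have hy0 : ∀ i, φ (y i) ^ b = 0 := fun i => by rw [← map_pow, hR']; simp [hf]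
  have hfin : Module.Finite k A := E.finite_of_isNilpotent φ hφ fun j => ⟨a, hx0 j⟩
  have kx := E.tmul_sub_mem φ fun j => ⟨a, hx0 j⟩
  have ky := E'.tmul_sub_mem φ fun j => ⟨b, hy0 j⟩
  have hM : ∀ l, ∃ M : Fin r → O ⊗[k] A, f l ⊗ₜ[k] (1 : A) =
      ∑ j, M j * (x j ⊗ₜ[k] (1 : A) - (1 : O) ⊗ₜ[k] φ (x j)) := by
    intro l
    have := kx (f l)
    rw [hf, TensorProduct.tmul_zero, sub_zero, Ideal.mem_span_range_iff_exists_fun] at this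
    obtain ⟨c, hc⟩ := this
    exact ⟨c, hc.symm⟩
  have hC : ∀ i, ∃ C : Fin r → O ⊗[k] A, x i ⊗ₜ[k] (1 : A) - (1 : O) ⊗ₜ[k] φ (x i) =
      ∑ j, C j * (y j ⊗ₜ[k] (1 : A) - (1 : O) ⊗ₜ[k] φ (y j)) := by
    intro i
    have := ky (x i)
    rw [Ideal.mem_span_range_iff_exists_fun] at this
    obtain ⟨c, hc⟩ := this
    exact ⟨c, hc.symm⟩
  choose M hM using hM
  choose C hC using hC
  let Mm : Matrix (Fin r) (Fin r) (O ⊗[k] A) := Matrix.of M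
  let Cm : Matrix (Fin r) (Fin r) (O ⊗[k] A) := Matrix.of C
  have hMC : ∀ l, f l ⊗ₜ[k] (1 : A) =
      ∑ j, (Mm * Cm) l j * (y j ⊗ₜ[k] (1 : A) - (1 : O) ⊗ₜ[k] φ (y j)) := by
    intro l
    rw [hM l]
    simp only [hC, Matrix.mul_apply, Finset.mul_sum, Finset.sum_mul]
    rw [Finset.sum_comm]
    exact Finset.sum_congr rfl fun j _ => Finset.sum_congr rfl fun i _ => by
      simp only [Mm, Cm, Matrix.of_apply]; ring
  let μ : O ⊗[k] A →ₐ[k] A :=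
    Algebra.TensorProduct.lift φ (AlgHom.id k A) (fun _ _ => Commute.all _ _)
  have hμ : ∀ s : O ⊗[k] A, s - 1 ⊗ₜ μ s ∈
      Ideal.span (Set.range fun j => x j ⊗ₜ[k] (1 : A) - (1 : O) ⊗ₜ[k] φ (x j)) := by
    intro s
    induction s using TensorProduct.induction_on with
    | zero => simp
    | tmul o c =>
      have : o ⊗ₜ[k] c - 1 ⊗ₜ μ (o ⊗ₜ[k] c) =
          (o ⊗ₜ[k] (1 : A) - (1 : O) ⊗ₜ[k] φ o) * ((1 : O) ⊗ₜ[k] c) := by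
        simp [μ, sub_mul]
      rw [this]
      exact Ideal.mul_mem_right _ _ (kx o)
    | add s t hs ht =>
      rw [map_add, TensorProduct.tmul_add, add_sub_add_comm]
      exact add_mem hs ht
  let J : Matrix (Fin r) (Fin r) O := Matrix.of fun i l => d l (x i)
  have hμC : μ Cm.det = φ J.det := by
    rw [AlgHom.map_det, AlgHom.map_det]
    congr 1
    ext i l
    have h1 := congrArg (fun s => μ ((d l).toLinearMap.rTensor A s)) (hC i)
    have hμξ : ∀ j, μ (y j ⊗ₜ[k] (1 : A) - (1 : O) ⊗ₜ[k] φ (y j)) = 0 := by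
      intro j
      simp [μ]
    simp only [map_sum] at h1
    have h2 : ∀ j, μ ((d l).toLinearMap.rTensor A
        (C i j * (y j ⊗ₜ[k] (1 : A) - (1 : O) ⊗ₜ[k] φ (y j)))) =
        if j = l then μ (C i j) else 0 := by
      intro j
      rw [Derivation.rTensor_diagonal_mul φ (d l)]
      change μ _ * _ + μ _ * _ = _
      rw [hμξ, zero_mul, add_zero]
      simp only [map_sub, LinearMap.rTensor_tmul, Derivation.coeFn_coe, hd,
        Derivation.map_one_eq_zero, TensorProduct.zero_tmul, sub_zero]
      split_ifs <;> simp
    simp only [h2, Finset.sum_ite_eq', Finset.mem_univ, if_true] at h1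
    simp only [AlgHom.mapMatrix_apply, Matrix.map_apply]
    change μ (C i l) = φ (d l (x i))
    rw [← h1]
    simp [μ]
  let τx : O →ₗ[k] k := E.coeff (constExp r (a - 1)) ∘ₗ LinearMap.mulLeft k R.det
  let τy : O →ₗ[k] k := E'.coeff (constExp r (b - 1)) ∘ₗ LinearMap.mulLeft k R'.det
  have hτx : ∀ g ∈ 𝔞, τx g = 0 := by
    intro g hg
    rw [Ideal.mem_span_range_iff_exists_fun] at hg
    obtain ⟨c, rfl⟩ := hg
    rw [map_sum]
    refine Finset.sum_eq_zero fun l _ => ?_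
    rw [mul_comm]
    exact E.coeff_det_mul_mul_eq_zero ha hR l _
  have hτy : ∀ g ∈ 𝔞, τy g = 0 := by
    intro g hg
    rw [Ideal.mem_span_range_iff_exists_fun] at hg
    obtain ⟨c, rfl⟩ := hg
    rw [map_sum]
    refine Finset.sum_eq_zero fun l _ => ?_
    rw [mul_comm]
    exact E'.coeff_det_mul_mul_eq_zero hb hR' l _
  let τy' : O →ₗ[k] k := τy ∘ₗ LinearMap.mulLeft k J.det
  let lift : (τ : O →ₗ[k] k) → (∀ g ∈ 𝔞, τ g = 0) → (A →ₗ[k] k) := fun τ hτ =>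
    (Submodule.liftQ (𝔞.restrictScalars k) τ hτ)
  have hlift : ∀ τ hτ, lift τ hτ ∘ₗ φ.toLinearMap = τ := by
    intro τ hτ
    ext o
    rfl
  have hkill : ∀ (ρ : A →ₗ[k] k) (s : O ⊗[k] A),
      s ∈ Ideal.span (Set.range fun j => x j ⊗ₜ[k] (1 : A) - (1 : O) ⊗ₜ[k] φ (x j)) →
      (ρ ∘ₗ φ.toLinearMap).extendScalarsTensor A (s * Mm.det) = 0 := by
    have hf0 : ∀ (ρ : A →ₗ[k] k) (l : Fin r) (s : O ⊗[k] A),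
        (ρ ∘ₗ φ.toLinearMap).extendScalarsTensor A ((f l ⊗ₜ 1) * s) = 0 := by
      intro ρ l s
      rw [LinearMap.extendScalarsTensor_mul_left]
      have : (ρ ∘ₗ φ.toLinearMap) ∘ₗ LinearMap.mulLeft k (f l) = 0 := by
        ext o
        simp [hf]
      rw [this]
      simp [LinearMap.extendScalarsTensor]
    intro ρ s hs
    rw [Ideal.mem_span_range_iff_exists_fun] at hs
    obtain ⟨c, rfl⟩ := hs
    rw [Finset.sum_mul, map_sum]
    refine Finset.sum_eq_zero fun j _ => ?_
    have h1 : (x j ⊗ₜ[k] (1 : A) - (1 : O) ⊗ₜ[k] φ (x j)) * Mm.det =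
        ∑ l, Mm.adjugate j l * f l ⊗ₜ[k] (1 : A) := by
      have h := congrFun (congrArg (fun M => M.mulVec
        (fun j => x j ⊗ₜ[k] (1 : A) - (1 : O) ⊗ₜ[k] φ (x j))) Mm.adjugate_mul) j
      simp only [← Matrix.mulVec_mulVec] at h
      rw [Matrix.smul_mulVec, Matrix.one_mulVec] at h
      simp only [Pi.smul_apply, smul_eq_mul] at h
      rw [mul_comm, ← h]
      simp only [Matrix.mulVec, dotProduct]
      exact Finset.sum_congr rfl fun i _ => by rw [hM i]; rfl
    rw [mul_assoc, h1, Finset.mul_sum, map_sum]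
    refine Finset.sum_eq_zero fun l _ => ?_
    rw [← mul_assoc, mul_comm]
    exact hf0 _ _ _
  have H1 : τx.extendScalarsTensor A Mm.det = 1 := by
    rw [← LinearMap.extendScalarsTensor_mul_left]
    exact E.coeffExt_det_mul_det _ a ha hx0 f R hR Mm hM
  have H2 : τy.extendScalarsTensor A (Mm * Cm).det = 1 := by
    rw [← LinearMap.extendScalarsTensor_mul_left]
    exact E'.coeffExt_det_mul_det _ b hb hy0 f R' hR' (Mm * Cm) hMC
  have H3 : τy'.extendScalarsTensor A Mm.det = 1 := by
    have e1 := hkill (lift τy hτy) _ (hμ Cm.det)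
    have e2 := hkill (lift τy hτy) _ (kx J.det)
    rw [hlift, sub_mul, map_sub, sub_eq_zero] at e1 e2
    rw [← LinearMap.extendScalarsTensor_mul_left, e2, ← hμC, ← e1, mul_comm, ← Matrix.det_mul]
    exact H2
  have hτy' : ∀ g ∈ 𝔞, τy' g = 0 := fun g hg => hτy _ (Ideal.mul_mem_left _ _ hg)
  have hfinal := LinearMap.eq_of_extendScalarsTensor_eq_one φ hφ Mm.det
    (fun ρ o => hkill ρ _ (kx o)) (lift τx hτx) (lift τy' hτy')
    (by rw [hlift]; exact H1) (by rw [hlift]; exact H3)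
  have := congrArg (fun ρ => ρ ∘ₗ φ.toLinearMap) hfinal
  simp only [hlift] at this
  exact DFunLike.congr_fun this h

end PowerExpansion

/-! ### Power series expansions in formally smooth algebras -/

section Expansion

variable {k O : Type u} [Field k] [CommRing O] [Algebra k O] {r : ℕ} {x : Fin r → O}
  (ev : O →ₐ[k] k) (d : Fin r → Derivation k O O)

/-- The first-order Taylor expansion `o ↦ o(0) + ∑ (∂_l o)(0) X_l` at a rational point. -/
noncomputable def taylorOne : O →ₐ[k]
    MvPolynomial (Fin r) k ⧸ MvPolynomial.idealOfVars (Fin r) k ^ 2 :=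
  AlgHom.ofLinearMap
    { toFun := fun o => Ideal.Quotient.mk _ (MvPolynomial.C (ev o) +
        ∑ l, MvPolynomial.C (ev (d l o)) * MvPolynomial.X l)
      map_add' := fun a b => by
        simp only [map_add, add_mul, Finset.sum_add_distrib]
        ring
      map_smul' := fun c a => by
        simp only [map_smul, Derivation.map_smul, RingHom.id_apply, smul_eq_mul, MvPolynomial.C_mul,
          mul_assoc, ← Finset.mul_sum, ← mul_add]
        rw [← MvPolynomial.smul_eq_C_mul]
        rfl }
    (by simp)
    (fun a b => by
      change Ideal.Quotient.mk _ _ = Ideal.Quotient.mk _ _ * Ideal.Quotient.mk _ _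
      rw [← map_mul, Ideal.Quotient.eq]
      set La := ∑ l, MvPolynomial.C (ev (d l a)) * (MvPolynomial.X l : MvPolynomial (Fin r) k)
      set Lb := ∑ l, MvPolynomial.C (ev (d l b)) * (MvPolynomial.X l : MvPolynomial (Fin r) k)
      have hmem : ∀ c : Fin r → k, ∑ l, MvPolynomial.C (c l) * (MvPolynomial.X l) ∈
          MvPolynomial.idealOfVars (Fin r) k := fun c =>
        Ideal.sum_mem _ fun l _ => Ideal.mul_mem_left _ _ (Ideal.subset_span ⟨l, rfl⟩)
      have h : ∑ l, MvPolynomial.C (ev (d l (a * b))) *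
          (MvPolynomial.X l : MvPolynomial (Fin r) k) =
          MvPolynomial.C (ev a) * Lb + MvPolynomial.C (ev b) * La := by
        simp only [La, Lb, Finset.mul_sum, ← Finset.sum_add_distrib]
        refine Finset.sum_congr rfl fun l _ => ?_
        simp only [Derivation.leibniz, smul_eq_mul, map_add, map_mul]
        ring
      rw [h, map_mul, map_mul]
      have : MvPolynomial.C (ev a) * MvPolynomial.C (ev b) + (MvPolynomial.C (ev a) * Lb +
          MvPolynomial.C (ev b) * La) - (MvPolynomial.C (ev a) + La) *
          (MvPolynomial.C (ev b) + Lb) = -(La * Lb) := by ring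
      rw [this, pow_two]
      exact neg_mem (Ideal.mul_mem_mul (hmem _) (hmem _)))

theorem taylorOne_apply (o : O) : taylorOne ev d o = Ideal.Quotient.mk _ (MvPolynomial.C (ev o) +
        ∑ l, MvPolynomial.C (ev (d l o)) * MvPolynomial.X l) := rfl

/-- By formal smoothness the first-order Taylor expansion lifts to any finite order, with `x_i`
mapping to `X_i` up to terms of higher order. -/
theorem exists_algHom_truncated [Algebra.FormallySmooth k O] (hx : ∀ i, ev (x i) = 0)
    (hd : ∀ j l, d l (x j) = if j = l then 1 else 0) (N : ℕ) (hN : 2 ≤ N) :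
    ∃ s : O →ₐ[k] MvPolynomial (Fin r) k ⧸ MvPolynomial.idealOfVars (Fin r) k ^ N,
      ∀ i, s (x i) - Ideal.Quotient.mk _ (MvPolynomial.X i) ∈
        (MvPolynomial.idealOfVars (Fin r) k ^ 2).map (Ideal.Quotient.mk _) := by
  let g : (MvPolynomial (Fin r) k ⧸ MvPolynomial.idealOfVars (Fin r) k ^ N) →ₐ[k]
      (MvPolynomial (Fin r) k ⧸ MvPolynomial.idealOfVars (Fin r) k ^ 2) :=
    Ideal.Quotient.factorₐ k (Ideal.pow_le_pow_right hN)
  have hker : RingHom.ker g =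
      (MvPolynomial.idealOfVars (Fin r) k ^ 2).map (Ideal.Quotient.mk _) :=
    Ideal.Quotient.factor_ker (Ideal.pow_le_pow_right hN)
  have hnil : IsNilpotent (RingHom.ker g) := by
    refine ⟨N, ?_⟩
    rw [hker, ← Ideal.map_pow, Ideal.zero_eq_bot, eq_bot_iff, Ideal.map_le_iff_le_comap,
      ← RingHom.ker_eq_comap_bot, Ideal.mk_ker, ← pow_mul]
    exact Ideal.pow_le_pow_right (by omega)
  have hg : Function.Surjective g := Ideal.Quotient.factor_surjective (Ideal.pow_le_pow_right hN)
  refine ⟨Algebra.FormallySmooth.liftOfSurjective (taylorOne ev d) g hg hnil, fun i => ?_⟩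
  rw [← hker, RingHom.mem_ker, map_sub, Algebra.FormallySmooth.liftOfSurjective_apply,
    taylorOne_apply, hx, sub_eq_zero]
  change _ = Ideal.Quotient.mk _ _
  congr 1
  simp [hd]

/-- A polynomial in the coordinates `x` that vanishes to order `N` as a function has no terms of
degree less than `N`. -/
theorem mem_pow_of_aeval_mem [Algebra.FormallySmooth k O] (hx : ∀ i, ev (x i) = 0)
    (hd : ∀ j l, d l (x j) = if j = l then 1 else 0) (N : ℕ) {F : MvPolynomial (Fin r) k}
    (hF : MvPolynomial.aeval x F ∈ Ideal.span (Set.range x) ^ N) :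
    F ∈ MvPolynomial.idealOfVars (Fin r) k ^ N := by
  set X' := MvPolynomial.idealOfVars (Fin r) k with hX'
  obtain ⟨s, hs⟩ : ∃ s : O →ₐ[k] MvPolynomial (Fin r) k ⧸ X' ^ (N + 2),
      ∀ i, s (x i) - Ideal.Quotient.mk _ (MvPolynomial.X i) ∈
        (X' ^ 2).map (Ideal.Quotient.mk _) :=
    exists_algHom_truncated ev d hx hd (N + 2) (by omega)
  let q := Ideal.Quotient.mk (X' ^ (N + 2))
  let b : MvPolynomial (Fin r) k →ₐ[k] _ := s.comp (MvPolynomial.aeval x)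
  have h0 : ∀ G : MvPolynomial (Fin r) k, b G - q G ∈ X'.map q := by
    intro G
    have hX0 : ∀ i, q (MvPolynomial.X i) ∈ X'.map q :=
      fun i => Ideal.mem_map_of_mem q (Ideal.subset_span ⟨i, rfl⟩)
    have hb0 : ∀ i, b (MvPolynomial.X i) ∈ X'.map q := fun i => by
      have h1 := Ideal.map_mono (f := q) (Ideal.pow_le_self (I := X') two_ne_zero) (hs i)
      have := add_mem h1 (hX0 i)
      rw [sub_add_cancel] at this
      simpa [b] using this
    induction G using MvPolynomial.induction_on with
    | C a =>
      have : b (MvPolynomial.C a) = q (MvPolynomial.C a) := b.commutes a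
      rw [this, sub_self]
      exact zero_mem _
    | add F G hF hG =>
      rw [map_add, map_add, add_sub_add_comm]
      exact add_mem hF hG
    | mul_X G i _ =>
      rw [map_mul, map_mul]
      exact sub_mem (Ideal.mul_mem_left _ _ (hb0 i)) (Ideal.mul_mem_left _ _ (hX0 i))
  have h1 : ∀ H ∈ X', b H - q H ∈ (X' ^ 2).map q := by
    intro H hH
    rw [hX', MvPolynomial.idealOfVars, Ideal.mem_span_range_iff_exists_fun] at hH
    obtain ⟨c, rfl⟩ := hH
    rw [map_sum, map_sum, ← Finset.sum_sub_distrib]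
    refine Ideal.sum_mem _ fun i _ => ?_
    rw [map_mul, map_mul]
    have e : b (c i) * b (MvPolynomial.X i) - q (c i) * q (MvPolynomial.X i) =
        b (c i) * (b (MvPolynomial.X i) - q (MvPolynomial.X i)) +
        (b (c i) - q (c i)) * q (MvPolynomial.X i) := by ring
    rw [e]
    refine add_mem (Ideal.mul_mem_left _ _ ?_) ?_
    · have := hs i
      simpa [b] using this
    · rw [pow_two, Ideal.map_mul]
      exact Ideal.mul_mem_mul (h0 _) (Ideal.mem_map_of_mem q (Ideal.subset_span ⟨i, rfl⟩))
  have hd' : ∀ n : ℕ, ∀ G ∈ X' ^ n, b G - q G ∈ (X' ^ (n + 1)).map q := by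
    intro n
    induction n with
    | zero => intro G _; simpa using h0 G
    | succ n ih =>
      intro G hG
      rw [pow_succ] at hG
      induction hG using Submodule.mul_induction_on' with
      | mem_mul_mem G hG H hH =>
        rw [map_mul, map_mul]
        have e : b G * b H - q G * q H = (b G - q G) * ((b H - q H) + q H) +
          q G * (b H - q H) := by ring
        rw [e]
        have hqH : q H ∈ X'.map q := Ideal.mem_map_of_mem q hH
        refine add_mem ?_ ?_
        · rw [pow_succ _ (n + 1), Ideal.map_mul]
          exact Ideal.mul_mem_mul (ih G hG) (add_mem (Ideal.map_mono
            (Ideal.pow_le_self two_ne_zero) (h1 H hH)) hqH)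
        · rw [show n + 1 + 1 = n + 2 from rfl, pow_add X' n 2, Ideal.map_mul]
          exact Ideal.mul_mem_mul (Ideal.mem_map_of_mem q hG) (h1 H hH)
      | add G _ H _ hG hH =>
        rw [map_add, map_add, add_sub_add_comm]
        exact add_mem hG hH
  have hbF : b F ∈ (X' ^ N).map q := by
    have h2 := Ideal.mem_map_of_mem s hF
    rw [Ideal.map_pow, Ideal.map_span] at h2
    rw [Ideal.map_pow]
    refine Ideal.pow_right_mono ?_ N h2
    rw [Ideal.span_le]
    rintro _ ⟨_, ⟨i, rfl⟩, rfl⟩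
    have h3 := Ideal.map_mono (f := q) (Ideal.pow_le_self (I := X') two_ne_zero) (hs i)
    have := add_mem h3 (Ideal.mem_map_of_mem q (Ideal.subset_span ⟨i, rfl⟩ :
      MvPolynomial.X i ∈ X'))
    rw [sub_add_cancel] at this
    exact this
  have hfin : ∀ n ≤ N, F ∈ X' ^ n := by
    intro n
    induction n with
    | zero => simp
    | succ n ih =>
      intro hn
      have h4 := hd' n F (ih (by omega))
      have h5 : q F ∈ (X' ^ (n + 1)).map q := by
        have := sub_mem (Ideal.map_mono (f := q) (Ideal.pow_le_pow_right hn) hbF) h4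
        simpa using this
      rw [Ideal.mem_quotient_iff_mem_sup] at h5
      rwa [sup_eq_left.mpr (Ideal.pow_le_pow_right (by omega))] at h5
  exact hfin N le_rfl

theorem exists_aeval_sub_mem (hker : ∀ g, ev g = 0 → g ∈ Ideal.span (Set.range x)) (N : ℕ) (g : O) :
    ∃ F : MvPolynomial (Fin r) k, g - MvPolynomial.aeval x F ∈ Ideal.span (Set.range x) ^ N := by
  induction N generalizing g with
  | zero => exact ⟨0, by simp⟩
  | succ N ih =>
    have h : g - algebraMap k O (ev g) ∈ Ideal.span (Set.range x) := hker _ (by simp)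
    rw [Ideal.mem_span_range_iff_exists_fun] at h
    obtain ⟨c, hc⟩ := h
    choose F hF using fun i => ih (c i)
    refine ⟨MvPolynomial.C (ev g) + ∑ i, F i * MvPolynomial.X i, ?_⟩
    have e : g - MvPolynomial.aeval x (MvPolynomial.C (ev g) + ∑ i, F i * MvPolynomial.X i) =
        ∑ i, (c i - MvPolynomial.aeval x (F i)) * x i := by
      simp only [map_add, map_sum, map_mul, MvPolynomial.aeval_X, MvPolynomial.aeval_C, sub_mul,
        Finset.sum_sub_distrib, hc]
      ring
    rw [e, pow_succ]
    exact Ideal.sum_mem _ fun i _ => Ideal.mul_mem_mul (hF i) (Ideal.subset_span ⟨i, rfl⟩)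

/-- At a rational point of a smooth variety, functions have power series expansions in local
coordinates. -/
noncomputable def PowerExpansion.ofFormallySmooth [Algebra.FormallySmooth k O]
    (hx : ∀ i, ev (x i) = 0) (hker : ∀ g, ev g = 0 → g ∈ Ideal.span (Set.range x))
    (hd : ∀ j l, d l (x j) = if j = l then 1 else 0) : PowerExpansion k x :=
  have key : ∀ (J : Fin r →₀ ℕ) (g : O) (F : MvPolynomial (Fin r) k),
      g - MvPolynomial.aeval x F ∈ Ideal.span (Set.range x) ^ (J.degree + 1) →
      MvPolynomial.coeff J (exists_aeval_sub_mem ev hker (J.degree + 1) g).choose =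
        MvPolynomial.coeff J F := by
    intro J g F hF
    have h1 := (exists_aeval_sub_mem ev hker (J.degree + 1) g).choose_spec
    have h2 := sub_mem hF h1
    rw [sub_sub_sub_cancel_left, ← map_sub] at h2
    have h3 := (MvPolynomial.mem_pow_idealOfVars_iff' _ _).mp
      (mem_pow_of_aeval_mem ev d hx hd _ h2) J (Nat.lt_succ_self _)
    rwa [MvPolynomial.coeff_sub, sub_eq_zero] at h3
  { coeff := fun J =>
      { toFun := fun g => MvPolynomial.coeff J
          (exists_aeval_sub_mem ev hker (J.degree + 1) g).choose
        map_add' := fun g g' => by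
          rw [← MvPolynomial.coeff_add]
          apply key
          rw [map_add, add_sub_add_comm]
          exact add_mem (exists_aeval_sub_mem ev hker (J.degree + 1) g).choose_spec
            (exists_aeval_sub_mem ev hker (J.degree + 1) g').choose_spec
        map_smul' := fun c g => by
          rw [RingHom.id_apply, ← MvPolynomial.coeff_smul]
          apply key
          rw [map_smul, ← smul_sub]
          exact Submodule.smul_of_tower_mem _ c
            (exists_aeval_sub_mem ev hker (J.degree + 1) g).choose_spec }
    coeff_aeval := fun J F => key J _ F (by simp)
    coeff_of_mem := fun J g hg => (key J g 0 (by simpa using hg)).trans (by simp)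
    exists_approx := fun g N => exists_aeval_sub_mem ev hker N g }

end Expansion

/-! ### Normal and smooth domains -/

section Normal

variable {R K : Type*} [CommRing R] [IsDomain R] [IsNoetherianRing R] [IsIntegrallyClosed R]
  [Field K] [Algebra R K] [IsFractionRing R K]

/-- A normal Noetherian domain is the intersection of its localizations at the primes of height
one. -/
theorem IsIntegrallyClosed.exists_algebraMap_eq_of_height_one (g : K)
    (h : ∀ p : Ideal R, p.IsPrime → p.height = 1 →
      ∃ s t : R, t ∉ p ∧ g * algebraMap R K t = algebraMap R K s) :
    ∃ r, algebraMap R K r = g := by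
  by_contra hg
  let N : Submodule R K := LinearMap.range (Algebra.linearMap R K)
  have hgN : N.mkQ g ≠ 0 := by
    rw [Ne, Submodule.mkQ_apply, Submodule.Quotient.mk_eq_zero]
    rintro ⟨r, hr⟩
    exact hg ⟨r, hr⟩
  obtain ⟨P, hP, hle⟩ := exists_le_isAssociatedPrime_of_isNoetherianRing R _ hgN
  obtain ⟨hPp, y, rfl⟩ := (Submodule.isAssociatedPrime_iff).1 hP
  obtain ⟨x, rfl⟩ := N.mkQ_surjective y
  set P := (⊥ : Submodule R (K ⧸ N)).colon {N.mkQ x} with hPdef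
  have mem : ∀ (z : K) (r : R), r ∈ (⊥ : Submodule R (K ⧸ N)).colon {N.mkQ z} ↔
      ∃ s, algebraMap R K s = algebraMap R K r * z := by
    intro z r
    rw [Submodule.mem_colon_singleton, Submodule.mem_bot, ← map_smul, Submodule.mkQ_apply,
      Submodule.Quotient.mk_eq_zero, Algebra.smul_def]
    rfl
  have hxR : ¬ ∃ s, algebraMap R K s = x := by
    intro hs
    exact hPp.ne_top ((Ideal.eq_top_iff_one _).2 ((mem _ _).2 (by simpa using hs)))
  have hP0 : P ≠ ⊥ := by
    obtain ⟨a, b, hb, hab⟩ := IsFractionRing.div_surjective (A := R) x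
    intro h0
    have : b ∈ P := (mem _ _).2 ⟨a, by
      have : algebraMap R K b ≠ 0 := by simpa using nonZeroDivisors.ne_zero hb
      rw [← hab]; field_simp⟩
    rw [h0] at this
    exact nonZeroDivisors.ne_zero hb (by simpa using this)
  by_cases hc : ∀ r ∈ P, ∀ s, algebraMap R K s = algebraMap R K r * x → s ∈ P
  · have hint : IsIntegral R x := by
      refine isIntegral_of_smul_mem_submodule (M := K) (Submodule.map (Algebra.linearMap R K) P)
        ?_ ((IsNoetherian.noetherian P).map _) x ?_
      · intro h0
        exact hP0 ((Submodule.map_injective_of_injective (f := Algebra.linearMap R K)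
          (IsFractionRing.injective R K)) (by rw [h0, Submodule.map_bot]))
      · rintro _ ⟨r, hr, rfl⟩
        obtain ⟨s, hs⟩ := (mem _ _).1 hr
        exact ⟨s, hc r hr s hs, by simp [hs, mul_comm]⟩
    exact hxR (IsIntegrallyClosed.isIntegral_iff.1 hint)
  · push Not at hc
    obtain ⟨r, hr, s, hs, hsP⟩ := hc
    have hmin : P ∈ (Ideal.span {r}).minimalPrimes := by
      refine ⟨⟨hPp, (Ideal.span_singleton_le_iff_mem _).2 hr⟩, ?_⟩
      rintro q ⟨hq, hrq⟩ hqP p hp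
      obtain ⟨t, ht⟩ := (mem _ _).1 hp
      have hpt : p * s = r * t := by
        apply IsFractionRing.injective R K
        rw [map_mul, map_mul, hs, ht]; ring
      have : p * s ∈ q := by
        rw [hpt]; exact q.mul_mem_right _ (hrq (Ideal.mem_span_singleton_self r))
      exact (hq.mem_or_mem this).resolve_right fun h => hsP (hqP h)
    have h1 : P.height = 1 := by
      refine le_antisymm (Ideal.height_le_one_of_isPrincipal_of_mem_minimalPrimes _ _ hmin) ?_
      rw [Order.one_le_iff_ne_zero, Ne, Ideal.height_eq_zero_iff_eq_bot]
      exact hP0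
    obtain ⟨s', t, ht, hst⟩ := h P hPp h1
    exact ht (hle ((mem _ _).2 ⟨s', by rw [← hst, mul_comm]⟩))

end Normal

open nonZeroDivisors in
/-- The generic fibre of an étale algebra `A` over a normal domain `R` is a field (étale over
`Frac R` and a domain), hence `Frac A`; and integral closures commute with smooth base change. -/
theorem IsIntegrallyClosed.of_etale (R A : Type*) [CommRing R] [IsDomain R] [IsIntegrallyClosed R]
    [CommRing A] [IsDomain A] [Algebra R A] [Algebra.Etale R A] : IsIntegrallyClosed A := by
  let K := FractionRing R
  let B := A ⊗[R] K
  have hRA : Function.Injective (algebraMap R A) :=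
    have : Module.Flat R A := inferInstance
    FaithfulSMul.algebraMap_injective R A
  have hloc : IsLocalization (Algebra.algebraMapSubmonoid A R⁰) B := inferInstance
  have hM : Algebra.algebraMapSubmonoid A R⁰ ≤ A⁰ :=
    algebraMapSubmonoid_le_nonZeroDivisors_of_faithfulSMul A le_rfl
  have hdom : IsDomain B := IsLocalization.isDomain_of_le_nonZeroDivisors B hM
  let : Algebra K B := Algebra.TensorProduct.rightAlgebra
  have hfield : IsField B := by
    have : Algebra.FormallyUnramified K B :=
      Algebra.FormallyUnramified.of_equiv (Algebra.TensorProduct.commRight R K A)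
    have : Algebra.EssFiniteType K B :=
      (Algebra.EssFiniteType.iff_of_algEquiv (Algebra.TensorProduct.commRight R K A)).1 inferInstance
    have : Module.Finite K B := Algebra.FormallyUnramified.finite_of_free K B
    exact isField_of_isIntegral_of_isField' (R := K) (Field.toIsField K)
  let : Field B := hfield.toField
  have hinj : Function.Injective (algebraMap A B) := IsLocalization.injective B hM
  have : FaithfulSMul A B := (faithfulSMul_iff_algebraMap_injective A B).2 hinj
  have : IsFractionRing A B := IsFractionRing.of_field A B fun z => by
    obtain ⟨a, s, rfl⟩ := IsLocalization.exists_mk'_eq (Algebra.algebraMapSubmonoid A R⁰) z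
    exact ⟨a, s, by
      have hs : algebraMap A B s ≠ 0 := by
        rw [Ne, map_eq_zero_iff _ hinj]
        exact nonZeroDivisors.ne_zero (hM s.2)
      rw [eq_div_iff hs, IsLocalization.mk'_spec]⟩
  rw [isIntegrallyClosed_iff B]
  intro x hx
  obtain ⟨y, hy⟩ := (TensorProduct.toIntegralClosure_bijective_of_smooth (R := R) (S := A)
    (B := K)).2 ⟨x, hx⟩
  have key : ∀ y : A ⊗[R] integralClosure R K, ∃ a : A, algebraMap A B a =
      (TensorProduct.toIntegralClosure R A K y : B) := by
    intro y
    induction y with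
    | zero => exact ⟨0, by simp⟩
    | add u v hu hv =>
      obtain ⟨a, ha⟩ := hu
      obtain ⟨b, hb⟩ := hv
      exact ⟨a + b, by simp [ha, hb]⟩
    | tmul a c =>
      obtain ⟨d, hd⟩ := IsIntegrallyClosed.isIntegral_iff.1 c.2
      refine ⟨d • a, ?_⟩
      have h1 : algebraMap A B (d • a) = (d • a) ⊗ₜ[R] (1 : K) := rfl
      rw [h1, TensorProduct.smul_tmul, Algebra.smul_def, mul_one]
      simp [TensorProduct.toIntegralClosure, ← hd]
  obtain ⟨a, ha⟩ := key y
  exact ⟨a, by rw [ha, hy]⟩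

/-! ### Coordinates and differential forms -/

section Coordinates

open KaehlerDifferential

/-- `O` has coordinates over `k`: `Ω_{O/k}` has a basis of `r` exact differentials. -/
def HasCoordinates (k O : Type*) [CommRing k] [CommRing O] [Algebra k O] (r : ℕ) : Prop :=
  ∃ (x : Fin r → O) (b : Module.Basis (Fin r) O Ω[O⁄k]), ∀ i, b i = D k O (x i)

namespace HasCoordinates

theorem of_etale {k O : Type*} [CommRing k] [CommRing O] [Algebra k O] {r : ℕ}
    [Algebra (MvPolynomial (Fin r) k) O] [IsScalarTower k (MvPolynomial (Fin r) k) O]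
    [Algebra.FormallyEtale (MvPolynomial (Fin r) k) O] : HasCoordinates k O r := by
  refine ⟨fun i => algebraMap (MvPolynomial (Fin r) k) O (.X i),
    ((mvPolynomialBasis k (Fin r)).baseChange O).map
      (tensorKaehlerEquivOfFormallyEtale k (MvPolynomial (Fin r) k) O), fun i => ?_⟩
  simp only [Module.Basis.map_apply, Module.Basis.baseChange_apply, mvPolynomialBasis_apply]
  rw [← tensorKaehlerEquivOfFormallyEtale_symm_D_algebraMap, LinearEquiv.apply_symm_apply]

variable {k O : Type*} [CommRing k] [CommRing O] [Algebra k O] {r : ℕ}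

theorem exists_basis (h : HasCoordinates k O r) (x : Fin r → O)
    (hx : Submodule.span O (Set.range fun i => D k O (x i)) = ⊤) :
    ∃ b : Module.Basis (Fin r) O Ω[O⁄k], ∀ i, b i = D k O (x i) := by
  obtain ⟨y, b, -⟩ := h
  by_cases hn : Nontrivial O
  · refine ⟨basisOfTopLeSpanOfCardEqFinrank (fun i => D k O (x i)) hx.ge ?_,
      fun i => by rw [coe_basisOfTopLeSpanOfCardEqFinrank]⟩
    rw [Module.finrank_eq_card_basis b]
  · rw [not_nontrivial_iff_subsingleton] at hn
    have := Module.subsingleton O Ω[O⁄k]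
    exact ⟨b, fun i => Subsingleton.elim _ _⟩

/-- The derivations dual to coordinates. -/
theorem exists_dual (h : HasCoordinates k O r) (x : Fin r → O)
    (hx : Submodule.span O (Set.range fun i => D k O (x i)) = ⊤) :
    ∃ d : Fin r → Derivation k O O, (∀ j l, d l (x j) = if j = l then 1 else 0) ∧
      ∀ g, D k O g = ∑ l, d l g • D k O (x l) := by
  obtain ⟨b, hb⟩ := h.exists_basis x hx
  refine ⟨fun l => (b.coord l).compDer (D k O), fun j l => ?_, fun g => ?_⟩
  · change b.repr (D k O (x j)) l = _
    rw [← hb, Module.Basis.repr_self, Finsupp.single_apply]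
  · conv_lhs => rw [← b.sum_repr (D k O g)]
    simp only [hb]
    rfl

theorem exists_span (h : HasCoordinates k O r) :
    ∃ x : Fin r → O, Submodule.span O (Set.range fun i => D k O (x i)) = ⊤ := by
  obtain ⟨x, b, hb⟩ := h
  exact ⟨x, by rw [← b.span_eq]; congr 2; ext i; rw [hb]⟩

/-- Two systems of coordinates differ by an invertible matrix. -/
theorem exists_isUnit_det (h : HasCoordinates k O r) (x y : Fin r → O)
    (hx : Submodule.span O (Set.range fun i => D k O (x i)) = ⊤)
    (hy : Submodule.span O (Set.range fun i => D k O (y i)) = ⊤) :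
    ∃ a : Matrix (Fin r) (Fin r) O, IsUnit a.det ∧
      ∀ i, D k O (x i) = ∑ j, a i j • D k O (y j) := by
  obtain ⟨bx, hbx⟩ := h.exists_basis x hx
  obtain ⟨b, hb⟩ := h.exists_basis y hy
  refine ⟨fun i j => b.repr (D k O (x i)) j, ?_, fun i => ?_⟩
  · have : (fun i j => b.repr (D k O (x i)) j : Matrix (Fin r) (Fin r) O) =
        (b.toMatrix bx).transpose := by
      ext i j
      rw [Matrix.transpose_apply, Module.Basis.toMatrix_apply, hbx]
    rw [this, Matrix.det_transpose]
    exact Matrix.isUnit_det_of_left_inverse (bx.toMatrix_mul_toMatrix_flip b)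
  · conv_lhs => rw [← b.sum_repr (D k O (x i))]
    simp only [hb]

end HasCoordinates

variable {k O K : Type*} [CommRing k] [CommRing O] [Algebra k O] [CommRing K] [Algebra k K]
  [Algebra O K] [IsScalarTower k O K]

/-- If a set of elements of `O` generates `Ω_{O/k}`, then it generates the differentials of a
localization. -/
theorem span_D_of_isLocalization (M : Submonoid O) [IsLocalization M K] {ι : Type*} (x : ι → O)
    (hx : Submodule.span O (Set.range fun i => D k O (x i)) = ⊤) :
    Submodule.span K (Set.range fun i => D k K (algebraMap O K (x i))) = ⊤ := by
  have h := span_eq_top_of_isLocalizedModule K M (map k k O K)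
    (v := Set.range fun i => D k O (x i)) hx
  rw [← h, ← Set.range_comp]
  congr 2
  ext i
  simp

end Coordinates

namespace RatForm

open KaehlerDifferential

variable {k K : Type u} [Field k] [Field K] [Algebra k K] {r : ℕ}

theorem _root_.exteriorPower.ιMulti_eq_det_smul {R M : Type*} [CommRing R] [AddCommGroup M]
    [Module R M] {r : ℕ} (v w : Fin r → M) (a : Matrix (Fin r) (Fin r) R)
    (h : ∀ i, v i = ∑ j, a i j • w j) :
    exteriorPower.ιMulti R r v = a.det • exteriorPower.ιMulti R r w := by
  classical
  rw [funext h, ← AlternatingMap.coe_multilinearMap, MultilinearMap.map_sum]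
  simp only [MultilinearMap.map_smul_univ]
  rw [← Matrix.det_transpose, Matrix.det_apply, Finset.sum_smul]
  symm
  refine Finset.sum_of_injOn (fun σ : Equiv.Perm (Fin r) => (σ : Fin r → Fin r))
    (DFunLike.coe_injective.injOn) (fun _ _ => Finset.mem_coe.2 (Finset.mem_univ _)) ?_ ?_
  · intro f _ hf
    have : ¬ Function.Injective f := fun hi =>
      hf ⟨Equiv.ofBijective f (Finite.injective_iff_bijective.1 hi), by simp, rfl⟩
    rw [Function.not_injective_iff] at this
    obtain ⟨i, j, hij, hne⟩ := this
    rw [AlternatingMap.coe_multilinearMap,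
      (exteriorPower.ιMulti R r).map_eq_zero_of_eq _ (by rw [hij]) hne, smul_zero]
  · intro σ _
    have := (exteriorPower.ιMulti R r).map_perm w σ
    simp only [AlternatingMap.coe_multilinearMap, Matrix.transpose_apply]
    change _ = _ • (exteriorPower.ιMulti R r) (w ∘ σ)
    rw [this]
    rcases Int.units_eq_one_or (Equiv.Perm.sign σ) with h | h <;> simp [h]

theorem dWedge_eq_det_smul (x y : Fin r → K) (a : Matrix (Fin r) (Fin r) K)
    (h : ∀ i, D k K (x i) = ∑ j, a i j • D k K (y j)) :
    dWedge k x = a.det • dWedge k y :=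
  exteriorPower.ιMulti_eq_det_smul _ _ a h

theorem exists_eq_smul_dWedge (x : Fin r → K)
    (hx : Submodule.span K (Set.range fun i => D k K (x i)) = ⊤) (h : HasCoordinates k K r) (ω : Form k K r) :
    ∃ g : K, ω = g • dWedge k x := by
  obtain ⟨b, hb⟩ := h.exists_basis x hx
  have hω : ω ∈ Submodule.span K (Set.range (exteriorPower.ιMulti K r (M := Ω[K⁄k]))) := by
    rw [exteriorPower.ιMulti_span]; trivial
  induction hω using Submodule.span_induction with
  | mem ω h =>
    obtain ⟨v, rfl⟩ := h
    refine ⟨Matrix.det fun i j => b.repr (v i) j,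
      exteriorPower.ιMulti_eq_det_smul _ _ (fun i j => b.repr (v i) j) fun i => ?_⟩
    simp only [← hb]
    exact (b.sum_repr (v i)).symm
  | zero => exact ⟨0, by simp⟩
  | add u v _ _ hu hv =>
    obtain ⟨g, hg⟩ := hu
    obtain ⟨g', hg'⟩ := hv
    exact ⟨g + g', by rw [add_smul, hg, hg']⟩
  | smul c u _ hu =>
    obtain ⟨g, hg⟩ := hu
    exact ⟨c * g, by rw [mul_smul, hg]⟩

theorem smul_dWedge_injective (x : Fin r → K)
    (hx : Submodule.span K (Set.range fun i => D k K (x i)) = ⊤) (h : HasCoordinates k K r) {g g' : K}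
    (hg : g • dWedge k x = g' • dWedge k x) : g = g' := by
  obtain ⟨b, hb⟩ := h.exists_basis x hx
  have := congrArg (exteriorPower.alternatingMapLinearEquiv b.det) hg
  have hb' : (fun i => D k K (x i)) = b := funext fun i => (hb i).symm
  simpa [dWedge, exteriorPower.alternatingMapLinearEquiv_apply_ιMulti, hb', b.det_self] using this

end RatForm

/-! ### Local rings of smooth varieties -/

namespace Variety

variable {k : Type u} [Field k] {X : Variety k} {r : ℕ}

theorem toFun_injective (X : Variety k) (z : X.carrier) : Function.Injective (X.toFun z) :=
  IsFractionRing.injective (X.localRing z) X.funField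

theorem stalkSpecializes_const (X : Variety k) {x y : X.carrier} (h : x ⤳ y) (a : k) :
    X.carrier.presheaf.stalkSpecializes h (X.const y a) = X.const x a := by
  have h2 : X.carrier.presheaf.germ ⊤ y (TopologicalSpace.Opens.mem_top y) ≫
      X.carrier.presheaf.stalkSpecializes h =
      X.carrier.presheaf.germ ⊤ x (TopologicalSpace.Opens.mem_top x) :=
    TopCat.Presheaf.germ_stalkSpecializes ..
  simp only [const, ← h2]
  rfl

instance (X : Variety k) (z : X.carrier) : IsScalarTower k (X.localRing z) X.funField :=
  IsScalarTower.of_algebraMap_eq fun a => (stalkSpecializes_const X _ a).symm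

theorem exists_formallyEtale_mvPolynomial (hX : SmoothOfRelativeDimension r X.str)
    (z : X.carrier) : ∃ (_ : Algebra (MvPolynomial (Fin r) k) (X.localRing z)),
      IsScalarTower k (MvPolynomial (Fin r) k) (X.localRing z) ∧
      Algebra.FormallyEtale (MvPolynomial (Fin r) k) (X.localRing z) ∧
      Algebra.EssFiniteType k (X.localRing z) ∧ IsIntegrallyClosed (X.localRing z) := by
  obtain ⟨U, hU, V, hV, hz, e, hs⟩ := hX.exists_isStandardSmoothOfRelativeDimension z
  have hUt : U = ⊤ := by
    ext x
    have : x = X.str z := Subsingleton.elim (α := PrimeSpectrum k) _ _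
    simpa [this] using e hz
  subst hUt
  have hs' : RingHom.IsStandardSmoothOfRelativeDimension r
      ((X.str.appLE ⊤ V e).hom.comp (Scheme.ΓSpecIso (CommRingCat.of k)).inv.hom) :=
    RingHom.isStandardSmoothOfRelativeDimension_respectsIso.2 _
      (Scheme.ΓSpecIso (CommRingCat.of k)).symm.commRingCatIsoToRingEquiv hs
  obtain ⟨g, hg, hge⟩ := hs'.exists_etale_mvPolynomial
  let : Algebra (MvPolynomial (Fin r) k) Γ(X.carrier, V) := g.toAlgebra
  have : Algebra.Etale (MvPolynomial (Fin r) k) Γ(X.carrier, V) := hge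
  let zV : V := ⟨z, hz⟩
  let : Algebra Γ(X.carrier, V) (X.localRing z) := (X.carrier.presheaf.germ V z hz).hom.toAlgebra
  have hloc : IsLocalization.AtPrime (X.localRing z) (hV.primeIdealOf zV).asIdeal :=
    hV.isLocalization_stalk zV
  let : Algebra (MvPolynomial (Fin r) k) (X.localRing z) :=
    ((algebraMap Γ(X.carrier, V) (X.localRing z)).comp g).toAlgebra
  have : IsScalarTower (MvPolynomial (Fin r) k) Γ(X.carrier, V) (X.localRing z) :=
    IsScalarTower.of_algebraMap_eq' rfl
  have hconst : X.const z = ((algebraMap Γ(X.carrier, V) (X.localRing z)).comp g).comp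
      MvPolynomial.C := by
    rw [RingHom.comp_assoc, hg]
    have : X.str.appTop ≫ X.carrier.presheaf.germ ⊤ z (TopologicalSpace.Opens.mem_top z) =
        X.str.appLE ⊤ V e ≫ X.carrier.presheaf.germ V z hz := by
      rw [Scheme.Hom.appLE, Category.assoc]
      erw [TopCat.Presheaf.germ_res]
      rfl
    simp only [const, this]
    rfl
  have hfe : Algebra.FormallyEtale Γ(X.carrier, V) (X.localRing z) :=
    Algebra.FormallyEtale.of_isLocalization (hV.primeIdealOf zV).asIdeal.primeCompl
  have htow : IsScalarTower k (MvPolynomial (Fin r) k) (X.localRing z) :=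
    IsScalarTower.of_algebraMap_eq' hconst
  have : Nonempty V := ⟨zV⟩
  refine ⟨inferInstance, htow, .comp _ Γ(X.carrier, V) _, ?_, ?_⟩
  · have h1 : Algebra.EssFiniteType (MvPolynomial (Fin r) k) Γ(X.carrier, V) := inferInstance
    have h2 : Algebra.EssFiniteType Γ(X.carrier, V) (X.localRing z) :=
      .of_isLocalization _ (hV.primeIdealOf zV).asIdeal.primeCompl
    have h3 : Algebra.EssFiniteType (MvPolynomial (Fin r) k) (X.localRing z) :=
      .comp _ Γ(X.carrier, V) _
    exact .comp _ (MvPolynomial (Fin r) k) _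
  · have : IsIntegrallyClosed Γ(X.carrier, V) :=
      IsIntegrallyClosed.of_etale (MvPolynomial (Fin r) k) _
    exact isIntegrallyClosed_of_isLocalization (R := Γ(X.carrier, V)) _
      (hV.primeIdealOf zV).asIdeal.primeCompl (Ideal.primeCompl_le_nonZeroDivisors _)

theorem hasCoordinates (hX : SmoothOfRelativeDimension r X.str) (z : X.carrier) :
    HasCoordinates k (X.localRing z) r := by
  obtain ⟨_, _, _, -⟩ := exists_formallyEtale_mvPolynomial hX z
  exact .of_etale

theorem formallySmooth (hX : SmoothOfRelativeDimension r X.str) (z : X.carrier) :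
    Algebra.FormallySmooth k (X.localRing z) := by
  obtain ⟨_, _, _, -⟩ := exists_formallyEtale_mvPolynomial hX z
  exact .comp k (MvPolynomial (Fin r) k) _

theorem isIntegrallyClosed (hX : SmoothOfRelativeDimension r X.str) (z : X.carrier) :
    IsIntegrallyClosed (X.localRing z) := by
  obtain ⟨_, _, _, _, h⟩ := exists_formallyEtale_mvPolynomial hX z
  exact h

theorem isDiscreteValuationRing (hX : SmoothOfRelativeDimension r X.str) (z : X.PrimeDiv) :
    IsDiscreteValuationRing (X.localRing z.1) := by
  have := isIntegrallyClosed hX z.1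
  have hdim : ringKrullDim (X.localRing z.1) = 1 := by
    rw [ringKrullDim_stalk_eq_coheight, z.2]; rfl
  have hfield := (ringKrullDim_eq_one_iff_of_isLocalRing_isDomain.1 hdim).1
  have h1 : IsPrincipalIdealRing (X.localRing z.1) := by
    have htfae := (tfae_of_isNoetherianRing_of_isLocalRing_of_isDomain (X.localRing z.1)).out 0 3
    refine htfae.2 ⟨this, fun P hP hPp => ?_⟩
    have h2 : Ring.KrullDimLE 1 (X.localRing z.1) := Ring.krullDimLE_iff.2 hdim.le
    exact (IsLocalRing.eq_maximalIdeal
      (Ring.krullDimLE_one_iff_of_noZeroDivisors.1 h2 P hP hPp))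
  exact { not_a_field' := fun h => hfield (IsLocalRing.isField_iff_maximalIdeal_eq.2 h) }

theorem prod_smooth {Y : Variety k} {s : ℕ} (hX : SmoothOfRelativeDimension r X.str)
    (hY : SmoothOfRelativeDimension s Y.str) :
    SmoothOfRelativeDimension (r + s) (X.prod Y).str := by
  have : SmoothOfRelativeDimension s (pullback.fst X.str Y.str) :=
    (smoothOfRelativeDimension_isStableUnderBaseChange s).of_isPullback
      (IsPullback.of_hasPullback X.str Y.str).flip hY
  have : SmoothOfRelativeDimension s (prX X Y) := this
  rw [add_comm]
  exact smoothOfRelativeDimension_comp s r (prX X Y) X.str (hf := this) (hg := hX)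

/-! ### Orders of vanishing -/

section Ord

theorem ord_toFun_of_isUnit (z : X.PrimeDiv) {u : X.localRing z.1} (hu : IsUnit u) :
    Scheme.ord (X.toFun z.1 u) z.1 = 0 := by
  have h0 : X.toFun z.1 u ≠ 0 := by
    rw [Ne, map_eq_zero_iff _ (X.toFun_injective z.1)]
    exact hu.ne_zero
  have : Ring.KrullDimLE 1 (X.localRing z.1) := krullDimLE_of_coheight_le z.2.le
  rw [Scheme.ord_eq_iff z.2 h0]
  exact Ring.ordFrac_of_isUnit hu

variable (z : X.PrimeDiv) [IsDiscreteValuationRing (X.localRing z.1)]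

theorem ord_toFun_of_irreducible {π : X.localRing z.1} (hπ : Irreducible π) :
    Scheme.ord (X.toFun z.1 π) z.1 = 1 := by
  have h0 : X.toFun z.1 π ≠ 0 := by
    rw [Ne, map_eq_zero_iff _ (X.toFun_injective z.1)]
    exact hπ.ne_zero
  rw [Scheme.ord_eq_iff z.2 h0]
  exact Ring.ordFrac_irreducible (K := X.funField) hπ

theorem ord_zpow {f : X.funField} (hf : f ≠ 0) (n : ℤ) :
    Scheme.ord (f ^ n) z.1 = n * Scheme.ord f z.1 := by
  have hnat : ∀ n : ℕ, Scheme.ord (f ^ n) z.1 = n * Scheme.ord f z.1 := by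
    intro n
    induction n with
    | zero =>
      have := ord_toFun_of_isUnit z (isUnit_one)
      simpa using this
    | succ n ih => rw [pow_succ, Scheme.ord_mul (pow_ne_zero _ hf) hf, ih]; push_cast; ring
  obtain ⟨m, rfl | rfl⟩ := n.eq_nat_or_neg
  · simpa using hnat m
  · have h1 := ord_toFun_of_isUnit z (isUnit_one)
    rw [map_one, ← mul_inv_cancel₀ (pow_ne_zero m hf),
      Scheme.ord_mul (pow_ne_zero _ hf) (inv_ne_zero (pow_ne_zero _ hf)), hnat] at h1
    rw [zpow_neg, zpow_natCast]
    linarith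

theorem ord_unit_mul_zpow {u π : X.localRing z.1} (hu : IsUnit u) (hπ : Irreducible π) (n : ℤ) :
    Scheme.ord (X.toFun z.1 u * X.toFun z.1 π ^ n) z.1 = n := by
  have h1 : X.toFun z.1 u ≠ 0 := by
    rw [Ne, map_eq_zero_iff _ (X.toFun_injective z.1)]
    exact hu.ne_zero
  have h2 : X.toFun z.1 π ≠ 0 := by
    rw [Ne, map_eq_zero_iff _ (X.toFun_injective z.1)]
    exact hπ.ne_zero
  rw [Scheme.ord_mul h1 (zpow_ne_zero _ h2), ord_zpow z h2, ord_toFun_of_isUnit z hu,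
    ord_toFun_of_irreducible z hπ]
  ring

theorem exists_eq_unit_mul_zpow {π : X.localRing z.1} (hπ : Irreducible π) {f : X.funField}
    (hf : f ≠ 0) : ∃ (u : X.localRing z.1) (n : ℤ), IsUnit u ∧
      f = X.toFun z.1 u * X.toFun z.1 π ^ n := by
  obtain ⟨a, b, hb, rfl⟩ := IsFractionRing.div_surjective (A := X.localRing z.1) f
  have hb0 := nonZeroDivisors.ne_zero hb
  have ha0 : a ≠ 0 := by rintro rfl; simp at hf
  obtain ⟨m, u, rfl⟩ := IsDiscreteValuationRing.eq_unit_mul_pow_irreducible ha0 hπ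
  obtain ⟨n, v, rfl⟩ := IsDiscreteValuationRing.eq_unit_mul_pow_irreducible hb0 hπ
  refine ⟨↑(u * v⁻¹), (m : ℤ) - n, Units.isUnit _, ?_⟩
  have h2 : X.toFun z.1 π ≠ 0 := by
    rw [Ne, map_eq_zero_iff _ (X.toFun_injective z.1)]
    exact hπ.ne_zero
  have hv : X.toFun z.1 (v : X.localRing z.1) ≠ 0 := by
    rw [Ne, map_eq_zero_iff _ (X.toFun_injective z.1)]
    exact v.ne_zero
  have hv' : X.toFun z.1 (v⁻¹ : (X.localRing z.1)ˣ) = (X.toFun z.1 v)⁻¹ := by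
    rw [← mul_left_inj' hv, inv_mul_cancel₀ hv, ← map_mul, Units.inv_mul, map_one]
  rw [zpow_sub₀ h2]
  simp only [map_mul, map_pow, Units.val_mul, hv', zpow_natCast]
  field_simp

theorem ord_toFun_nonneg (a : X.localRing z.1) : 0 ≤ Scheme.ord (X.toFun z.1 a) z.1 := by
  by_cases ha : a = 0
  · simp [ha]
  obtain ⟨π, hπ⟩ := IsDiscreteValuationRing.exists_irreducible (X.localRing z.1)
  obtain ⟨m, u, rfl⟩ := IsDiscreteValuationRing.eq_unit_mul_pow_irreducible ha hπ
  have := ord_unit_mul_zpow z u.isUnit hπ m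
  rw [map_mul, map_pow, ← zpow_natCast, this]
  positivity

/-- The convention `ord 0 = 0` makes `f ≠ 0` superfluous. -/
theorem exists_toFun_eq_of_ord_nonneg {f : X.funField} (hf : 0 ≤ Scheme.ord f z.1) :
    ∃ a, X.toFun z.1 a = f := by
  by_cases h0 : f = 0
  · exact ⟨0, by simp [h0]⟩
  obtain ⟨π, hπ⟩ := IsDiscreteValuationRing.exists_irreducible (X.localRing z.1)
  obtain ⟨u, n, hu, rfl⟩ := exists_eq_unit_mul_zpow z hπ h0
  rw [ord_unit_mul_zpow z hu hπ] at hf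
  lift n to ℕ using hf
  exact ⟨u * π ^ n, by simp⟩

end Ord

end Variety

/-! ### Products: local rings -/

namespace Variety

variable {k : Type u} [Field k]

theorem fromSpecStalk_str (X : Variety k) (x : X.carrier) :
    X.carrier.fromSpecStalk x ≫ X.str = Spec.map (CommRingCat.ofHom (X.const x)) := by
  have h1 : X.carrier.fromSpecStalk x ≫ X.str ≫ (Spec (CommRingCat.of k)).toSpecΓ =
      Spec.map (X.str.appTop ≫ X.carrier.presheaf.germ ⊤ x (TopologicalSpace.Opens.mem_top x)) := by
    rw [Scheme.toSpecΓ_naturality, Scheme.fromSpecStalk_toSpecΓ_assoc, ← Spec.map_comp]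
  have h2 : CommRingCat.ofHom (X.const x) = (Scheme.ΓSpecIso (CommRingCat.of k)).inv ≫
      X.str.appTop ≫ X.carrier.presheaf.germ ⊤ x (TopologicalSpace.Opens.mem_top x) := rfl
  rw [h2, Spec.map_comp, ← h1]
  simp

/-- `F ⊗ k(Y)` is a domain for every extension field `F` of `k`. -/
theorem isDomain_tensor_funField (Y : Variety k) (F : Type u) [Field F] [Algebra k F] :
    IsDomain (F ⊗[k] Y.funField) := by
  obtain ⟨_, ⟨V, hV, rfl⟩, hg, -⟩ := Y.carrier.isBasis_affineOpens.exists_subset_of_mem_open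
    (Set.mem_univ (genericPoint Y.carrier)) isOpen_univ
  have : Nonempty V := ⟨_, hg⟩
  let A := Γ(Y.carrier, V)
  let φ : CommRingCat.of k ⟶ A := Spec.preimage (hV.fromSpec ≫ Y.str)
  let : Algebra k A := φ.hom.toAlgebra
  have hφ : Spec.map (CommRingCat.ofHom (algebraMap k A)) = hV.fromSpec ≫ Y.str :=
    Spec.map_preimage _
  have hfrac : IsFractionRing A Y.funField := functionField_isFractionRing_of_isAffineOpen _ _ hV
  have htow : IsScalarTower k A Y.funField := by
    refine IsScalarTower.of_algebraMap_eq' ?_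
    have : CommRingCat.ofHom (Y.const (genericPoint Y.carrier)) = φ ≫
        Y.carrier.presheaf.germ V _ hg := by
      apply Spec.map_injective
      rw [← fromSpecStalk_str, Spec.map_comp, Spec.map_preimage, ← Category.assoc,
        ← hV.fromSpecStalk_eq_fromSpecStalk hg]
      rfl
    exact congrArg CommRingCat.Hom.hom this
  have hint : IsIntegral (pullback (Spec.map (CommRingCat.ofHom (algebraMap k F)))
      (Spec.map (CommRingCat.ofHom (algebraMap k A)))) := by
    let s : Spec (CommRingCat.of F) ⟶ Spec (CommRingCat.of k) :=
      Spec.map (CommRingCat.ofHom (algebraMap k F))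
    have h1 : IsIntegral (pullback s Y.str) :=
      GeometricallyIntegral.isIntegral_of_subsingleton (pullback.fst s Y.str)
    let j : pullback s (Spec.map (CommRingCat.ofHom (algebraMap k A))) ⟶ pullback s Y.str :=
      pullback.map _ _ _ _ (𝟙 _) hV.fromSpec (𝟙 _) (by simp) (by simp [hφ])
    have hoi : IsOpenImmersion (X := Spec (CommRingCat.of A)) hV.fromSpec :=
      hV.isOpenImmersion_fromSpec
    have : IsOpenImmersion j :=
      Scheme.pullback_map_isOpenImmersion (i₁ := 𝟙 _) (i₂ := hV.fromSpec) (i₃ := 𝟙 _) ..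
    have : Nonempty (pullback s (Spec.map (CommRingCat.ofHom (algebraMap k A))) : Scheme.{u}) := by
      have : Nonempty (Spec (CommRingCat.of (F ⊗[k] A))) := by
        have : Nontrivial (F ⊗[k] A) := inferInstance
        exact inferInstanceAs (Nonempty (PrimeSpectrum (F ⊗[k] A)))
      exact this.map (pullbackSpecIso k F A).inv
    exact isIntegral_of_isOpenImmersion j
  have hdom : IsDomain (F ⊗[k] A) := by
    have h : IsIntegral (Spec (CommRingCat.of (F ⊗[k] A))) := by
      have : Nonempty (Spec (CommRingCat.of (F ⊗[k] A))) := by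
        have : Nontrivial (F ⊗[k] A) := inferInstance
        exact inferInstanceAs (Nonempty (PrimeSpectrum (F ⊗[k] A)))
      exact isIntegral_of_isOpenImmersion (pullbackSpecIso k F A).inv
    exact (affine_isIntegral_iff (CommRingCat.of (F ⊗[k] A))).1 h
  let : Algebra (F ⊗[k] A) (F ⊗[k] Y.funField) :=
    (Algebra.TensorProduct.map (AlgHom.id F F)
      (IsScalarTower.toAlgHom k A Y.funField)).toRingHom.toAlgebra
  have : IsScalarTower F (F ⊗[k] A) (F ⊗[k] Y.funField) :=
    IsScalarTower.of_algebraMap_eq fun a => by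
      rw [RingHom.algebraMap_toAlgebra]
      simp
  have hloc := IsLocalization.tensorProduct_tensorProduct_right k F (nonZeroDivisors A)
    Y.funField (by ext; simp [RingHom.algebraMap_toAlgebra])
  refine IsLocalization.isDomain_of_le_nonZeroDivisors _
    (M := (nonZeroDivisors A).map (Algebra.TensorProduct.includeRight (R := k) (A := F))) ?_
  rintro _ ⟨a, ha, rfl⟩
  refine mem_nonZeroDivisors_of_ne_zero ?_
  rw [Ne, map_eq_zero_iff _ (Algebra.TensorProduct.includeRight_injective
    (algebraMap k F).injective)]
  exact nonZeroDivisors.ne_zero ha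

/-- `Z` is the product of `X` and `Y` with the given projections. -/
structure IsProduct {X Y Z : Variety k} (p : Z.carrier ⟶ X.carrier) (q : Z.carrier ⟶ Y.carrier) :
    Prop where
  isPullback : IsPullback p q X.str Y.str
  dominant_fst : IsDominant p
  dominant_snd : IsDominant q
  fst_str : p ≫ X.str = Z.str
  snd_str : q ≫ Y.str = Z.str

theorem isProduct_prod (X Y : Variety k) : IsProduct (prX X Y) (prY X Y) where
  isPullback := IsPullback.of_hasPullback X.str Y.str
  dominant_fst := inferInstance
  dominant_snd := inferInstance
  fst_str := prX_str X Y
  snd_str := prY_str X Y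

theorem IsProduct.swap {X Y Z : Variety k} {p : Z.carrier ⟶ X.carrier}
    {q : Z.carrier ⟶ Y.carrier} (h : IsProduct p q) : IsProduct q p :=
  ⟨h.isPullback.flip, h.dominant_snd, h.dominant_fst, h.snd_str, h.fst_str⟩

/-- The homomorphism `𝒪_{X, φ z} → 𝒪_{Z, z}` of a morphism `φ : Z → X`. -/
noncomputable def stalkPull {X Z : Variety k} (φ : Z.carrier ⟶ X.carrier) (hφ : φ ≫ X.str = Z.str)
    (z : Z.carrier) : X.localRing (φ z) →ₐ[k] Z.localRing z where
  toRingHom := (φ.stalkMap z).hom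
  commutes' a := by
    have : CommRingCat.ofHom (X.const (φ z)) ≫ φ.stalkMap z = CommRingCat.ofHom (Z.const z) := by
      apply Spec.map_injective
      rw [Spec.map_comp, ← fromSpecStalk_str, ← fromSpecStalk_str,
        Scheme.SpecMap_stalkMap_fromSpecStalk_assoc, hφ]
    exact congrArg (fun q => q.hom a) this

instance {X Z : Variety k} (φ : Z.carrier ⟶ X.carrier) (hφ : φ ≫ X.str = Z.str)
    (z : Z.carrier) : IsLocalHom (stalkPull φ hφ z).toRingHom :=
  inferInstanceAs (IsLocalHom (φ.stalkMap z).hom)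

theorem funPull_toFun {X Z : Variety k} (φ : Z.carrier ⟶ X.carrier) [IsDominant φ]
    (hφ : φ ≫ X.str = Z.str) (z : Z.carrier) (a : X.localRing (φ z)) :
    funPull φ hφ (X.toFun (φ z) a) = Z.toFun z (stalkPull φ hφ z a) := by
  have h : X.carrier.presheaf.stalkSpecializes (genericPoint_specializes (φ z)) ≫
      X.carrier.presheaf.stalkSpecializes (specializes_of_eq (map_genericPoint φ)) ≫
        φ.stalkMap (genericPoint Z.carrier) =
      φ.stalkMap z ≫ Z.carrier.presheaf.stalkSpecializes (genericPoint_specializes z) := by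
    rw [TopCat.Presheaf.stalkSpecializes_comp_assoc, ← Scheme.Hom.stalkSpecializes_stalkMap]
  exact congrArg (fun q => q.hom a) h

/-- Elimination of the points of a local ring: a homomorphism from `𝒪_z` to a local ring `R` is
the same as a point `w` specializing to `z` and a local homomorphism `𝒪_w → R`. -/
theorem exists_isLocalHom_of_specializes (X : Variety k) (z : X.carrier) (R : Type u) [CommRing R]
    [IsLocalRing R] (φ : X.localRing z →+* R) :
    ∃ (w : X.carrier) (h : w ⤳ z) (β : X.localRing w →+* R), IsLocalHom β ∧
      ∀ a, β (X.carrier.presheaf.stalkSpecializes h a) = φ a := by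
  let f : Spec (CommRingCat.of R) ⟶ X.carrier :=
    Spec.map (CommRingCat.ofHom φ) ≫ X.carrier.fromSpecStalk z
  have hw : f (IsLocalRing.closedPoint R) ⤳ z := by
    have : f (IsLocalRing.closedPoint R) ∈ Set.range (X.carrier.fromSpecStalk z) :=
      ⟨_, (Scheme.Hom.comp_apply _ _ _).symm⟩
    rwa [Scheme.range_fromSpecStalk] at this
  refine ⟨_, hw, (Scheme.stalkClosedPointTo f).hom, inferInstance, fun a => ?_⟩
  have : X.carrier.presheaf.stalkSpecializes hw ≫ Scheme.stalkClosedPointTo f =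
      CommRingCat.ofHom φ := by
    apply Spec.map_injective
    rw [← cancel_mono (X.carrier.fromSpecStalk z), Spec.map_comp, Category.assoc,
      Scheme.SpecMap_stalkSpecializes_fromSpecStalk, Scheme.Spec_stalkClosedPointTo_fromSpecStalk]
  exact congrArg (fun q => q.hom a) this

namespace IsProduct

variable {X Y Z : Variety k} {p : Z.carrier ⟶ X.carrier} {q : Z.carrier ⟶ Y.carrier}

/-- Local homomorphisms from `𝒪_{X, x}` and `𝒪_{Y, y}` to a local ring factor through the local
ring of a point of `X × Y` over `x` and `y`. -/
theorem exists_point (h : IsProduct p q) (x : X.carrier) (y : Y.carrier) (R : Type u) [CommRing R]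
    [Algebra k R] [IsLocalRing R] (φ : X.localRing x →ₐ[k] R) (ψ : Y.localRing y →ₐ[k] R)
    [IsLocalHom φ.toRingHom] [IsLocalHom ψ.toRingHom] :
    ∃ (z : Z.carrier) (hx : p z = x) (hy : q z = y) (β : Z.localRing z →ₐ[k] R),
      IsLocalHom β.toRingHom ∧
      (∀ a, β (stalkPull p h.fst_str z
        (X.carrier.presheaf.stalkSpecializes (specializes_of_eq hx) a)) = φ a) ∧
      ∀ a, β (stalkPull q h.snd_str z
        (Y.carrier.presheaf.stalkSpecializes (specializes_of_eq hy) a)) = ψ a := by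
  let f₁ : Spec (CommRingCat.of R) ⟶ X.carrier :=
    Spec.map (CommRingCat.ofHom φ.toRingHom) ≫ X.carrier.fromSpecStalk x
  let f₂ : Spec (CommRingCat.of R) ⟶ Y.carrier :=
    Spec.map (CommRingCat.ofHom ψ.toRingHom) ≫ Y.carrier.fromSpecStalk y
  have hs₁ : f₁ ≫ X.str = Spec.map (CommRingCat.ofHom (algebraMap k R)) := by
    rw [Category.assoc, fromSpecStalk_str, ← Spec.map_comp, ← CommRingCat.ofHom_comp]
    congr 2
    exact φ.comp_algebraMap
  have hs₂ : f₂ ≫ Y.str = Spec.map (CommRingCat.ofHom (algebraMap k R)) := by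
    rw [Category.assoc, fromSpecStalk_str, ← Spec.map_comp, ← CommRingCat.ofHom_comp]
    congr 2
    exact ψ.comp_algebraMap
  let f : Spec (CommRingCat.of R) ⟶ Z.carrier := h.isPullback.lift f₁ f₂ (hs₁.trans hs₂.symm)
  have hf₁ : f ≫ p = f₁ := h.isPullback.lift_fst _ _ _
  have hf₂ : f ≫ q = f₂ := h.isPullback.lift_snd _ _ _
  have hx : p (f (IsLocalRing.closedPoint R)) = x := by
    have h1 : X.carrier.fromSpecStalk x
        (Spec.map (CommRingCat.ofHom φ.toRingHom) (IsLocalRing.closedPoint R)) = x := by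
      have : Spec.map (CommRingCat.ofHom φ.toRingHom) (IsLocalRing.closedPoint R) =
        IsLocalRing.closedPoint (X.localRing x) := IsLocalRing.comap_closedPoint φ.toRingHom
      rw [this, Scheme.fromSpecStalk_closedPoint]
    exact (congrArg (fun g : Spec (CommRingCat.of R) ⟶ X.carrier =>
      g (IsLocalRing.closedPoint R)) hf₁).trans h1
  have hy : q (f (IsLocalRing.closedPoint R)) = y := by
    have h1 : Y.carrier.fromSpecStalk y
        (Spec.map (CommRingCat.ofHom ψ.toRingHom) (IsLocalRing.closedPoint R)) = y := by
      have : Spec.map (CommRingCat.ofHom ψ.toRingHom) (IsLocalRing.closedPoint R) =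
        IsLocalRing.closedPoint (Y.localRing y) := IsLocalRing.comap_closedPoint ψ.toRingHom
      rw [this, Scheme.fromSpecStalk_closedPoint]
    exact (congrArg (fun g : Spec (CommRingCat.of R) ⟶ Y.carrier =>
      g (IsLocalRing.closedPoint R)) hf₂).trans h1
  have h₁ : X.carrier.presheaf.stalkSpecializes (specializes_of_eq hx) ≫ p.stalkMap _ ≫
      Scheme.stalkClosedPointTo f = CommRingCat.ofHom φ.toRingHom := by
    apply Spec.map_injective
    rw [← cancel_mono (X.carrier.fromSpecStalk x)]
    simp only [Spec.map_comp, Category.assoc, Scheme.SpecMap_stalkSpecializes_fromSpecStalk,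
      Scheme.SpecMap_stalkMap_fromSpecStalk]
    rw [Scheme.Spec_stalkClosedPointTo_fromSpecStalk_assoc, hf₁]
  have h₂ : Y.carrier.presheaf.stalkSpecializes (specializes_of_eq hy) ≫ q.stalkMap _ ≫
      Scheme.stalkClosedPointTo f = CommRingCat.ofHom ψ.toRingHom := by
    apply Spec.map_injective
    rw [← cancel_mono (Y.carrier.fromSpecStalk y)]
    simp only [Spec.map_comp, Category.assoc, Scheme.SpecMap_stalkSpecializes_fromSpecStalk,
      Scheme.SpecMap_stalkMap_fromSpecStalk]
    rw [Scheme.Spec_stalkClosedPointTo_fromSpecStalk_assoc, hf₂]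
  have hk : CommRingCat.ofHom (Z.const _) ≫ Scheme.stalkClosedPointTo f =
      CommRingCat.ofHom (algebraMap k R) := by
    apply Spec.map_injective
    rw [Spec.map_comp, ← fromSpecStalk_str, Scheme.Spec_stalkClosedPointTo_fromSpecStalk_assoc,
      ← h.fst_str, ← Category.assoc, hf₁, hs₁]
  exact ⟨_, hx, hy, { toRingHom := (Scheme.stalkClosedPointTo f).hom
                      commutes' := fun a => congrArg (fun q => q.hom a) hk },
    inferInstanceAs (IsLocalHom (Scheme.stalkClosedPointTo f).hom),
    fun a => congrArg (fun q => q.hom a) h₁, fun a => congrArg (fun q => q.hom a) h₂⟩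

/-- The homomorphism `𝒪_{X, p z} ⊗ 𝒪_{Y, q z} → 𝒪_{Z, z}`. -/
noncomputable def tensorMap (h : IsProduct p q) (z : Z.carrier) :
    X.localRing (p z) ⊗[k] Y.localRing (q z) →ₐ[k] Z.localRing z :=
  Algebra.TensorProduct.productMap (stalkPull p h.fst_str z) (stalkPull q h.snd_str z)

theorem tensorMap_tmul_one (h : IsProduct p q) (z : Z.carrier) (a : X.localRing (p z)) :
    h.tensorMap z (a ⊗ₜ 1) = stalkPull p h.fst_str z a := by
  simp [tensorMap]

theorem tensorMap_one_tmul (h : IsProduct p q) (z : Z.carrier) (b : Y.localRing (q z)) :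
    h.tensorMap z (1 ⊗ₜ b) = stalkPull q h.snd_str z b := by
  simp [tensorMap]

theorem tensorMap_tmul (h : IsProduct p q) (z : Z.carrier) (a : X.localRing (p z))
    (b : Y.localRing (q z)) :
    h.tensorMap z (a ⊗ₜ b) = stalkPull p h.fst_str z a * stalkPull q h.snd_str z b := by
  simp [tensorMap]

/-- The prime ideal of `𝒪_{X, p z} ⊗ 𝒪_{Y, q z}` that corresponds to the point `z`. -/
noncomputable def primeAt (h : IsProduct p q) (z : Z.carrier) :
    _root_.Ideal (X.localRing (p z) ⊗[k] Y.localRing (q z)) :=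
  (IsLocalRing.maximalIdeal (Z.localRing z)).comap (h.tensorMap z).toRingHom

instance (h : IsProduct p q) (z : Z.carrier) : (h.primeAt z).IsPrime :=
  Ideal.comap_isPrime _ _

/-- `𝒪_{Z, z}` is the localization of `𝒪_{X, p z} ⊗ 𝒪_{Y, q z}` at a prime ideal. -/
theorem isLocalization (h : IsProduct p q) (z : Z.carrier) :
    letI := (h.tensorMap z).toRingHom.toAlgebra
    IsLocalization.AtPrime (Z.localRing z) (h.primeAt z) := by
  let := (h.tensorMap z).toRingHom.toAlgebra
  let ι := h.tensorMap z
  let R := Localization.AtPrime (h.primeAt z)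
  have hu : ∀ t : (h.primeAt z).primeCompl, IsUnit (ι.toRingHom t) := fun t => by
    by_contra hn
    exact t.2 ((IsLocalRing.mem_maximalIdeal _).2 hn)
  let α : R →+* Z.localRing z := IsLocalization.lift hu
  have hα : ∀ t, α (algebraMap _ R t) = ι t := fun t => IsLocalization.lift_eq hu t
  have hαloc : IsLocalHom α := ⟨fun a ha => by
    obtain ⟨⟨t, s⟩, hts⟩ := IsLocalization.surj (h.primeAt z).primeCompl a
    have h1 : IsUnit (ι t) := by
      rw [← hα, ← hts, map_mul, hα]
      exact ha.mul (hu s)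
    have h2 : t ∈ (h.primeAt z).primeCompl := fun ht =>
      (IsLocalRing.mem_maximalIdeal _).1 ht h1
    have h3 := IsLocalization.map_units R (⟨t, h2⟩ : (h.primeAt z).primeCompl)
    rw [← hts] at h3
    exact isUnit_of_mul_isUnit_left h3⟩
  let φ₁ : X.localRing (p z) →+* R :=
    (algebraMap (X.localRing (p z) ⊗[k] Y.localRing (q z)) R).comp
      Algebra.TensorProduct.includeLeftRingHom
  let φ₂ : Y.localRing (q z) →+* R :=
    (algebraMap (X.localRing (p z) ⊗[k] Y.localRing (q z)) R).comp
      (Algebra.TensorProduct.includeRight (R := k)).toRingHom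
  let f₁ : Spec (CommRingCat.of R) ⟶ X.carrier :=
    Spec.map (CommRingCat.ofHom φ₁) ≫ X.carrier.fromSpecStalk (p z)
  let f₂ : Spec (CommRingCat.of R) ⟶ Y.carrier :=
    Spec.map (CommRingCat.ofHom φ₂) ≫ Y.carrier.fromSpecStalk (q z)
  have hs : f₁ ≫ X.str = f₂ ≫ Y.str := by
    rw [Category.assoc, Category.assoc, fromSpecStalk_str, fromSpecStalk_str, ← Spec.map_comp,
      ← Spec.map_comp, ← CommRingCat.ofHom_comp, ← CommRingCat.ofHom_comp]
    congr 2
    ext a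
    exact congrArg (algebraMap (X.localRing (p z) ⊗[k] Y.localRing (q z)) R)
      (Algebra.TensorProduct.tmul_one_eq_one_tmul (R := k) a)
  let f : Spec (CommRingCat.of R) ⟶ Z.carrier := h.isPullback.lift f₁ f₂ hs
  have hf₁ : f ≫ p = f₁ := h.isPullback.lift_fst _ _ _
  have hf₂ : f ≫ q = f₂ := h.isPullback.lift_snd _ _ _
  have hαf : Spec.map (CommRingCat.ofHom α) ≫ f = Z.carrier.fromSpecStalk z := by
    apply h.isPullback.hom_ext
    · rw [Category.assoc, hf₁, ← Scheme.SpecMap_stalkMap_fromSpecStalk, ← Spec.map_comp_assoc,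
        ← CommRingCat.ofHom_comp]
      congr 2
      ext a
      exact (hα _).trans (h.tensorMap_tmul_one z a)
    · rw [Category.assoc, hf₂, ← Scheme.SpecMap_stalkMap_fromSpecStalk, ← Spec.map_comp_assoc,
        ← CommRingCat.ofHom_comp]
      congr 2
      ext a
      exact (hα _).trans (h.tensorMap_one_tmul z a)
  have hfz : f (IsLocalRing.closedPoint R) = z := by
    have h1 := congrArg (fun g : Spec (Z.carrier.presheaf.stalk z) ⟶ Z.carrier =>
      g (IsLocalRing.closedPoint (Z.localRing z))) hαf
    have h2 : Spec.map (CommRingCat.ofHom α) (IsLocalRing.closedPoint (Z.localRing z)) =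
      IsLocalRing.closedPoint R := IsLocalRing.comap_closedPoint α
    have h3 : f (Spec.map (CommRingCat.ofHom α) (IsLocalRing.closedPoint (Z.localRing z))) = z :=
      h1.trans Scheme.fromSpecStalk_closedPoint
    rwa [h2] at h3
  let b : Z.carrier.presheaf.stalk z ⟶ CommRingCat.of R :=
    Z.carrier.presheaf.stalkSpecializes (specializes_of_eq hfz) ≫ Scheme.stalkClosedPointTo f
  let β : Z.localRing z →+* R := b.hom
  have hβ : Spec.map b ≫ Z.carrier.fromSpecStalk z = f := by
    rw [Spec.map_comp, Category.assoc, Scheme.SpecMap_stalkSpecializes_fromSpecStalk,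
      Scheme.Spec_stalkClosedPointTo_fromSpecStalk]
  have hαβ : ∀ a, α (β a) = a := fun a => by
    have : b ≫ CommRingCat.ofHom α = 𝟙 (Z.carrier.presheaf.stalk z) := by
      apply Spec.map_injective
      rw [← cancel_mono (Z.carrier.fromSpecStalk z), Spec.map_comp, Category.assoc, hβ, hαf,
        Spec.map_id]
      exact (Category.id_comp _).symm
    exact congrArg (fun q => q.hom a) this
  have hβι : β.comp ι.toRingHom = algebraMap _ R := by
    have h₁ : p.stalkMap z ≫ b = CommRingCat.ofHom φ₁ := by
      apply Spec.map_injective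
      rw [← cancel_mono (X.carrier.fromSpecStalk (p z)), Spec.map_comp, Category.assoc,
        Scheme.SpecMap_stalkMap_fromSpecStalk, ← Category.assoc, hβ, hf₁]
    have h₂ : q.stalkMap z ≫ b = CommRingCat.ofHom φ₂ := by
      apply Spec.map_injective
      rw [← cancel_mono (Y.carrier.fromSpecStalk (q z)), Spec.map_comp, Category.assoc,
        Scheme.SpecMap_stalkMap_fromSpecStalk, ← Category.assoc, hβ, hf₂]
    apply Algebra.TensorProduct.ringHom_ext
    · ext a
      have := congrArg (fun q => q.hom a) h₁
      exact (congrArg β (h.tensorMap_tmul_one z a)).trans this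
    · ext a
      have := congrArg (fun q => q.hom a) h₂
      exact (congrArg β (h.tensorMap_one_tmul z a)).trans this
  have hβα : ∀ a, β (α a) = a := fun a => by
    have : (β.comp α) = RingHom.id R := by
      apply IsLocalization.ringHom_ext (h.primeAt z).primeCompl
      refine RingHom.ext fun t => ?_
      change β (α (algebraMap _ R t)) = algebraMap _ R t
      rw [hα]
      exact congrArg (fun g => g t) hβι
    exact congrArg (fun g => g a) this
  exact IsLocalization.isLocalization_of_algEquiv (h.primeAt z).primeCompl
    (S := R) (AlgEquiv.ofBijective { α with commutes' := hα }
      ⟨Function.LeftInverse.injective hβα, fun a => ⟨β a, hαβ a⟩⟩)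

end IsProduct

end Variety

/-! ### Regular functions on the local rings of a variety -/

namespace Variety

variable {k : Type u} [Field k] {r : ℕ}

/-- The localizations of a local ring of `X` at its primes are the local rings of the points that
specialize to the given one. -/
theorem exists_bijective_of_isPrime (X : Variety k) (z : X.carrier)
    (P : _root_.Ideal (X.localRing z)) [P.IsPrime] :
    ∃ (w : X.carrier) (h : w ⤳ z) (β : X.localRing w →+* Localization.AtPrime P),
      Function.Bijective β ∧
      ∀ a, β (X.carrier.presheaf.stalkSpecializes h a) = algebraMap _ _ a := by
  obtain ⟨w, h, β, hβ, hβa⟩ := exists_isLocalHom_of_specializes X z (Localization.AtPrime P)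
    (algebraMap _ _)
  have htoFun : ∀ a, X.toFun w (X.carrier.presheaf.stalkSpecializes h a) = X.toFun z a := by
    intro a
    have : X.carrier.presheaf.stalkSpecializes h ≫
        X.carrier.presheaf.stalkSpecializes (genericPoint_specializes w) =
        X.carrier.presheaf.stalkSpecializes (genericPoint_specializes z) :=
      TopCat.Presheaf.stalkSpecializes_comp ..
    exact congrArg (fun q => q.hom a) this
  refine ⟨w, h, β, ⟨?_, ?_⟩, hβa⟩
  · rw [injective_iff_map_eq_zero]
    intro a ha
    obtain ⟨x, y, hy, hxy⟩ := IsFractionRing.div_surjective (A := X.localRing z) (X.toFun w a)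
    have hy0 : X.toFun z y ≠ 0 := by
      rw [Ne, map_eq_zero_iff _ (X.toFun_injective z)]
      exact nonZeroDivisors.ne_zero hy
    have h1 : a * X.carrier.presheaf.stalkSpecializes h y =
        X.carrier.presheaf.stalkSpecializes h x := by
      apply X.toFun_injective w
      rw [map_mul, htoFun, htoFun, ← hxy, div_mul_cancel₀ _ hy0]
    have h2 := congrArg β h1
    rw [map_mul, ha, zero_mul, hβa, eq_comm, map_eq_zero_iff _ (IsLocalization.injective _
      (Ideal.primeCompl_le_nonZeroDivisors P))] at h2
    apply X.toFun_injective w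
    rw [← hxy, h2]
    simp
  · intro b
    obtain ⟨⟨s, t⟩, hst⟩ := IsLocalization.surj P.primeCompl b
    have hu : IsUnit (X.carrier.presheaf.stalkSpecializes h t.1) := by
      have := IsLocalization.map_units (Localization.AtPrime P) t
      rw [← hβa] at this
      exact isUnit_of_map_unit β _ this
    obtain ⟨u, hu⟩ := hu
    refine ⟨X.carrier.presheaf.stalkSpecializes h s * ↑u⁻¹, ?_⟩
    have h3 := IsLocalization.map_units (Localization.AtPrime P) t
    apply h3.mul_right_cancel
    rw [hst, ← hβa, ← hβa, ← map_mul, ← hu, mul_assoc, Units.inv_mul, mul_one]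

theorem toFun_stalkSpecializes (X : Variety k) {w z : X.carrier} (h : w ⤳ z) (a : X.localRing z) :
    X.toFun w (X.carrier.presheaf.stalkSpecializes h a) = X.toFun z a := by
  have : X.carrier.presheaf.stalkSpecializes h ≫
      X.carrier.presheaf.stalkSpecializes (genericPoint_specializes w) =
      X.carrier.presheaf.stalkSpecializes (genericPoint_specializes z) :=
    TopCat.Presheaf.stalkSpecializes_comp ..
  exact congrArg (fun q => q.hom a) this

/-- A rational function without poles through `z` is regular at `z`. -/
theorem exists_toFun_eq_of_forall_ord_nonneg {X : Variety k}
    (hX : SmoothOfRelativeDimension r X.str) (z : X.carrier) (f : X.funField)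
    (hf : ∀ w : X.PrimeDiv, w.1 ⤳ z → 0 ≤ Scheme.ord f w.1) : ∃ a, X.toFun z a = f := by
  have := isIntegrallyClosed hX z
  refine IsIntegrallyClosed.exists_algebraMap_eq_of_height_one (R := X.localRing z) f
    fun P hP hP1 => ?_
  obtain ⟨w, h, β, hβ, hβa⟩ := exists_bijective_of_isPrime X z P
  have hw : coheight w = 1 := by
    have h1 : ringKrullDim (X.localRing w) = ringKrullDim (Localization.AtPrime P) :=
      ringKrullDim_eq_of_ringEquiv (RingEquiv.ofBijective β hβ)
    rw [ringKrullDim_stalk_eq_coheight, IsLocalization.AtPrime.ringKrullDim_eq_height P, hP1] at h1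
    exact_mod_cast h1
  have := isDiscreteValuationRing hX ⟨w, hw⟩
  obtain ⟨a, ha⟩ := exists_toFun_eq_of_ord_nonneg ⟨w, hw⟩ (hf ⟨w, hw⟩ h)
  obtain ⟨⟨s, t⟩, hst⟩ := IsLocalization.surj P.primeCompl (β a)
  refine ⟨s, t, t.2, ?_⟩
  rw [← hβa, ← hβa, ← map_mul] at hst
  have := congrArg (X.toFun w) (hβ.1 hst)
  rw [map_mul, toFun_stalkSpecializes, toFun_stalkSpecializes] at this
  rw [← ha]
  exact this

theorem eq_genericPoint_of_maximalIdeal_eq_bot (X : Variety k) (z : X.carrier)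
    (h : IsLocalRing.maximalIdeal (X.localRing z) = ⊥) : z = genericPoint X.carrier := by
  have h1 := ringKrullDim_eq_zero_of_isField (IsLocalRing.isField_iff_maximalIdeal_eq.2 h)
  rw [ringKrullDim_stalk_eq_coheight] at h1
  have h0 : coheight z = 0 := by exact_mod_cast h1
  rw [coheight_eq_zero] at h0
  have hs : genericPoint X.carrier ⤳ z := genericPoint_specializes z
  exact (Specializes.antisymm (h0 hs) hs).eq

theorem coheight_genericPoint (X : Variety k) : coheight (genericPoint X.carrier) = 0 :=
  coheight_eq_zero.mpr fun b _ => (genericPoint_specializes b : genericPoint X.carrier ⤳ b)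

theorem toFun_bijective_of_eq (X : Variety k) (z : X.carrier) (hz : z = genericPoint X.carrier) :
    Function.Bijective (X.toFun z) := by
  refine ⟨X.toFun_injective z, fun f => ?_⟩
  subst hz
  refine ⟨f, ?_⟩
  change X.carrier.presheaf.stalkSpecializes _ f = f
  rw [TopCat.Presheaf.stalkSpecializes_refl]
  rfl

end Variety

/-! ### Tensor products of domains -/

section Tensor

variable {k A B L : Type u} [Field k] [CommRing A] [Algebra k A] [CommRing B] [Algebra k B]
  [Field L] [Algebra k L] [Algebra B L] [IsScalarTower k B L] [FaithfulSMul B L]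

open Algebra.TensorProduct in
/-- If `L` stays a domain after extension of scalars, primes of `A` extend to primes of `A ⊗ B`,
and the extended prime meets `A` and `B` in the expected ideals. -/
theorem Ideal.isPrime_map_includeLeft
    (hL : ∀ (F : Type u) [Field F] [Algebra k F], IsDomain (F ⊗[k] L))
    (P : _root_.Ideal A) [P.IsPrime] :
    (P.map (includeLeftRingHom : A →+* A ⊗[k] B)).IsPrime ∧
    (∀ a : A, a ⊗ₜ[k] (1 : B) ∈ P.map (includeLeftRingHom : A →+* A ⊗[k] B) → a ∈ P) ∧
    (∀ b : B, (1 : A) ⊗ₜ[k] b ∈ P.map (includeLeftRingHom : A →+* A ⊗[k] B) → b = 0) := by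
  let F := FractionRing (A ⧸ P)
  have := hL F
  let φ : A ⊗[k] B →ₐ[k] (A ⧸ P) ⊗[k] B :=
    Algebra.TensorProduct.map (Ideal.Quotient.mkₐ k P) (AlgHom.id k B)
  let ψ : (A ⧸ P) ⊗[k] B →ₐ[k] F ⊗[k] L :=
    Algebra.TensorProduct.map (IsScalarTower.toAlgHom k (A ⧸ P) F) (IsScalarTower.toAlgHom k B L)
  have hψ : Function.Injective ψ := by
    exact TensorProduct.map_injective_of_flat_flat
      (IsScalarTower.toAlgHom k (A ⧸ P) F).toLinearMap (IsScalarTower.toAlgHom k B L).toLinearMap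
      (IsFractionRing.injective (A ⧸ P) F) (FaithfulSMul.algebraMap_injective B L)
  have hφ : RingHom.ker φ = P.map (includeLeftRingHom : A →+* A ⊗[k] B) := by
    have := Algebra.TensorProduct.rTensor_ker (R := k) (C := B) (f := Ideal.Quotient.mkₐ k P)
      (Ideal.Quotient.mkₐ_surjective k P)
    have h1 : RingHom.ker (Ideal.Quotient.mkₐ k P) = P := Ideal.Quotient.mkₐ_ker k P
    rw [h1] at this
    exact this
  have hker : RingHom.ker (ψ.comp φ) = P.map (includeLeftRingHom : A →+* A ⊗[k] B) := by
    rw [← hφ]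
    ext t
    exact map_eq_zero_iff ψ hψ
  rw [← hker]
  refine ⟨RingHom.ker_isPrime _, fun a ha => ?_, fun b hb => ?_⟩
  · rw [RingHom.mem_ker] at ha
    have h1 : ψ (φ (a ⊗ₜ 1)) = algebraMap (A ⧸ P) F (Ideal.Quotient.mk P a) ⊗ₜ 1 := by
      simp [φ, ψ]
    have h2 : (algebraMap (A ⧸ P) F (Ideal.Quotient.mk P a)) ⊗ₜ[k] (1 : L) = 0 := by
      rw [← h1]; exact ha
    have h3 := (includeLeft_injective (R := k) (S := k) (A := F) (B := L)
      (algebraMap k L).injective) (h2.trans (map_zero _).symm)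
    rw [map_eq_zero_iff _ (IsFractionRing.injective (A ⧸ P) F)] at h3
    exact Ideal.Quotient.eq_zero_iff_mem.1 h3
  · rw [RingHom.mem_ker] at hb
    have h1 : ψ (φ (1 ⊗ₜ b)) = 1 ⊗ₜ algebraMap B L b := by
      simp [φ, ψ]
    have h2 : (1 : F) ⊗ₜ[k] algebraMap B L b = 0 := by
      rw [← h1]; exact hb
    have h3 := (includeRight_injective (R := k) (A := F) (B := L)
      (algebraMap k F).injective) (h2.trans (map_zero _).symm)
    exact (map_eq_zero_iff _ (FaithfulSMul.algebraMap_injective B L)).1 h3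

end Tensor

/-! ### Products: points of codimension one -/

namespace Variety

variable {k : Type u} [Field k] {r s : ℕ}

theorem ringKrullDim_primeDiv {X : Variety k} (w : X.PrimeDiv) :
    ringKrullDim (X.localRing w.1) = 1 := by
  rw [ringKrullDim_stalk_eq_coheight, w.2]; rfl

theorem eq_maximalIdeal_of_primeDiv {X : Variety k} (w : X.PrimeDiv)
    (P : _root_.Ideal (X.localRing w.1)) [P.IsPrime] (hP : P ≠ ⊥) :
    P = IsLocalRing.maximalIdeal _ :=
  IsLocalRing.eq_maximalIdeal (Ring.krullDimLE_one_iff_of_noZeroDivisors.1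
    (Ring.krullDimLE_iff.2 (ringKrullDim_primeDiv w).le) P hP inferInstance)

theorem toFun_genericPoint (X : Variety k) (f : X.localRing (genericPoint X.carrier)) :
    X.toFun (genericPoint X.carrier) f = f := by
  change X.carrier.presheaf.stalkSpecializes _ f = f
  rw [TopCat.Presheaf.stalkSpecializes_refl]
  rfl

namespace IsProduct

variable {X Y Z : Variety k} {p : Z.carrier ⟶ X.carrier} {q : Z.carrier ⟶ Y.carrier}

section

variable (h : IsProduct p q)

/-- The pull-back of rational functions along the first projection. -/
noncomputable def pullFst (h : IsProduct p q) : X.funField →ₐ[k] Z.funField :=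
  haveI := h.dominant_fst
  funPull p h.fst_str

/-- The pull-back of rational functions along the second projection. -/
noncomputable def pullSnd (h : IsProduct p q) : Y.funField →ₐ[k] Z.funField :=
  h.swap.pullFst

theorem pullFst_toFun (z : Z.carrier) (a : X.localRing (p z)) :
    h.pullFst (X.toFun (p z) a) = Z.toFun z (stalkPull p h.fst_str z a) :=
  haveI := h.dominant_fst
  funPull_toFun p h.fst_str z a

theorem pullSnd_toFun (z : Z.carrier) (b : Y.localRing (q z)) :
    h.pullSnd (Y.toFun (q z) b) = Z.toFun z (stalkPull q h.snd_str z b) :=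
  h.swap.pullFst_toFun z b

theorem stalkPull_injective (z : Z.carrier) :
    Function.Injective (stalkPull p h.fst_str z) := by
  intro a b hab
  apply X.toFun_injective
  apply h.pullFst.injective
  exact (h.pullFst_toFun z a).trans ((congrArg _ hab).trans (h.pullFst_toFun z b).symm)

theorem stalkPull_mem_maximalIdeal (z : Z.carrier) (a : X.localRing (p z)) :
    stalkPull p h.fst_str z a ∈ IsLocalRing.maximalIdeal (Z.localRing z) ↔
      a ∈ IsLocalRing.maximalIdeal (X.localRing (p z)) := by
  rw [IsLocalRing.mem_maximalIdeal, IsLocalRing.mem_maximalIdeal, mem_nonunits_iff,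
    mem_nonunits_iff, not_iff_not]
  exact isUnit_map_iff (stalkPull p h.fst_str z).toRingHom a

theorem isPrime_map (_ : IsProduct p q) (z : Z.carrier)
    (P : _root_.Ideal (X.localRing (p z))) [P.IsPrime] :
    (P.map (Algebra.TensorProduct.includeLeftRingHom :
      X.localRing (p z) →+* X.localRing (p z) ⊗[k] Y.localRing (q z))).IsPrime ∧
    (∀ a : X.localRing (p z), a ⊗ₜ[k] (1 : Y.localRing (q z)) ∈
      P.map (Algebra.TensorProduct.includeLeftRingHom :
        X.localRing (p z) →+* X.localRing (p z) ⊗[k] Y.localRing (q z)) → a ∈ P) ∧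
    (∀ b : Y.localRing (q z), (1 : X.localRing (p z)) ⊗ₜ[k] b ∈
      P.map (Algebra.TensorProduct.includeLeftRingHom :
        X.localRing (p z) →+* X.localRing (p z) ⊗[k] Y.localRing (q z)) → b = 0) :=
  haveI : FaithfulSMul (Y.localRing (q z)) Y.funField :=
    (faithfulSMul_iff_algebraMap_injective _ _).2 (Y.toFun_injective (q z))
  Ideal.isPrime_map_includeLeft (L := Y.funField) (fun F _ _ => isDomain_tensor_funField Y F) P

theorem mem_primeAt (z : Z.carrier) (t : X.localRing (p z) ⊗[k] Y.localRing (q z)) :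
    t ∈ h.primeAt z ↔ h.tensorMap z t ∈ IsLocalRing.maximalIdeal (Z.localRing z) := Iff.rfl

theorem tmul_one_mem_primeAt (z : Z.carrier) (a : X.localRing (p z)) :
    a ⊗ₜ 1 ∈ h.primeAt z ↔ a ∈ IsLocalRing.maximalIdeal (X.localRing (p z)) := by
  rw [mem_primeAt, tensorMap_tmul_one]
  exact h.stalkPull_mem_maximalIdeal z a

theorem one_tmul_mem_primeAt (z : Z.carrier) (b : Y.localRing (q z)) :
    1 ⊗ₜ b ∈ h.primeAt z ↔ b ∈ IsLocalRing.maximalIdeal (Y.localRing (q z)) := by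
  rw [mem_primeAt, tensorMap_one_tmul]
  exact h.swap.stalkPull_mem_maximalIdeal z b

/-- A prime of height one of `𝒪_{X, p w} ⊗ 𝒪_{Y, q w}` that meets `𝒪_{X, p w}` is extended from
any of its nonzero primes. -/
theorem primeAt_eq_map (w : Z.PrimeDiv) (P : _root_.Ideal (X.localRing (p w.1))) [P.IsPrime]
    (hP : P ≠ ⊥) : h.primeAt w.1 = P.map Algebra.TensorProduct.includeLeftRingHom := by
  let := (h.tensorMap w.1).toRingHom.toAlgebra
  have hloc := h.isLocalization w.1
  obtain ⟨hprime, -, -⟩ := h.isPrime_map w.1 P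
  set I := P.map (Algebra.TensorProduct.includeLeftRingHom :
    X.localRing (p w.1) →+* X.localRing (p w.1) ⊗[k] Y.localRing (q w.1)) with hI
  have hle : I ≤ h.primeAt w.1 := by
    rw [hI, Ideal.map_le_iff_le_comap]
    intro a ha
    exact (h.tmul_one_mem_primeAt w.1 a).2 (IsLocalRing.le_maximalIdeal (Ideal.IsPrime.ne_top ‹_›) ha)
  have hdisj : Disjoint
      ((h.primeAt w.1).primeCompl : Set (X.localRing (p w.1) ⊗[k] Y.localRing (q w.1)))
      (I : Set (X.localRing (p w.1) ⊗[k] Y.localRing (q w.1))) :=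
    Set.disjoint_left.2 fun t ht ht' => ht (hle ht')
  have hJ := IsLocalization.isPrime_of_isPrime_disjoint (h.primeAt w.1).primeCompl
    (Z.localRing w.1) I hprime hdisj
  have hJ0 : I.map (algebraMap _ (Z.localRing w.1)) ≠ ⊥ := by
    intro h0
    obtain ⟨a, haP, ha0⟩ := Submodule.exists_mem_ne_zero_of_ne_bot hP
    have h1 : algebraMap _ (Z.localRing w.1) (a ⊗ₜ[k] (1 : Y.localRing (q w.1))) ∈
        I.map (algebraMap _ (Z.localRing w.1)) :=
      Ideal.mem_map_of_mem _ (Ideal.mem_map_of_mem _ haP)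
    rw [h0, Ideal.mem_bot] at h1
    exact ha0 (h.stalkPull_injective w.1 (((h.tensorMap_tmul_one w.1 a).symm.trans h1).trans
      (map_zero _).symm))
  have hmax := eq_maximalIdeal_of_primeDiv w _ hJ0
  have := IsLocalization.under_map_of_isPrime_disjoint (h.primeAt w.1).primeCompl
    (Z.localRing w.1) hprime hdisj
  rw [hmax] at this
  exact this

/-- A prime divisor of the product that does not dominate the first factor dominates the second: its
prime ideal is extended from the first factor, so it meets the second only in zero. -/
theorem snd_eq_genericPoint (h : IsProduct p q) (w : Z.PrimeDiv) (hw : p w.1 ≠ genericPoint X.carrier) :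
    q w.1 = genericPoint Y.carrier := by
  have hm : IsLocalRing.maximalIdeal (X.localRing (p w.1)) ≠ ⊥ :=
    fun h0 => hw (X.eq_genericPoint_of_maximalIdeal_eq_bot _ h0)
  apply Y.eq_genericPoint_of_maximalIdeal_eq_bot
  rw [eq_bot_iff]
  intro b hb
  rw [← h.one_tmul_mem_primeAt, h.primeAt_eq_map w _ hm] at hb
  exact (h.isPrime_map w.1 _).2.2 b hb

/-- A prime divisor of the product that does not dominate the first factor lies over a prime divisor
of it. -/
theorem coheight_fst (h : IsProduct p q) (w : Z.PrimeDiv) (hw : p w.1 ≠ genericPoint X.carrier) :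
    coheight (p w.1) = 1 := by
  have hm : IsLocalRing.maximalIdeal (X.localRing (p w.1)) ≠ ⊥ :=
    fun h0 => hw (X.eq_genericPoint_of_maximalIdeal_eq_bot _ h0)
  have key : ∀ P : _root_.Ideal (X.localRing (p w.1)), P.IsPrime → P ≠ ⊥ →
      P = IsLocalRing.maximalIdeal _ := by
    intro P hP hP0
    refine le_antisymm (IsLocalRing.le_maximalIdeal hP.ne_top) fun a ha => ?_
    apply (h.isPrime_map w.1 P).2.1
    rw [← h.primeAt_eq_map w P hP0, h.tmul_one_mem_primeAt]
    exact ha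
  have hdim : ringKrullDim (X.localRing (p w.1)) = 1 := by
    refine ringKrullDim_eq_one_iff_of_isLocalRing_isDomain.2
      ⟨fun hf => hm (IsLocalRing.isField_iff_maximalIdeal_eq.1 hf), fun x hx => ?_⟩
    rw [Ideal.radical_eq_sInf]
    refine le_sInf fun J ⟨hJ1, hJ2⟩ => (key J hJ2 ?_).ge
    rintro rfl
    exact hx (by simpa using hJ1)
  rw [ringKrullDim_stalk_eq_coheight] at hdim
  exact_mod_cast hdim

/-- The maximal ideal at a prime divisor `D × Y` is extended from the maximal ideal at `D`. -/
theorem maximalIdeal_eq_map (w : Z.PrimeDiv) (hw : p w.1 ≠ genericPoint X.carrier) :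
    IsLocalRing.maximalIdeal (Z.localRing w.1) =
      (IsLocalRing.maximalIdeal (X.localRing (p w.1))).map
        (stalkPull p h.fst_str w.1).toRingHom := by
  have hm : IsLocalRing.maximalIdeal (X.localRing (p w.1)) ≠ ⊥ :=
    fun h0 => hw (X.eq_genericPoint_of_maximalIdeal_eq_bot _ h0)
  let := (h.tensorMap w.1).toRingHom.toAlgebra
  have hloc := h.isLocalization w.1
  have h1 := IsLocalization.AtPrime.map_eq_maximalIdeal (h.primeAt w.1) (Z.localRing w.1)
  rw [← h1, h.primeAt_eq_map w _ hm, Ideal.map_map]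
  congr 1
  ext a
  exact h.tensorMap_tmul_one w.1 a

/-- The order of vanishing of a pulled back function. -/
theorem ord_pullFst (hX : SmoothOfRelativeDimension r X.str)
    (hZ : SmoothOfRelativeDimension s Z.str) (w : Z.PrimeDiv) (f : X.funField) :
    Scheme.ord (h.pullFst f) w.1 = Scheme.ord f (p w.1) := by
  have := isDiscreteValuationRing hZ w
  by_cases hf : f = 0
  · simp [hf]
  by_cases hw : p w.1 = genericPoint X.carrier
  · rw [Scheme.ord_eq_zero_of_coheight_neq_one (z := p w.1)]
    · obtain ⟨a, rfl⟩ := (X.toFun_bijective_of_eq _ hw).2 f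
      obtain ⟨b, hb⟩ := (X.toFun_bijective_of_eq _ hw).2 (X.toFun _ a)⁻¹
      have hab : a * b = 1 := by
        apply X.toFun_injective
        rw [map_mul, hb, mul_inv_cancel₀ hf, map_one]
      rw [h.pullFst_toFun]
      exact ord_toFun_of_isUnit w ((IsUnit.of_mul_eq_one _ hab).map (stalkPull p h.fst_str w.1))
    · rw [hw, X.coheight_genericPoint]
      exact zero_ne_one
  · have := isDiscreteValuationRing hX ⟨p w.1, h.coheight_fst w hw⟩
    obtain ⟨π, hπ⟩ := IsDiscreteValuationRing.exists_irreducible (X.localRing (p w.1))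
    obtain ⟨u, n, hu, rfl⟩ := exists_eq_unit_mul_zpow ⟨p w.1, h.coheight_fst w hw⟩ hπ hf
    rw [ord_unit_mul_zpow ⟨p w.1, h.coheight_fst w hw⟩ hu hπ, map_mul, map_zpow₀, h.pullFst_toFun,
      h.pullFst_toFun]
    refine ord_unit_mul_zpow w (hu.map (stalkPull p h.fst_str w.1)) ?_ n
    rw [IsDiscreteValuationRing.irreducible_iff_uniformizer, h.maximalIdeal_eq_map w hw,
      hπ.maximalIdeal_eq, Ideal.map_span, Set.image_singleton]
    rfl

/-- The prime divisor `D × Y` of `X × Y` for a prime divisor `D` of `X`. -/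
theorem exists_primeDiv (h : IsProduct p q) (hX : SmoothOfRelativeDimension r X.str) (x : X.PrimeDiv) :
    ∃ w : Z.PrimeDiv, p w.1 = x.1 ∧ q w.1 = genericPoint Y.carrier := by
  obtain ⟨x, hx1⟩ := x
  let m := IsLocalRing.maximalIdeal (X.localRing x)
  let J := m.map (Algebra.TensorProduct.includeLeftRingHom :
    X.localRing x →+* X.localRing x ⊗[k] Y.funField)
  obtain ⟨hJ, hJ1, -⟩ := Ideal.isPrime_map_includeLeft (B := Y.funField) (L := Y.funField)
    (fun F _ _ => isDomain_tensor_funField Y F) m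
  have : J.IsPrime := hJ
  let R := Localization.AtPrime J
  let φ : X.localRing x →ₐ[k] R :=
    (IsScalarTower.toAlgHom k (X.localRing x ⊗[k] Y.funField) R).comp
      Algebra.TensorProduct.includeLeft
  let ψ : Y.localRing (genericPoint Y.carrier) →ₐ[k] R :=
    (IsScalarTower.toAlgHom k (X.localRing x ⊗[k] Y.funField) R).comp
      Algebra.TensorProduct.includeRight
  have hφ : IsLocalHom φ.toRingHom := ⟨fun a ha => by
    by_contra hn
    have h1 : a ⊗ₜ[k] (1 : Y.funField) ∈ J := Ideal.mem_map_of_mem _ hn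
    have h2 := (IsLocalization.AtPrime.to_map_mem_maximal_iff R J (a ⊗ₜ[k] (1 : Y.funField))).2 h1
    exact h2 ha⟩
  have hψ : IsLocalHom ψ.toRingHom := ⟨fun b hb => by
    have : b ≠ 0 := by
      rintro rfl
      rw [map_zero] at hb
      exact not_isUnit_zero hb
    exact (IsUnit.mk0 (b : Y.funField) this)⟩
  obtain ⟨w, hx, hy, β, hβ, hβ₁, hβ₂⟩ := h.exists_point x (genericPoint Y.carrier) R φ ψ
  subst hx
  let e : X.localRing (p w) ⊗[k] Y.localRing (q w) ≃ₐ[k] X.localRing (p w) ⊗[k] Y.funField :=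
    Algebra.TensorProduct.congr AlgEquiv.refl
      (AlgEquiv.ofBijective (IsScalarTower.toAlgHom k (Y.localRing (q w)) Y.funField)
        (Y.toFun_bijective_of_eq _ hy))
  have he : β.comp (h.tensorMap w) =
      (IsScalarTower.toAlgHom k (X.localRing (p w) ⊗[k] Y.funField) R).comp e.toAlgHom := by
    apply Algebra.TensorProduct.ext'
    intro a b
    have h1 : β (stalkPull p h.fst_str w a) = φ a := by
      rw [← hβ₁, TopCat.Presheaf.stalkSpecializes_refl]
      rfl
    have h2 : β (stalkPull q h.snd_str w b) = ψ (Y.toFun _ b) := by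
      rw [← hβ₂]
      congr 2
      apply Y.toFun_injective
      rw [toFun_stalkSpecializes, toFun_genericPoint]
    change β (h.tensorMap w (a ⊗ₜ b)) = algebraMap _ R (a ⊗ₜ[k] Y.toFun (q w) b)
    rw [tensorMap_tmul, map_mul, h1, h2, show a ⊗ₜ[k] Y.toFun (q w) b = (a ⊗ₜ 1) * (1 ⊗ₜ Y.toFun (q w) b) by
        rw [Algebra.TensorProduct.tmul_mul_tmul, mul_one, one_mul], map_mul]
    rfl
  have hprime : h.primeAt w = m.map Algebra.TensorProduct.includeLeftRingHom := by
    ext t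
    have h1 : e '' (m.map (Algebra.TensorProduct.includeLeftRingHom :
        X.localRing (p w) →+* X.localRing (p w) ⊗[k] Y.localRing (q w)) : Set _) = J := by
      have h2 : (m.map (Algebra.TensorProduct.includeLeftRingHom :
          X.localRing (p w) →+* X.localRing (p w) ⊗[k] Y.localRing (q w))).map
          e.toRingEquiv.toRingHom = J := by
        rw [Ideal.map_map]
        congr 1
        ext a
        change a ⊗ₜ Y.toFun _ 1 = _
        rw [map_one]
        rfl
      rw [← h2]
      ext u
      exact (Ideal.mem_map_iff_of_surjective _ e.surjective).symm
    have h2 : t ∈ m.map (Algebra.TensorProduct.includeLeftRingHom :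
        X.localRing (p w) →+* X.localRing (p w) ⊗[k] Y.localRing (q w)) ↔ e t ∈ J := by
      rw [← SetLike.mem_coe, ← SetLike.mem_coe, ← h1, e.injective.mem_set_image]
    rw [h2, mem_primeAt, ← IsLocalization.AtPrime.to_map_mem_maximal_iff R J (e t)]
    have h3 : β (h.tensorMap w t) = algebraMap _ R (e t) := congrArg (fun g => g t) he
    rw [← h3, IsLocalRing.mem_maximalIdeal, IsLocalRing.mem_maximalIdeal, mem_nonunits_iff,
      mem_nonunits_iff, not_iff_not]
    exact (isUnit_map_iff β.toRingHom _).symm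
  have hmax : IsLocalRing.maximalIdeal (Z.localRing w) = m.map (stalkPull p h.fst_str w).toRingHom := by
    let := (h.tensorMap w).toRingHom.toAlgebra
    have hloc := h.isLocalization w
    have h1 := IsLocalization.AtPrime.map_eq_maximalIdeal (h.primeAt w) (Z.localRing w)
    rw [← h1, hprime, Ideal.map_map]
    congr 1
    ext a
    exact h.tensorMap_tmul_one w a
  have hdvr := isDiscreteValuationRing hX ⟨p w, hx1⟩
  obtain ⟨π, hπ⟩ := IsDiscreteValuationRing.exists_irreducible (X.localRing (p w))
  have hspan : IsLocalRing.maximalIdeal (Z.localRing w) =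
      Ideal.span {stalkPull p h.fst_str w π} := by
    have hm : m = Ideal.span {π} := hπ.maximalIdeal_eq
    rw [hmax, hm, Ideal.map_span, Set.image_singleton]
    rfl
  have htfae := (tfae_of_isNoetherianRing_of_isLocalRing_of_isDomain (Z.localRing w)).out 0 4
  have hpid : IsPrincipalIdealRing (Z.localRing w) := htfae.2 ⟨_, hspan⟩
  have hnf : ¬ IsField (Z.localRing w) := by
    rw [IsLocalRing.isField_iff_maximalIdeal_eq, hspan, Ideal.span_singleton_eq_bot]
    exact fun h0 => hπ.ne_zero (h.stalkPull_injective w (h0.trans (map_zero _).symm))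
  have hdim := IsPrincipalIdealRing.ringKrullDim_eq_one _ hnf
  rw [ringKrullDim_stalk_eq_coheight] at hdim
  exact ⟨⟨w, by exact_mod_cast hdim⟩, rfl, hy⟩

end

end IsProduct

end Variety

/-! ### Products: rational functions -/

section Tensor

variable {k K L : Type u} [Field k] [AddCommGroup K] [Module k K] [AddCommGroup L] [Module k L]

/-- A tensor lies in `A ⊗ B` as soon as it lies in `A ⊗ L` and in `K ⊗ B`; membership in these
two spaces is read off from expansions with linearly independent second (first) factors. -/
theorem TensorProduct.exists_sum_tmul_mem (A : Submodule k K) (B : Submodule k L) (t : K ⊗[k] L)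
    (hA : ∀ (N : ℕ) (h : Fin N → K) (b : Fin N → L), LinearIndependent k b →
      t = ∑ i, h i ⊗ₜ b i → ∀ i, h i ∈ A)
    (hB : ∀ (N : ℕ) (h : Fin N → K) (b : Fin N → L), LinearIndependent k h →
      t = ∑ i, h i ⊗ₜ b i → ∀ i, b i ∈ B) :
    ∃ (N : ℕ) (h : Fin N → K) (b : Fin N → L), (∀ i, h i ∈ A) ∧ (∀ i, b i ∈ B) ∧
      t = ∑ i, h i ⊗ₜ b i := by
  have hsum : ∀ {ι M N : Type u} [AddCommGroup M] [AddCommGroup N] [Module k M] [Module k N]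
      (c : ι →₀ M) (F : ι → M → N), ∃ e : Fin c.support.card ≃ c.support,
        c.sum F = ∑ i, F (e i).1 (c (e i).1) := by
    intro ι M N _ _ _ _ c F
    refine ⟨c.support.equivFin.symm, ?_⟩
    rw [Finsupp.sum, ← Finset.sum_coe_sort]
    exact (Equiv.sum_comp c.support.equivFin.symm (fun i => F i.1 (c i.1))).symm
  let bL := Module.Basis.ofVectorSpace k L
  obtain ⟨c, hc⟩ := TensorProduct.eq_repr_basis_right bL t
  obtain ⟨e, he⟩ := hsum c (fun i m => m ⊗ₜ[k] bL i)
  have h1 := hA _ (fun i => c (e i).1) (fun i => bL (e i).1)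
    (bL.linearIndependent.comp _ (Subtype.val_injective.comp e.injective)) (by rw [← hc, ← he])
  let t' : A ⊗[k] L := ∑ i, (⟨c (e i).1, h1 i⟩ : A) ⊗ₜ bL (e i).1
  have ht' : A.subtype.rTensor L t' = t := by
    rw [← hc, he]
    simp [t']
  let bA := Module.Basis.ofVectorSpace k A
  obtain ⟨d, hd⟩ := TensorProduct.eq_repr_basis_left bA t'
  obtain ⟨e', he'⟩ := hsum d (fun i n => bA i ⊗ₜ[k] n)
  have h2 : t = ∑ i, (bA (e' i).1 : K) ⊗ₜ d (e' i).1 := by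
    rw [← ht', ← hd, he']
    simp
  refine ⟨_, fun i => bA (e' i).1, fun i => d (e' i).1, fun i => (bA (e' i).1).2,
    hB _ (fun i => bA (e' i).1) _ ?_ h2, h2⟩
  exact (bA.linearIndependent.map' A.subtype A.ker_subtype).comp (fun i => (e' i).1)
    (Subtype.val_injective.comp e'.injective)

end Tensor

namespace Variety.IsProduct

variable {k : Type u} [Field k] {r s : ℕ}
variable {X Y Z : Variety k} {p : Z.carrier ⟶ X.carrier} {q : Z.carrier ⟶ Y.carrier}

/-- The homomorphism `k(X) ⊗ k(Y) → k(Z)`. -/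
noncomputable def funTensor (h : IsProduct p q) : X.funField ⊗[k] Y.funField →ₐ[k] Z.funField :=
  Algebra.TensorProduct.productMap h.pullFst h.pullSnd

theorem funTensor_tmul (h : IsProduct p q) (f : X.funField) (g : Y.funField) :
    h.funTensor (f ⊗ₜ g) = h.pullFst f * h.pullSnd g := by
  simp [funTensor]

/-- The inclusion of `𝒪_{X, p z} ⊗ 𝒪_{Y, q z}` in `k(X) ⊗ k(Y)`. -/
noncomputable def toFunTensor (_ : IsProduct p q) (z : Z.carrier) :
    X.localRing (p z) ⊗[k] Y.localRing (q z) →ₐ[k] X.funField ⊗[k] Y.funField :=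
  Algebra.TensorProduct.map (IsScalarTower.toAlgHom k _ X.funField)
    (IsScalarTower.toAlgHom k _ Y.funField)

theorem funTensor_toFunTensor (h : IsProduct p q) (z : Z.carrier)
    (t : X.localRing (p z) ⊗[k] Y.localRing (q z)) :
    h.funTensor (h.toFunTensor z t) = Z.toFun z (h.tensorMap z t) := by
  induction t with
  | zero => simp
  | add a b ha hb => rw [map_add, map_add, ha, hb, map_add, map_add]
  | tmul a b =>
    change h.funTensor (X.toFun _ a ⊗ₜ Y.toFun _ b) = _
    rw [funTensor_tmul, tensorMap_tmul, map_mul, pullFst_toFun, pullSnd_toFun]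

/-- A rational function on `X × Y` with poles only along divisors `D × Y` and `X × E` lies in
`k(X) ⊗ k(Y)`. -/
theorem exists_funTensor_eq (h : IsProduct p q) (hZ : SmoothOfRelativeDimension s Z.str)
    (g : Z.funField)
    (hg : ∀ w : Z.PrimeDiv, p w.1 = genericPoint X.carrier → q w.1 = genericPoint Y.carrier →
      0 ≤ Scheme.ord g w.1) : ∃ t, h.funTensor t = g := by
  let T := X.funField ⊗[k] Y.funField
  -- the ideal of denominators of `g`
  let I : _root_.Ideal T :=
    { carrier := {t | ∃ t', g * h.funTensor t = h.funTensor t'}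
      add_mem' := fun {a b} ⟨a', ha⟩ ⟨b', hb⟩ => ⟨a' + b', by rw [map_add, mul_add, ha, hb, map_add]⟩
      zero_mem' := ⟨0, by simp⟩
      smul_mem' := fun c a ⟨a', ha⟩ => ⟨c * a', by
        rw [smul_eq_mul, map_mul, mul_left_comm, ha, map_mul]⟩ }
  suffices hI : I = ⊤ by
    have h1 : (1 : T) ∈ I := hI ▸ Submodule.mem_top
    obtain ⟨t, ht⟩ := h1
    exact ⟨t, by rw [← ht, map_one, mul_one]⟩
  by_contra hI
  obtain ⟨𝔮, h𝔮, hle⟩ := Ideal.exists_le_maximal I hI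
  let R := Localization.AtPrime 𝔮
  let φ : X.localRing (genericPoint X.carrier) →ₐ[k] R :=
    (IsScalarTower.toAlgHom k T R).comp Algebra.TensorProduct.includeLeft
  let ψ : Y.localRing (genericPoint Y.carrier) →ₐ[k] R :=
    (IsScalarTower.toAlgHom k T R).comp Algebra.TensorProduct.includeRight
  have hφ : IsLocalHom φ.toRingHom := ⟨fun a ha => by
    refine IsUnit.mk0 (a : X.funField) ?_
    rintro rfl
    rw [map_zero] at ha
    exact not_isUnit_zero ha⟩
  have hψ : IsLocalHom ψ.toRingHom := ⟨fun a ha => by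
    refine IsUnit.mk0 (a : Y.funField) ?_
    rintro rfl
    rw [map_zero] at ha
    exact not_isUnit_zero ha⟩
  obtain ⟨w, hx, hy, β, -, hβ₁, hβ₂⟩ := h.exists_point _ _ R φ ψ
  have he : β.comp (h.tensorMap w) = (IsScalarTower.toAlgHom k T R).comp (h.toFunTensor w) := by
    apply Algebra.TensorProduct.ext'
    intro a b
    have h1 : β (stalkPull p h.fst_str w a) = φ (X.toFun _ a) := by
      rw [← hβ₁]
      congr 2
      apply X.toFun_injective
      rw [toFun_stalkSpecializes, toFun_genericPoint]
    have h2 : β (stalkPull q h.snd_str w b) = ψ (Y.toFun _ b) := by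
      rw [← hβ₂]
      congr 2
      apply Y.toFun_injective
      rw [toFun_stalkSpecializes, toFun_genericPoint]
    change β (h.tensorMap w (a ⊗ₜ b)) = algebraMap T R (X.toFun (p w) a ⊗ₜ[k] Y.toFun (q w) b)
    rw [tensorMap_tmul, map_mul, h1, h2, show X.toFun (p w) a ⊗ₜ[k] Y.toFun (q w) b =
      (X.toFun (p w) a ⊗ₜ 1) * (1 ⊗ₜ Y.toFun (q w) b) by
        rw [Algebra.TensorProduct.tmul_mul_tmul, mul_one, one_mul], map_mul]
    rfl
  obtain ⟨a, ha⟩ := exists_toFun_eq_of_forall_ord_nonneg hZ w g fun v hv => by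
    refine hg v ?_ ?_
    · have h1 : p v.1 ⤳ p w := hv.map p.continuous
      rw [hx] at h1
      exact (h1.antisymm (genericPoint_specializes _)).eq
    · have h1 : q v.1 ⤳ q w := hv.map q.continuous
      rw [hy] at h1
      exact (h1.antisymm (genericPoint_specializes _)).eq
  let := (h.tensorMap w).toRingHom.toAlgebra
  have hloc := h.isLocalization w
  obtain ⟨⟨t, u⟩, htu⟩ := IsLocalization.surj (h.primeAt w).primeCompl a
  have hu : IsUnit (h.tensorMap w u.1) := IsLocalization.map_units (Z.localRing w) u
  have h1 : h.toFunTensor w u.1 ∈ I := by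
    refine ⟨h.toFunTensor w t, ?_⟩
    rw [← ha, funTensor_toFunTensor, funTensor_toFunTensor, ← map_mul]
    exact congrArg _ htu
  have h2 := hu.map β
  have h3 : β (h.tensorMap w u.1) = algebraMap T R (h.toFunTensor w u.1) :=
    congrArg (fun f => f u.1) he
  rw [h3] at h2
  exact (IsLocalization.AtPrime.isUnit_to_map_iff R 𝔮 _).1 h2 (hle h1)

/-- Gauss' lemma for the prime divisor `D × Y`: if `∑ f_i ⊗ b_i`, with `b_i` linearly independent,
is regular along `D × Y`, then every `f_i` is regular along `D`. -/
theorem exists_toFun_eq_of_sum (h : IsProduct p q) (hX : SmoothOfRelativeDimension r X.str)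
    (w : Z.PrimeDiv) (hw : p w.1 ≠ genericPoint X.carrier) {N : ℕ} (f : Fin N → X.funField)
    (b : Fin N → Y.funField) (hb : LinearIndependent k b) (c : Z.localRing w.1)
    (hc : Z.toFun w.1 c = ∑ i, h.pullFst (f i) * h.pullSnd (b i)) (i : Fin N) :
    ∃ a, X.toFun (p w.1) a = f i := by
  have hdvr := isDiscreteValuationRing hX ⟨p w.1, h.coheight_fst w hw⟩
  obtain ⟨π, hπ⟩ := IsDiscreteValuationRing.exists_irreducible (X.localRing (p w.1))
  have hπ0 : X.toFun (p w.1) π ≠ 0 := by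
    rw [Ne, map_eq_zero_iff _ (X.toFun_injective _)]
    exact hπ.ne_zero
  have hm : IsLocalRing.maximalIdeal (X.localRing (p w.1)) ≠ ⊥ :=
    fun h0 => hw (X.eq_genericPoint_of_maximalIdeal_eq_bot _ h0)
  have hex : ∃ n : ℕ, ∀ i, ∃ a, X.toFun (p w.1) a = X.toFun (p w.1) π ^ n * f i := by
    have h1 : ∀ i, ∃ n : ℕ, ∃ a, X.toFun (p w.1) a = X.toFun (p w.1) π ^ n * f i := by
      intro i
      by_cases h0 : f i = 0
      · exact ⟨0, 0, by simp [h0]⟩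
      obtain ⟨u, n, hu, hn⟩ := exists_eq_unit_mul_zpow ⟨p w.1, h.coheight_fst w hw⟩ hπ h0
      refine ⟨n.natAbs, u * π ^ (n + n.natAbs).toNat, ?_⟩
      have h2 : ((n + n.natAbs).toNat : ℤ) = n + n.natAbs := Int.toNat_of_nonneg (by omega)
      rw [hn, map_mul, map_pow, ← zpow_natCast, h2, zpow_add₀ hπ0, zpow_natCast]
      ring
    choose n hn using h1
    refine ⟨∑ j, n j, fun i => ?_⟩
    obtain ⟨a, ha⟩ := hn i
    refine ⟨π ^ ((∑ j, n j) - n i) * a, ?_⟩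
    rw [map_mul, ha, map_pow, ← mul_assoc, ← pow_add,
      Nat.sub_add_cancel (Finset.single_le_sum (fun _ _ => Nat.zero_le _) (Finset.mem_univ i))]
  have hy := h.snd_eq_genericPoint w hw
  classical
  have hmin := Nat.find_spec hex
  rcases hn : Nat.find hex with _ | n
  · rw [hn] at hmin
    simpa using hmin i
  exfalso
  rw [hn] at hmin
  refine Nat.find_min hex (m := n) (by omega) ?_
  choose a ha using hmin
  choose b' hb' using fun i => (Y.toFun_bijective_of_eq _ hy).2 (b i)
  have hlin : LinearIndependent k b' := by
    refine LinearIndependent.of_comp (IsScalarTower.toAlgHom k _ Y.funField).toLinearMap ?_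
    convert hb using 1
    exact funext hb'
  have hmem : ∑ i, a i ⊗ₜ[k] b' i ∈ h.primeAt w.1 := by
    rw [mem_primeAt]
    have : h.tensorMap w.1 (∑ i, a i ⊗ₜ[k] b' i) =
        stalkPull p h.fst_str w.1 (π ^ (n + 1)) * c := by
      apply Z.toFun_injective
      rw [map_mul, hc, ← h.pullFst_toFun, map_pow, Finset.mul_sum, map_sum, map_sum]
      refine Finset.sum_congr rfl fun i _ => ?_
      rw [tensorMap_tmul, map_mul, ← h.pullFst_toFun, ← h.pullSnd_toFun, ha, hb', map_mul]
      ring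
    rw [this]
    refine Ideal.mul_mem_right _ _ ((h.stalkPull_mem_maximalIdeal _ _).2 ?_)
    rw [pow_succ]
    refine Ideal.mul_mem_left _ _ ?_
    rw [hπ.maximalIdeal_eq]
    exact Ideal.mem_span_singleton_self π
  rw [h.primeAt_eq_map w _ hm] at hmem
  let κ := X.localRing (p w.1) ⧸ IsLocalRing.maximalIdeal (X.localRing (p w.1))
  let F : X.localRing (p w.1) ⊗[k] Y.localRing (q w.1) →ₐ[k] κ ⊗[k] Y.localRing (q w.1) :=
    Algebra.TensorProduct.map (Ideal.Quotient.mkₐ k _) (AlgHom.id k _)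
  have hF : F (∑ i, a i ⊗ₜ[k] b' i) = 0 := by
    have : (IsLocalRing.maximalIdeal (X.localRing (p w.1))).map
        Algebra.TensorProduct.includeLeftRingHom ≤ RingHom.ker F := by
      rw [Ideal.map_le_iff_le_comap]
      intro y hy
      change Ideal.Quotient.mk _ y ⊗ₜ[k] (1 : Y.localRing (q w.1)) = 0
      rw [Ideal.Quotient.eq_zero_iff_mem.2 hy, TensorProduct.zero_tmul]
    exact this hmem
  have hzero : ∀ i, (Ideal.Quotient.mk _ (a i) : κ) = 0 := by
    refine Fintype.linearIndependent_iff.1 (Module.Flat.linearIndependent_one_tmul (S := κ) hlin) _ ?_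
    rw [← hF, map_sum]
    refine Finset.sum_congr rfl fun i _ => ?_
    rw [TensorProduct.smul_tmul', smul_eq_mul, mul_one]
    rfl
  intro i
  have h1 := Ideal.Quotient.eq_zero_iff_mem.1 (hzero i)
  rw [hπ.maximalIdeal_eq, Ideal.mem_span_singleton] at h1
  obtain ⟨d, hd⟩ := h1
  refine ⟨d, mul_left_cancel₀ hπ0 ?_⟩
  rw [← map_mul, ← hd, ha, pow_succ']
  ring

/-- Gauss' lemma with a bound `n` on the poles: `f i` has order at least `-n` if the sum does. -/
theorem ord_nonneg_of_sum (h : IsProduct p q) (hX : SmoothOfRelativeDimension r X.str)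
    (hZ : SmoothOfRelativeDimension s Z.str)
    (w : Z.PrimeDiv) (hw : p w.1 ≠ genericPoint X.carrier) {N : ℕ} (f : Fin N → X.funField)
    (b : Fin N → Y.funField) (hb : LinearIndependent k b) (n : ℤ)
    (hn : ∑ i, h.pullFst (f i) * h.pullSnd (b i) = 0 ∨
      0 ≤ Scheme.ord (∑ i, h.pullFst (f i) * h.pullSnd (b i)) w.1 + n) (i : Fin N) :
    f i = 0 ∨ 0 ≤ Scheme.ord (f i) (p w.1) + n := by
  have hdvr := isDiscreteValuationRing hX ⟨p w.1, h.coheight_fst w hw⟩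
  have hdvr' := isDiscreteValuationRing hZ w
  obtain ⟨π, hπ⟩ := IsDiscreteValuationRing.exists_irreducible (X.localRing (p w.1))
  have hπ0 : X.toFun (p w.1) π ≠ 0 := by
    rw [Ne, map_eq_zero_iff _ (X.toFun_injective _)]
    exact hπ.ne_zero
  have hordπ : Scheme.ord (X.toFun (p w.1) π ^ n) (p w.1) = n := by
    have := ord_unit_mul_zpow ⟨p w.1, h.coheight_fst w hw⟩ isUnit_one hπ n
    rwa [map_one, one_mul] at this
  have key : ∑ i, h.pullFst (X.toFun (p w.1) π ^ n * f i) * h.pullSnd (b i) =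
      h.pullFst (X.toFun (p w.1) π ^ n) * ∑ i, h.pullFst (f i) * h.pullSnd (b i) := by
    simp only [map_mul, Finset.mul_sum, mul_assoc]
  have hc : ∃ c, Z.toFun w.1 c = ∑ i, h.pullFst (X.toFun (p w.1) π ^ n * f i) * h.pullSnd (b i) := by
    rw [key]
    by_cases h0 : ∑ i, h.pullFst (f i) * h.pullSnd (b i) = 0
    · exact ⟨0, by rw [h0, map_zero, mul_zero]⟩
    · apply exists_toFun_eq_of_ord_nonneg w
      have h1 : h.pullFst (X.toFun (p w.1) π ^ n) ≠ 0 := by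
        rw [map_ne_zero]
        exact zpow_ne_zero _ hπ0
      rw [Scheme.ord_mul h1 h0, h.ord_pullFst hX hZ, hordπ]
      have := hn.resolve_left h0
      linarith
  obtain ⟨c, hc⟩ := hc
  obtain ⟨a, ha⟩ := h.exists_toFun_eq_of_sum hX w hw _ b hb c hc i
  by_cases h0 : f i = 0
  · exact Or.inl h0
  right
  have := ord_toFun_nonneg ⟨p w.1, h.coheight_fst w hw⟩ a
  rw [ha, Scheme.ord_mul (zpow_ne_zero _ hπ0) h0] at this
  simp only at this
  rw [hordπ] at this
  linarith

end Variety.IsProduct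

/-! ### Products: closed points -/

namespace Variety

variable {k : Type u} [Field k]

theorem finite_residueField (X : Variety k) (x : X.carrier) (hx : IsClosed {x}) :
    Module.Finite k (IsLocalRing.ResidueField (X.localRing x)) := by
  have : JacobsonSpace X.carrier := LocallyOfFiniteType.jacobsonSpace X.str
  have h1 := isClosed_singleton_iff_locallyOfFiniteType.1 hx
  have h2 : LocallyOfFiniteType (X.carrier.fromSpecResidueField x ≫ X.str) := inferInstance
  have h3 : X.carrier.fromSpecResidueField x ≫ X.str = Spec.map (CommRingCat.ofHom
      (algebraMap k (IsLocalRing.ResidueField (X.localRing x)))) := by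
    rw [Scheme.fromSpecResidueField, Category.assoc, fromSpecStalk_str, ← Spec.map_comp]
    rfl
  rw [h3] at h2
  have h2' : LocallyOfFiniteType (X := Spec (CommRingCat.of (IsLocalRing.ResidueField
      (X.localRing x)))) (Spec.map (CommRingCat.ofHom
      (algebraMap k (IsLocalRing.ResidueField (X.localRing x))))) := h2
  rw [HasRingHomProperty.Spec_iff (P := @LocallyOfFiniteType)] at h2'
  have h4 : Algebra.FiniteType k (IsLocalRing.ResidueField (X.localRing x)) := by
    have h5 : (algebraMap k (IsLocalRing.ResidueField (X.localRing x))).FiniteType := h2'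
    rwa [RingHom.finiteType_algebraMap] at h5
  exact finite_of_finite_type_of_isJacobsonRing _ _

variable {X Y Z : Variety k} {p : Z.carrier ⟶ X.carrier} {q : Z.carrier ⟶ Y.carrier}

/-- At a point of `X × Y` over closed points of `X` and `Y` the maximal ideal is generated by the
two maximal ideals, since the tensor product of the two residue fields is reduced. -/
theorem IsProduct.maximalIdeal_eq_sup [PerfectField k] (h : IsProduct p q) (z : Z.carrier)
    (hx : IsClosed {p z}) (hy : IsClosed {q z}) :
    IsLocalRing.maximalIdeal (Z.localRing z) =
      (IsLocalRing.maximalIdeal (X.localRing (p z))).map (stalkPull p h.fst_str z).toRingHom ⊔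
      (IsLocalRing.maximalIdeal (Y.localRing (q z))).map (stalkPull q h.snd_str z).toRingHom := by
  let κ := IsLocalRing.ResidueField (X.localRing (p z))
  let κ' := IsLocalRing.ResidueField (Y.localRing (q z))
  have hκ : Module.Finite k κ := X.finite_residueField _ hx
  have hκ' : Module.Finite k κ' := Y.finite_residueField _ hy
  let S := κ ⊗[k] κ'
  have hunr : Algebra.FormallyUnramified k κ' := .of_isSeparable _ _
  have hfinS : Module.Finite κ S := inferInstance
  have hred : IsReduced S := Algebra.FormallyUnramified.isReduced_of_field κ S
  have hart : IsArtinianRing S := IsArtinianRing.of_finite κ S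
  let ρ : X.localRing (p z) →ₐ[k] κ := IsScalarTower.toAlgHom k _ κ
  let ρ' : Y.localRing (q z) →ₐ[k] κ' := IsScalarTower.toAlgHom k _ κ'
  have hρ : Function.Surjective ρ := Ideal.Quotient.mk_surjective
  have hρ' : Function.Surjective ρ' := Ideal.Quotient.mk_surjective
  let F := Algebra.TensorProduct.map ρ ρ'
  have hF : Function.Surjective F := TensorProduct.map_surjective hρ hρ'
  have hker := Algebra.TensorProduct.map_ker (f := ρ) (g := ρ') hρ hρ'
  have hk1 : RingHom.ker ρ = IsLocalRing.maximalIdeal (X.localRing (p z)) := Ideal.mk_ker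
  have hk2 : RingHom.ker ρ' = IsLocalRing.maximalIdeal (Y.localRing (q z)) := Ideal.mk_ker
  rw [hk1, hk2] at hker
  change _ = (IsLocalRing.maximalIdeal (X.localRing (p z))).map
    Algebra.TensorProduct.includeLeftRingHom ⊔ (IsLocalRing.maximalIdeal (Y.localRing (q z))).map
    (Algebra.TensorProduct.includeRight (R := k)).toRingHom at hker
  have hle : RingHom.ker F ≤ h.primeAt z := by
    refine hker.trans_le (sup_le ?_ ?_)
    · rw [Ideal.map_le_iff_le_comap]
      intro a ha
      exact (h.tmul_one_mem_primeAt z a).2 ha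
    · rw [Ideal.map_le_iff_le_comap]
      intro b hb
      exact (h.one_tmul_mem_primeAt z b).2 hb
  have hprime : ((h.primeAt z).map F).IsPrime := Ideal.map_isPrime_of_surjective hF hle
  have hcomap : ∀ t, F t ∈ (h.primeAt z).map F ↔ t ∈ h.primeAt z := by
    intro t
    have := Ideal.comap_map_of_surjective' F hF (h.primeAt z)
    rw [sup_eq_left.2 hle] at this
    rw [← Ideal.mem_comap, this]
  have hfield : IsField (Localization.AtPrime ((h.primeAt z).map F)) :=
    IsArtinianRing.isField_of_isReduced_of_isLocalRing _
  let := (h.tensorMap z).toRingHom.toAlgebra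
  have hloc := h.isLocalization z
  apply le_antisymm
  · rw [← IsLocalization.AtPrime.map_eq_maximalIdeal (h.primeAt z) (Z.localRing z),
      Ideal.map_le_iff_le_comap]
    intro t ht
    have h0 : algebraMap S (Localization.AtPrime ((h.primeAt z).map F)) (F t) = 0 := by
      have h1 := (IsLocalization.AtPrime.to_map_mem_maximal_iff
        (Localization.AtPrime ((h.primeAt z).map F)) ((h.primeAt z).map F) (F t)).2
        ((hcomap t).2 ht)
      rwa [IsLocalRing.isField_iff_maximalIdeal_eq.1 hfield] at h1
    rw [IsLocalization.map_eq_zero_iff ((h.primeAt z).map F).primeCompl] at h0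
    obtain ⟨⟨s', hs'⟩, h1⟩ := h0
    obtain ⟨s, rfl⟩ := hF s'
    have hs : s ∉ h.primeAt z := fun hs => hs' ((hcomap s).2 hs)
    have hu : IsUnit (h.tensorMap z s) := IsLocalization.map_units (Z.localRing z)
      (⟨s, hs⟩ : (h.primeAt z).primeCompl)
    have h2 : s * t ∈ RingHom.ker F := by
      rw [RingHom.mem_ker, map_mul]
      exact h1
    rw [hker] at h2
    have h3 := Ideal.mem_map_of_mem (h.tensorMap z).toRingHom h2
    rw [Ideal.map_sup, Ideal.map_map, Ideal.map_map] at h3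
    have e1 : (h.tensorMap z).toRingHom.comp Algebra.TensorProduct.includeLeftRingHom =
        (stalkPull p h.fst_str z).toRingHom := RingHom.ext fun a => h.tensorMap_tmul_one z a
    have e2 : (h.tensorMap z).toRingHom.comp
        (Algebra.TensorProduct.includeRight (R := k)).toRingHom =
        (stalkPull q h.snd_str z).toRingHom := RingHom.ext fun a => h.tensorMap_one_tmul z a
    have h4 : h.tensorMap z (s * t) ∈
      (IsLocalRing.maximalIdeal (X.localRing (p z))).map (stalkPull p h.fst_str z).toRingHom ⊔
      (IsLocalRing.maximalIdeal (Y.localRing (q z))).map (stalkPull q h.snd_str z).toRingHom := by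
      rw [← e1, ← e2]
      exact h3
    rw [map_mul] at h4
    exact (Ideal.unit_mul_mem_iff_mem _ hu).1 h4
  · refine sup_le ?_ ?_
    · rw [Ideal.map_le_iff_le_comap]
      intro a ha
      exact (h.stalkPull_mem_maximalIdeal z a).2 ha
    · rw [Ideal.map_le_iff_le_comap]
      intro a ha
      exact (h.swap.stalkPull_mem_maximalIdeal z a).2 ha

end Variety

/-! ### Divisors of differential forms -/

namespace Variety

open KaehlerDifferential

variable {k : Type u} [Field k] {r s : ℕ}

section

variable {X : Variety k}

theorem IsCoordinates.span_D {z : X.carrier} {x : Fin r → X.localRing z}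
    (hx : X.IsCoordinates z x) :
    Submodule.span X.funField (Set.range fun i => D k X.funField (X.toFun z (x i))) = ⊤ :=
  span_D_of_isLocalization (nonZeroDivisors (X.localRing z)) x hx

theorem hasCoordinates_funField (hX : SmoothOfRelativeDimension r X.str) :
    HasCoordinates k X.funField r :=
  hasCoordinates hX (genericPoint X.carrier)

theorem exists_isCoordinates (hX : SmoothOfRelativeDimension r X.str) (z : X.carrier) :
    ∃ x : Fin r → X.localRing z, X.IsCoordinates z x :=
  (hasCoordinates hX z).exists_span

theorem IsCoordinates.exists_eq_smul_dx (hX : SmoothOfRelativeDimension r X.str) {z : X.carrier}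
    {x : Fin r → X.localRing z} (hx : X.IsCoordinates z x) (ω : X.RForm r) :
    ∃ g : X.funField, ω = g • X.dx x :=
  RatForm.exists_eq_smul_dWedge _ hx.span_D (hasCoordinates_funField hX) ω

theorem IsCoordinates.smul_dx_injective (hX : SmoothOfRelativeDimension r X.str) {z : X.carrier}
    {x : Fin r → X.localRing z} (hx : X.IsCoordinates z x) {g g' : X.funField}
    (h : g • X.dx x = g' • X.dx x) : g = g' :=
  RatForm.smul_dWedge_injective _ hx.span_D (hasCoordinates_funField hX) h

theorem IsCoordinates.dx_ne_zero (hX : SmoothOfRelativeDimension r X.str) {z : X.carrier}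
    {x : Fin r → X.localRing z} (hx : X.IsCoordinates z x) : X.dx x ≠ 0 := fun h =>
  one_ne_zero (hx.smul_dx_injective hX (g := 1) (g' := 0) (by simp [h]))

theorem dx_eq_det_smul {z : X.carrier} (x y : Fin r → X.localRing z)
    (a : Matrix (Fin r) (Fin r) (X.localRing z))
    (h : ∀ i, D k (X.localRing z) (x i) = ∑ j, a i j • D k (X.localRing z) (y j)) :
    X.dx x = X.toFun z a.det • X.dx y := by
  have h1 : X.toFun z a.det = (a.map (X.toFun z)).det := RingHom.map_det _ _
  rw [h1]
  refine RatForm.dWedge_eq_det_smul _ _ _ fun i => ?_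
  have := congrArg (KaehlerDifferential.map k k (X.localRing z) X.funField) (h i)
  rw [map_D, map_sum] at this
  rw [this]
  refine Finset.sum_congr rfl fun j _ => ?_
  rw [map_smul, map_D, algebra_compatible_smul X.funField]
  rfl

/-- The order of a form along a prime divisor can be computed in any local coordinates. -/
theorem formOrd_smul_dx (hX : SmoothOfRelativeDimension r X.str) (z : X.PrimeDiv)
    {x : Fin r → X.localRing z.1} (hx : X.IsCoordinates z.1 x) (g : X.funField) :
    formOrd (g • X.dx x) z = Scheme.ord g z.1 := by
  have hex : ∃ (g' : X.funField) (x' : Fin r → X.localRing z.1),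
      X.IsCoordinates z.1 x' ∧ g • X.dx x = g' • X.dx x' := ⟨g, x, hx, rfl⟩
  rw [formOrd, dif_pos hex]
  obtain ⟨x', hx', he⟩ := hex.choose_spec
  generalize hex.choose = g' at he ⊢
  obtain ⟨a, ha, h⟩ := (hasCoordinates hX z.1).exists_isUnit_det x x' hx hx'
  rw [dx_eq_det_smul x x' a h, smul_smul] at he
  rw [← hx'.smul_dx_injective hX he]
  by_cases hg : g = 0
  · simp [hg]
  have hne : X.toFun z.1 a.det ≠ 0 := by
    rw [Ne, map_eq_zero_iff _ (X.toFun_injective z.1)]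
    exact ha.ne_zero
  rw [Scheme.ord_mul hg hne, ord_toFun_of_isUnit z ha, add_zero]

theorem formOrd_smul (hX : SmoothOfRelativeDimension r X.str) (z : X.PrimeDiv)
    {g : X.funField} (hg : g ≠ 0) {ω : X.RForm r} (hω : ω ≠ 0) :
    formOrd (g • ω) z = Scheme.ord g z.1 + formOrd ω z := by
  obtain ⟨x, hx⟩ := exists_isCoordinates hX z.1
  obtain ⟨f, rfl⟩ := hx.exists_eq_smul_dx hX ω
  have hf : f ≠ 0 := by
    rintro rfl
    exact hω (zero_smul _ _)
  rw [smul_smul, formOrd_smul_dx hX z hx, formOrd_smul_dx hX z hx, Scheme.ord_mul hg hf]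

theorem eq_zero_or_ord_nonneg_iff (z : X.PrimeDiv) [IsDiscreteValuationRing (X.localRing z.1)]
    {π : X.localRing z.1} (hπ : Irreducible π) (g : X.funField) (n : ℤ) :
    (g = 0 ∨ 0 ≤ Scheme.ord g z.1 + n) ↔ X.toFun z.1 π ^ n * g ∈ (X.toFun z.1).range := by
  have hπ0 : X.toFun z.1 π ^ n ≠ 0 := by
    refine zpow_ne_zero _ ?_
    rw [Ne, map_eq_zero_iff _ (X.toFun_injective z.1)]
    exact hπ.ne_zero
  have hord : Scheme.ord (X.toFun z.1 π ^ n) z.1 = n := by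
    have := ord_unit_mul_zpow z isUnit_one hπ n
    rwa [map_one, one_mul] at this
  by_cases hg : g = 0
  · simp [hg]
  rw [or_iff_right hg]
  constructor
  · intro h
    apply exists_toFun_eq_of_ord_nonneg z
    rw [Scheme.ord_mul hπ0 hg, hord]
    linarith
  · rintro ⟨a, ha⟩
    have := ord_toFun_nonneg z a
    rw [ha, Scheme.ord_mul hπ0 hg, hord] at this
    linarith

/-- The condition on a form imposed at one prime divisor. -/
theorem eq_zero_or_formOrd_nonneg_iff (hX : SmoothOfRelativeDimension r X.str) (z : X.PrimeDiv)
    {x : Fin r → X.localRing z.1} (hx : X.IsCoordinates z.1 x) (g : X.funField) (n : ℤ) :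
    (g • X.dx x = 0 ∨ 0 ≤ formOrd (g • X.dx x) z + n) ↔ (g = 0 ∨ 0 ≤ Scheme.ord g z.1 + n) := by
  rw [formOrd_smul_dx hX z hx, smul_eq_zero, or_iff_left (hx.dx_ne_zero hX)]

theorem mem_formSpace_iff {B : X.Divisor} (ω : X.RForm r) :
    ω ∈ formSpace r B ↔ ∀ z : X.PrimeDiv, ω = 0 ∨ 0 ≤ formOrd ω z + B z := by
  rw [forall_or_left]
  rfl

/-- `Ω^r(B)` as a subspace of the space of rational `r`-forms. -/
noncomputable def formSubmodule (hX : SmoothOfRelativeDimension r X.str) (B : X.Divisor) :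
    Submodule k (X.RForm r) where
  carrier := formSpace r B
  zero_mem' := Or.inl rfl
  add_mem' {ω χ} hω hχ := by
    rw [mem_formSpace_iff] at hω hχ ⊢
    intro z
    have := isDiscreteValuationRing hX z
    obtain ⟨π, hπ⟩ := IsDiscreteValuationRing.exists_irreducible (X.localRing z.1)
    obtain ⟨x, hx⟩ := exists_isCoordinates hX z.1
    obtain ⟨f, rfl⟩ := hx.exists_eq_smul_dx hX ω
    obtain ⟨g, rfl⟩ := hx.exists_eq_smul_dx hX χ
    have h1 := hω z
    have h2 := hχ z
    rw [eq_zero_or_formOrd_nonneg_iff hX z hx, eq_zero_or_ord_nonneg_iff z hπ] at h1 h2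
    rw [← add_smul, eq_zero_or_formOrd_nonneg_iff hX z hx, eq_zero_or_ord_nonneg_iff z hπ, mul_add]
    exact add_mem h1 h2
  smul_mem' c ω hω := by
    rw [mem_formSpace_iff] at hω ⊢
    intro z
    have := isDiscreteValuationRing hX z
    obtain ⟨π, hπ⟩ := IsDiscreteValuationRing.exists_irreducible (X.localRing z.1)
    obtain ⟨x, hx⟩ := exists_isCoordinates hX z.1
    obtain ⟨f, rfl⟩ := hx.exists_eq_smul_dx hX ω
    have h1 := hω z
    rw [eq_zero_or_formOrd_nonneg_iff hX z hx, eq_zero_or_ord_nonneg_iff z hπ] at h1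
    rw [algebra_compatible_smul X.funField, smul_smul, eq_zero_or_formOrd_nonneg_iff hX z hx,
      eq_zero_or_ord_nonneg_iff z hπ, mul_left_comm]
    refine mul_mem ⟨algebraMap k _ c, ?_⟩ h1
    exact (IsScalarTower.algebraMap_apply k (X.localRing z.1) X.funField c).symm

open Classical in
/-- The coefficient of the divisor of a form at an arbitrary point, zero away from
codimension one. -/
noncomputable def formCoeff (ω : X.RForm r) (x : X.carrier) : ℤ :=
  if h : coheight x = 1 then formOrd ω ⟨x, h⟩ else 0

theorem formCoeff_smul_dx (hX : SmoothOfRelativeDimension r X.str) (z : X.carrier)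
    {x : Fin r → X.localRing z} (hx : X.IsCoordinates z x) (g : X.funField) :
    formCoeff (g • X.dx x) z = Scheme.ord g z := by
  unfold formCoeff
  split_ifs with h
  · exact formOrd_smul_dx hX ⟨z, h⟩ hx g
  · rw [Scheme.ord_eq_zero_of_coheight_neq_one h]

theorem formCoeff_primeDiv (ω : X.RForm r) (z : X.PrimeDiv) : formCoeff ω z.1 = formOrd ω z :=
  dif_pos z.2

theorem Divisor.coeff_primeDiv (D : X.Divisor) (z : X.PrimeDiv) : D.coeff z.1 = D z :=
  dif_pos z.2

end

/-! ### Products: differential forms -/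

section

variable {X Y : Variety k}

theorem _root_.KaehlerDifferential.span_D_tensorProduct {A B ι κ : Type*} [CommRing A] [CommRing B]
    [Algebra k A] [Algebra k B] (x : ι → A) (y : κ → B)
    (hx : Submodule.span A (Set.range fun i => D k A (x i)) = ⊤)
    (hy : Submodule.span B (Set.range fun i => D k B (y i)) = ⊤) :
    Submodule.span (A ⊗[k] B) (Set.range (Sum.elim (fun i => D k (A ⊗[k] B) (x i ⊗ₜ 1))
      fun j => D k (A ⊗[k] B) (1 ⊗ₜ y j))) = ⊤ := by
  set S := Submodule.span (A ⊗[k] B) (Set.range (Sum.elim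
    (fun i => D k (A ⊗[k] B) (x i ⊗ₜ 1)) fun j => D k (A ⊗[k] B) (1 ⊗ₜ y j))) with hS
  have hA : ∀ a : A, D k (A ⊗[k] B) (a ⊗ₜ 1) ∈ S := by
    intro a
    have h1 : (⊤ : Submodule A Ω[A⁄k]) ≤
        (S.restrictScalars A).comap (KaehlerDifferential.map k k A (A ⊗[k] B)) := by
      rw [← hx, Submodule.span_le]
      rintro _ ⟨i, rfl⟩
      change KaehlerDifferential.map k k A (A ⊗[k] B) (D k A (x i)) ∈ S
      rw [map_D]
      exact Submodule.subset_span ⟨Sum.inl i, rfl⟩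
    have h2 := h1 (Submodule.mem_top (x := D k A a))
    change KaehlerDifferential.map k k A (A ⊗[k] B) (D k A a) ∈ S at h2
    rwa [map_D] at h2
  have hB : ∀ b : B, D k (A ⊗[k] B) (1 ⊗ₜ b) ∈ S := by
    intro b
    let := (Algebra.TensorProduct.includeRight (R := k) (A := A) (B := B)).toRingHom.toAlgebra
    have : IsScalarTower k B (A ⊗[k] B) := IsScalarTower.of_algebraMap_eq fun c =>
      (Algebra.TensorProduct.includeRight (R := k) (A := A) (B := B)).commutes c |>.symm
    have h1 : (⊤ : Submodule B Ω[B⁄k]) ≤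
        (S.restrictScalars B).comap (KaehlerDifferential.map k k B (A ⊗[k] B)) := by
      rw [← hy, Submodule.span_le]
      rintro _ ⟨i, rfl⟩
      change KaehlerDifferential.map k k B (A ⊗[k] B) (D k B (y i)) ∈ S
      rw [map_D]
      exact Submodule.subset_span ⟨Sum.inr i, rfl⟩
    have h2 := h1 (Submodule.mem_top (x := D k B b))
    change KaehlerDifferential.map k k B (A ⊗[k] B) (D k B b) ∈ S at h2
    rwa [map_D] at h2
  rw [eq_top_iff, ← span_range_derivation, Submodule.span_le]
  rintro _ ⟨t, rfl⟩
  induction t with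
  | zero => simp
  | add a b ha hb => rw [map_add]; exact add_mem ha hb
  | tmul a b =>
    have : a ⊗ₜ[k] b = (a ⊗ₜ 1) * (1 ⊗ₜ b) := by
      rw [Algebra.TensorProduct.tmul_mul_tmul, mul_one, one_mul]
    rw [this, Derivation.leibniz]
    exact add_mem (S.smul_mem _ (hB b)) (S.smul_mem _ (hA a))

/-- Local coordinates on the factors give local coordinates on the product. -/
theorem isCoordinates_append (z : (X.prod Y).carrier) {x : Fin r → X.localRing (prX X Y z)}
    {y : Fin s → Y.localRing (prY X Y z)} (hx : X.IsCoordinates _ x) (hy : Y.IsCoordinates _ y) :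
    (X.prod Y).IsCoordinates z (Fin.append (fun i => stalkPull (prX X Y) (prX_str X Y) z (x i))
      (fun j => stalkPull (prY X Y) (prY_str X Y) z (y j))) := by
  let h := isProduct_prod X Y
  let := (h.tensorMap z).toRingHom.toAlgebra
  have hloc := h.isLocalization z
  have : IsScalarTower k (X.localRing (prX X Y z) ⊗[k] Y.localRing (prY X Y z))
      ((X.prod Y).localRing z) := IsScalarTower.of_algebraMap_eq fun c => ((h.tensorMap z).commutes c).symm
  have h1 := span_D_of_isLocalization (k := k) (K := (X.prod Y).localRing z) (h.primeAt z).primeCompl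
    (Sum.elim (fun i => x i ⊗ₜ[k] (1 : Y.localRing (prY X Y z))) fun j => 1 ⊗ₜ y j) (by
      rw [← KaehlerDifferential.span_D_tensorProduct x y hx hy]
      congr 2
      ext (i | j) <;> rfl)
  rw [IsCoordinates, ← h1]
  congr 1
  ext t
  rw [Set.mem_range, Set.mem_range, ← finSumFinEquiv.exists_congr_right]
  refine exists_congr fun i => ?_
  have : Fin.append (fun i => stalkPull (prX X Y) (prX_str X Y) z (x i))
      (fun j => stalkPull (prY X Y) (prY_str X Y) z (y j)) (finSumFinEquiv i) =
      h.tensorMap z (Sum.elim (fun i => x i ⊗ₜ[k] (1 : Y.localRing (prY X Y z)))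
        (fun j => 1 ⊗ₜ y j) i) := by
    rcases i with i | j
    · simp [h.tensorMap_tmul_one]
    · simp [h.tensorMap_one_tmul]
  rw [this]
  rfl

theorem prodForm_smul_dx (z : (X.prod Y).carrier) (x : Fin r → X.localRing (prX X Y z))
    (y : Fin s → Y.localRing (prY X Y z)) (f : X.funField) (g : Y.funField) :
    prodForm (f • X.dx x) (g • Y.dx y) = prodFun f g • (X.prod Y).dx
      (Fin.append (fun i => stalkPull (prX X Y) (prX_str X Y) z (x i))
        (fun j => stalkPull (prY X Y) (prY_str X Y) z (y j))) := by
  have hw : ∀ (a b : (X.prod Y).funField) (ω : (X.prod Y).RForm r) (χ : (X.prod Y).RForm s),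
      RatForm.wedge (a • ω) (b • χ) = (a * b) • RatForm.wedge ω χ := fun a b ω χ =>
    Subtype.ext (smul_mul_smul_comm a ω.1 b χ.1)
  rw [prodForm, dx, dx, RatForm.pull_smul_dWedge, RatForm.pull_smul_dWedge, hw,
    RatForm.wedge_dWedge, dx]
  congr 2
  funext i
  refine Fin.addCases (fun i => ?_) (fun j => ?_) i
  · rw [Fin.append_left, Fin.append_left, funPull_toFun]
  · rw [Fin.append_right, Fin.append_right, funPull_toFun]

theorem prodFun_ne_zero {f : X.funField} {g : Y.funField} (hf : f ≠ 0) (hg : g ≠ 0) :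
    prodFun f g ≠ 0 :=
  mul_ne_zero ((map_ne_zero _).2 hf) ((map_ne_zero _).2 hg)

theorem ord_prodFun (hX : SmoothOfRelativeDimension r X.str) (hY : SmoothOfRelativeDimension s Y.str)
    {f : X.funField} {g : Y.funField} (hf : f ≠ 0) (hg : g ≠ 0) (w : (X.prod Y).PrimeDiv) :
    Scheme.ord (prodFun f g) w.1 =
      Scheme.ord f (prX X Y w.1) + Scheme.ord g (prY X Y w.1) := by
  have hZ := prod_smooth hX hY
  rw [prodFun, Scheme.ord_mul ((map_ne_zero _).2 hf) ((map_ne_zero _).2 hg)]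
  exact congrArg₂ _ ((isProduct_prod X Y).ord_pullFst hX hZ w f)
    ((isProduct_prod X Y).swap.ord_pullFst hY hZ w g)

theorem prodForm_ne_zero (hX : SmoothOfRelativeDimension r X.str)
    (hY : SmoothOfRelativeDimension s Y.str) {ω : X.RForm r} {χ : Y.RForm s} (hω : ω ≠ 0)
    (hχ : χ ≠ 0) : prodForm ω χ ≠ 0 := by
  let z := genericPoint (X.prod Y).carrier
  obtain ⟨x, hx⟩ := exists_isCoordinates hX (prX X Y z)
  obtain ⟨y, hy⟩ := exists_isCoordinates hY (prY X Y z)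
  obtain ⟨f, rfl⟩ := hx.exists_eq_smul_dx hX ω
  obtain ⟨g, rfl⟩ := hy.exists_eq_smul_dx hY χ
  rw [prodForm_smul_dx]
  refine smul_ne_zero (prodFun_ne_zero ?_ ?_)
    ((isCoordinates_append z hx hy).dx_ne_zero (prod_smooth hX hY))
  · rintro rfl
    exact hω (zero_smul _ _)
  · rintro rfl
    exact hχ (zero_smul _ _)

/-- The divisor of a product form is the sum of the pulled back divisors. -/
theorem formOrd_prodForm (hX : SmoothOfRelativeDimension r X.str)
    (hY : SmoothOfRelativeDimension s Y.str) {ω : X.RForm r} {χ : Y.RForm s} (hω : ω ≠ 0)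
    (hχ : χ ≠ 0) (w : (X.prod Y).PrimeDiv) :
    formOrd (prodForm ω χ) w = formCoeff ω (prX X Y w.1) + formCoeff χ (prY X Y w.1) := by
  obtain ⟨x, hx⟩ := exists_isCoordinates hX (prX X Y w.1)
  obtain ⟨y, hy⟩ := exists_isCoordinates hY (prY X Y w.1)
  obtain ⟨f, rfl⟩ := hx.exists_eq_smul_dx hX ω
  obtain ⟨g, rfl⟩ := hy.exists_eq_smul_dx hY χ
  have hf : f ≠ 0 := by
    rintro rfl
    exact hω (zero_smul _ _)
  have hg : g ≠ 0 := by
    rintro rfl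
    exact hχ (zero_smul _ _)
  rw [prodForm_smul_dx, formOrd_smul_dx (prod_smooth hX hY) w (isCoordinates_append w.1 hx hy),
    ord_prodFun hX hY hf hg, formCoeff_smul_dx hX _ hx, formCoeff_smul_dx hY _ hy]

end

end Variety

/-! ### Coordinates at generizations and at rational points -/

namespace Variety

open KaehlerDifferential

variable {k : Type u} [Field k] {r s : ℕ} {X : Variety k}

/-- The local ring at a generization is a localization. -/
theorem isLocalization_stalkSpecializes (X : Variety k) {w z : X.carrier} (h : w ⤳ z) :
    letI := (X.carrier.presheaf.stalkSpecializes h).hom.toAlgebra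
    ∃ M : Submonoid (X.localRing z), IsLocalization M (X.localRing w) := by
  let := (X.carrier.presheaf.stalkSpecializes h).hom.toAlgebra
  obtain ⟨_, ⟨V, hV, rfl⟩, hz, -⟩ := X.carrier.isBasis_affineOpens.exists_subset_of_mem_open
    (Set.mem_univ z) isOpen_univ
  have hw : w ∈ V := h.mem_open V.2 hz
  let : Algebra Γ(X.carrier, V) (X.localRing z) := (X.carrier.presheaf.germ V z hz).hom.toAlgebra
  let : Algebra Γ(X.carrier, V) (X.localRing w) := (X.carrier.presheaf.germ V w hw).hom.toAlgebra
  have : IsScalarTower Γ(X.carrier, V) (X.localRing z) (X.localRing w) :=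
    IsScalarTower.of_algebraMap_eq' (by
      have : X.carrier.presheaf.germ V z hz ≫ X.carrier.presheaf.stalkSpecializes h =
        X.carrier.presheaf.germ V w hw := TopCat.Presheaf.germ_stalkSpecializes ..
      exact (congrArg CommRingCat.Hom.hom this).symm)
  have hlz : IsLocalization.AtPrime (X.localRing z) (hV.primeIdealOf ⟨z, hz⟩).asIdeal :=
    hV.isLocalization_stalk ⟨z, hz⟩
  have hlw : IsLocalization.AtPrime (X.localRing w) (hV.primeIdealOf ⟨w, hw⟩).asIdeal :=
    hV.isLocalization_stalk ⟨w, hw⟩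
  refine ⟨_, IsLocalization.isLocalization_of_submonoid_le (X.localRing z) (X.localRing w)
    (hV.primeIdealOf ⟨z, hz⟩).asIdeal.primeCompl (hV.primeIdealOf ⟨w, hw⟩).asIdeal.primeCompl ?_⟩
  intro f hf
  have h1 := (IsLocalization.AtPrime.isUnit_to_map_iff (X.localRing z) _ f).2 hf
  have h2 := h1.map (algebraMap (X.localRing z) (X.localRing w))
  rw [← IsScalarTower.algebraMap_apply] at h2
  exact (IsLocalization.AtPrime.isUnit_to_map_iff (X.localRing w) _ f).1 h2

theorem IsCoordinates.of_specializes {w z : X.carrier} (h : w ⤳ z) {x : Fin r → X.localRing z}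
    (hx : X.IsCoordinates z x) :
    X.IsCoordinates w fun i => X.carrier.presheaf.stalkSpecializes h (x i) := by
  let := (X.carrier.presheaf.stalkSpecializes h).hom.toAlgebra
  obtain ⟨M, hM⟩ := X.isLocalization_stalkSpecializes h
  have : IsScalarTower k (X.localRing z) (X.localRing w) :=
    IsScalarTower.of_algebraMap_eq fun a => (X.stalkSpecializes_const h a).symm
  exact span_D_of_isLocalization M x hx

theorem dx_stalkSpecializes {w z : X.carrier} (h : w ⤳ z) (x : Fin r → X.localRing z) :
    (X.dx fun i => X.carrier.presheaf.stalkSpecializes h (x i)) = X.dx x := by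
  rw [dx, dx]
  congr 1
  funext i
  exact X.toFun_stalkSpecializes h (x i)

/-- The evaluation of germs at a rational point. -/
noncomputable def RatPoint.ev (P : X.RatPoint) : X.localRing P.pt →ₐ[k] k where
  toRingHom := (Scheme.stalkClosedPointTo P.hom).hom
  commutes' a := by
    have : CommRingCat.ofHom (X.const (P.hom (IsLocalRing.closedPoint k))) ≫ Scheme.stalkClosedPointTo P.hom =
        𝟙 (CommRingCat.of k) := by
      apply Spec.map_injective
      rw [Spec.map_comp, ← fromSpecStalk_str, Scheme.Spec_stalkClosedPointTo_fromSpecStalk_assoc,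
        P.w, Spec.map_id]
    exact congrArg (fun q => q.hom a) this

theorem ev_eq_zero_iff {z : X.carrier} (ev : X.localRing z →ₐ[k] k) (g : X.localRing z) :
    ev g = 0 ↔ g ∈ IsLocalRing.maximalIdeal (X.localRing z) := by
  have hs : Function.Surjective ev := fun c => ⟨algebraMap k _ c, ev.commutes c⟩
  have h1 : (RingHom.ker ev).IsMaximal := RingHom.ker_isMaximal_of_surjective ev.toRingHom hs
  rw [← IsLocalRing.eq_maximalIdeal h1, RingHom.mem_ker]

/-- At a rational point, generators of the maximal ideal are local coordinates. -/
theorem isCoordinates_of_span_eq (hX : SmoothOfRelativeDimension r X.str) {z : X.carrier}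
    (ev : X.localRing z →ₐ[k] k) {x : Fin r → X.localRing z}
    (hx : Ideal.span (Set.range x) = IsLocalRing.maximalIdeal (X.localRing z)) :
    X.IsCoordinates z x := by
  obtain ⟨y, b, -⟩ := hasCoordinates hX z
  have hfin : Module.Finite (X.localRing z) Ω[X.localRing z⁄k] := Module.Finite.of_basis b
  set N := Submodule.span (X.localRing z)
    (Set.range fun i => D k (X.localRing z) (x i)) with hN
  rw [IsCoordinates, ← hN, eq_top_iff]
  refine Submodule.le_of_le_smul_of_le_jacobson_bot
    (I := IsLocalRing.maximalIdeal (X.localRing z)) hfin.fg_top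
    (IsLocalRing.jacobson_eq_maximalIdeal ⊥ bot_ne_top).ge ?_
  rw [← span_range_derivation, Submodule.span_le]
  rintro _ ⟨g, rfl⟩
  have hm : g - algebraMap k _ (ev g) ∈ Ideal.span (Set.range x) := by
    rw [hx, ← ev_eq_zero_iff ev, map_sub, AlgHom.commutes]
    exact sub_self _
  have key : ∀ a ∈ Ideal.span (Set.range x), D k (X.localRing z) a ∈
      N ⊔ IsLocalRing.maximalIdeal (X.localRing z) • (⊤ : Submodule (X.localRing z) _) := by
    intro a ha
    induction ha using Submodule.span_induction with
    | mem a h =>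
      obtain ⟨i, rfl⟩ := h
      exact Submodule.mem_sup_left (Submodule.subset_span ⟨i, rfl⟩)
    | zero => simp
    | add a b _ _ ha hb => rw [map_add]; exact add_mem ha hb
    | smul c a h ha =>
      rw [smul_eq_mul, Derivation.leibniz]
      refine add_mem (Submodule.smul_mem _ _ ha) (Submodule.mem_sup_right ?_)
      refine Submodule.smul_mem_smul ?_ Submodule.mem_top
      rw [← hx]
      exact h
  have := key _ hm
  rw [map_sub, Derivation.map_algebraMap, sub_zero] at this
  rw [span_range_derivation]
  exact this

theorem exists_powerExpansion (hX : SmoothOfRelativeDimension r X.str) {z : X.carrier}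
    (ev : X.localRing z →ₐ[k] k) {x : Fin r → X.localRing z}
    (hx : Ideal.span (Set.range x) = IsLocalRing.maximalIdeal (X.localRing z)) :
    Nonempty (PowerExpansion k x) := by
  obtain ⟨d, hd, -⟩ := (hasCoordinates hX z).exists_dual x (isCoordinates_of_span_eq hX ev hx)
  have := formallySmooth hX z
  refine ⟨.ofFormallySmooth ev d (fun i => ?_) (fun g hg => ?_) hd⟩
  · rw [ev_eq_zero_iff, ← hx]
    exact Ideal.subset_span ⟨i, rfl⟩
  · rwa [hx, ← ev_eq_zero_iff ev]

/-! ### Residues -/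

theorem IsExpansionCoeff.eq_coeff {z : X.carrier} {x : Fin r → X.localRing z}
    (hx : Ideal.span (Set.range x) = IsLocalRing.maximalIdeal (X.localRing z))
    (E : PowerExpansion k x) {g : X.localRing z} {I : Fin r →₀ ℕ} {c : k}
    (h : IsExpansionCoeff x g I c) : c = E.coeff I g := by
  obtain ⟨F, hF, rfl⟩ := h
  rw [← hx] at hF
  have := E.coeff_of_mem I _ hF
  rw [map_sub, E.coeff_aeval, sub_eq_zero] at this
  exact this.symm

theorem isExpansionCoeff_coeff {z : X.carrier} {x : Fin r → X.localRing z}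
    (hx : Ideal.span (Set.range x) = IsLocalRing.maximalIdeal (X.localRing z))
    (E : PowerExpansion k x) (g : X.localRing z) (I : Fin r →₀ ℕ) :
    IsExpansionCoeff x g I (E.coeff I g) := by
  obtain ⟨F, hF⟩ := E.exists_approx g (I.degree + 1)
  refine ⟨F, by rwa [← hx], ?_⟩
  have := E.coeff_of_mem I _ hF
  rw [map_sub, E.coeff_aeval, sub_eq_zero] at this
  exact this.symm

/-- Two local equations of a divisor differ by a unit. -/
theorem IsLocalEquation.exists_unit (hX : SmoothOfRelativeDimension r X.str) {B : X.Divisor}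
    {z : X.carrier} {f g : X.localRing z} (hf : IsLocalEquation B z f)
    (hg : IsLocalEquation B z g) : ∃ u, IsUnit u ∧ g = u * f := by
  have key : ∀ {f g : X.localRing z}, IsLocalEquation B z f → IsLocalEquation B z g →
      ∃ u, g = u * f := by
    intro f g hf hg
    have hf0 : X.toFun z f ≠ 0 := by
      rw [Ne, map_eq_zero_iff _ (X.toFun_injective z)]
      exact hf.1
    have hg0 : X.toFun z g ≠ 0 := by
      rw [Ne, map_eq_zero_iff _ (X.toFun_injective z)]
      exact hg.1
    obtain ⟨u, hu⟩ := exists_toFun_eq_of_forall_ord_nonneg hX z (X.toFun z g / X.toFun z f)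
      fun w hw => by
        have h1 : Scheme.ord (X.toFun z g / X.toFun z f * X.toFun z f) w.1 =
            Scheme.ord (X.toFun z f) w.1 := by
          rw [div_mul_cancel₀ _ hf0, hg.2 w hw, hf.2 w hw]
        rw [Scheme.ord_mul (div_ne_zero hg0 hf0) hf0] at h1
        linarith
    refine ⟨u, X.toFun_injective z ?_⟩
    rw [map_mul, hu, div_mul_cancel₀ _ hf0]
  obtain ⟨u, hu⟩ := key hf hg
  obtain ⟨v, hv⟩ := key hg hf
  refine ⟨u, IsUnit.of_mul_eq_one v (mul_right_cancel₀ hg.1 ?_), hu⟩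
  rw [one_mul, mul_assoc, ← hv, ← hu]

/-- The residue can be computed from any local data. -/
theorem IsResidue.eq_coeff (hX : SmoothOfRelativeDimension r X.str) {B : Fin r → X.Divisor}
    {P : X.RatPoint} {ω : X.RForm r} {c : k} (hc : IsResidue B P ω c) (L : LocalData B P.pt)
    (E : PowerExpansion k L.x) {h : X.localRing P.pt}
    (hω : X.toFun P.pt (∏ l, L.f l) • ω = X.toFun P.pt h • X.dx L.x) :
    c = E.coeff (constExp r (L.a - 1)) (L.R.det * h) := by
  obtain ⟨L', h', hω', hexp⟩ := hc
  obtain ⟨E'⟩ := exists_powerExpansion hX P.ev L'.span_x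
  rw [hexp.eq_coeff L'.span_x E']
  choose u hu huf using fun l => (L.isLocalEquation l).exists_unit hX (L'.isLocalEquation l)
  have hcoord := isCoordinates_of_span_eq hX P.ev L.span_x
  obtain ⟨d, hd, hD⟩ := (hasCoordinates hX P.pt).exists_dual L.x hcoord
  have hU : IsUnit (∏ l, u l) := by
    rw [IsUnit.prod_univ_iff]
    exact hu
  obtain ⟨U, hU⟩ := hU
  set J := (Matrix.of fun i l => d l (L'.x i)) with hJ
  have hdx : X.dx L'.x = X.toFun P.pt J.det • X.dx L.x := dx_eq_det_smul _ _ J fun i => hD _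
  have hf : ∏ l, L'.f l = U * ∏ l, L.f l := by
    rw [hU, ← Finset.prod_mul_distrib]
    exact Finset.prod_congr rfl fun l _ => huf l
  rw [hf, map_mul, mul_smul, hω, hdx, smul_smul, smul_smul, ← map_mul, ← map_mul] at hω'
  have h1 := X.toFun_injective _ (hcoord.smul_dx_injective hX hω')
  have h2 : J.det * (↑U⁻¹ * h') = h := by
    rw [mul_left_comm, mul_comm J.det, ← h1, ← mul_assoc, Units.inv_mul, one_mul]
  have h3 : (L'.R * Matrix.diagonal u).det * (↑U⁻¹ * h') = L'.R.det * h' := by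
    rw [Matrix.det_mul, Matrix.det_diagonal, ← hU, mul_assoc, ← mul_assoc (U : X.localRing P.pt),
      Units.mul_inv, one_mul]
  have h4 := E'.coeff_det_mul_eq E L'.a_pos L.a_pos (f := L.f) (R := L'.R * Matrix.diagonal u)
    (R' := L.R) (fun i => by
      rw [L'.pow_eq]
      refine Finset.sum_congr rfl fun j _ => ?_
      rw [Matrix.mul_diagonal, huf, mul_assoc]) L.pow_eq d hd (↑U⁻¹ * h')
  rw [h3, ← hJ, h2] at h4
  exact h4

/-- The residue, defined by a choice of local data, is computed from any local data at `P`. The point is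
a variable `z` because the points `(P × Q).pt` lie over `P.pt` only up to a propositional equality. -/
theorem residue_eq_coeff (hX : SmoothOfRelativeDimension r X.str) {B : Fin r → X.Divisor}
    (P : X.RatPoint) {z : X.carrier} (hz : P.pt = z) {ω : X.RForm r} (L : LocalData B z)
    (E : PowerExpansion k L.x) {h : X.localRing z}
    (hω : X.toFun z (∏ l, L.f l) • ω = X.toFun z h • X.dx L.x) :
    residue B P ω = E.coeff (constExp r (L.a - 1)) (L.R.det * h) := by
  subst hz
  have hex : ∃ c, IsResidue B P ω c :=
    ⟨_, L, h, hω, isExpansionCoeff_coeff L.span_x E _ _⟩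
  rw [residue, dif_pos hex]
  exact hex.choose_spec.eq_coeff hX L E hω

theorem ord_prod_localEquation {z : X.carrier} {ι : Type*} (S : Finset ι)
    (f : ι → X.localRing z) (b : ι → X.Divisor) (hf : ∀ l, IsLocalEquation (b l) z (f l))
    (w : X.PrimeDiv) (hw : w.1 ⤳ z) :
    Scheme.ord (X.toFun z (∏ l ∈ S, f l)) w.1 = ∑ l ∈ S, b l w := by
  classical
  have hf0 : ∀ l, X.toFun z (f l) ≠ 0 := fun l => by
    rw [Ne, map_eq_zero_iff _ (X.toFun_injective z)]
    exact (hf l).1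
  induction S using Finset.induction_on with
  | empty =>
    have := ord_toFun_of_isUnit w isUnit_one
    simpa using this
  | insert l S hl ih =>
    rw [Finset.prod_insert hl, Finset.sum_insert hl, map_mul, Scheme.ord_mul (hf0 l), ih,
      (hf l).2 w hw]
    rw [map_prod]
    exact Finset.prod_ne_zero_iff.2 fun l _ => hf0 l

/-- A form in `Ω^r(∑ D_l - G - N)` with `N` effective becomes regular at `z ∉ supp G` after
multiplication with the local equations. -/
theorem exists_smul_eq_smul_dx (hX : SmoothOfRelativeDimension r X.str) {B : Fin r → X.Divisor}
    {G N : X.Divisor} {ω : X.RForm r} (hN : 0 ≤ N) (hω : ω ∈ formSpace r ((∑ l, B l) - G - N))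
    {z : X.carrier} (hG : z ∉ G.supp) (ev : X.localRing z →ₐ[k] k) (L : LocalData B z) :
    ∃ h, X.toFun z (∏ l, L.f l) • ω = X.toFun z h • X.dx L.x := by
  have hcoord := isCoordinates_of_span_eq hX ev L.span_x
  obtain ⟨g, rfl⟩ := hcoord.exists_eq_smul_dx hX ω
  obtain ⟨h, hh⟩ := exists_toFun_eq_of_forall_ord_nonneg hX z (X.toFun z (∏ l, L.f l) * g)
    fun w hw => by
      by_cases hg : g = 0
      · simp [hg]
      have hf0 : X.toFun z (∏ l, L.f l) ≠ 0 := by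
        rw [Ne, map_eq_zero_iff _ (X.toFun_injective z)]
        exact Finset.prod_ne_zero_iff.2 fun l _ => (L.isLocalEquation l).1
      rw [Scheme.ord_mul hf0 hg, ord_prod_localEquation _ _ B L.isLocalEquation w hw]
      rw [mem_formSpace_iff] at hω
      have h1 := (hω w).resolve_left (smul_ne_zero hg (hcoord.dx_ne_zero hX))
      rw [← dx_stalkSpecializes hw, formOrd_smul_dx hX w (hcoord.of_specializes hw)] at h1
      have h2 : G w = 0 := by
        by_contra h2
        exact hG ⟨w, h2, hw⟩
      have h3 : 0 ≤ N w := hN w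
      simp only [Finsupp.coe_sub, Pi.sub_apply, Finsupp.finsetSum_apply, h2] at h1
      linarith
  exact ⟨h, by rw [hh, smul_smul]⟩

end Variety

/-! ### Local data on products -/

section

variable {k O O' S : Type*} [Field k] [CommRing O] [Algebra k O] [CommRing O'] [Algebra k O']
  [CommRing S] [Algebra k S] {r s : ℕ}

theorem MvPolynomial.coeff_constExp_rename_mul (b : ℕ) (F : MvPolynomial (Fin r) k)
    (G : MvPolynomial (Fin s) k) :
    coeff (constExp (r + s) b) (rename (Fin.castAdd s) F * rename (Fin.natAdd r) G) =
      coeff (constExp r b) F * coeff (constExp s b) G := by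
  induction F using MvPolynomial.induction_on' with
  | add F F' hF hF' => rw [map_add, add_mul, coeff_add, coeff_add, hF, hF', add_mul]
  | monomial I c =>
    induction G using MvPolynomial.induction_on' with
    | add G G' hG hG' => rw [map_add, mul_add, coeff_add, coeff_add, hG, hG', mul_add]
    | monomial J d =>
      classical
      rw [rename_monomial, rename_monomial, monomial_mul, coeff_monomial, coeff_monomial,
        coeff_monomial]
      have hI : ∀ i, (I.mapDomain (Fin.castAdd s) + J.mapDomain (Fin.natAdd r))
          (Fin.castAdd s i) = I i := fun i => by
        rw [Finsupp.add_apply, Finsupp.mapDomain_apply (Fin.castAdd_injective r s),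
          Finsupp.mapDomain_of_notMem_range, add_zero]
        rintro ⟨j, hj⟩
        have := congrArg Fin.val hj
        simp at this
        omega
      have hJ : ∀ j, (I.mapDomain (Fin.castAdd s) + J.mapDomain (Fin.natAdd r))
          (Fin.natAdd r j) = J j := fun j => by
        rw [Finsupp.add_apply, Finsupp.mapDomain_apply (Fin.natAdd_injective s r),
          Finsupp.mapDomain_of_notMem_range, zero_add]
        rintro ⟨i, hi⟩
        have := congrArg Fin.val hi
        simp at this
        omega
      have hiff : I.mapDomain (Fin.castAdd s) + J.mapDomain (Fin.natAdd r) = constExp (r + s) b ↔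
          I = constExp r b ∧ J = constExp s b := by
        constructor
        · intro h
          constructor
          · ext i
            rw [← hI, h]
            rfl
          · ext j
            rw [← hJ, h]
            rfl
        · rintro ⟨h1, h2⟩
          ext i
          refine Fin.addCases (fun i => ?_) (fun j => ?_) i
          · rw [hI, h1]
            rfl
          · rw [hJ, h2]
            rfl
      simp only [hiff]
      by_cases h1 : I = constExp r b <;> by_cases h2 : J = constExp s b <;> simp [h1, h2]

/-- The expansion of a product of functions in separate variables. -/
theorem PowerExpansion.coeff_constExp_mul (α : O →ₐ[k] S) (β : O' →ₐ[k] S) {x : Fin r → O}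
    {y : Fin s → O'} (E : PowerExpansion k x) (E' : PowerExpansion k y)
    {z : Fin (r + s) → S} (hz : z = Fin.append (fun i => α (x i)) fun j => β (y j))
    (E'' : PowerExpansion k z) (b : ℕ) (u : O) (v : O') :
    E''.coeff (constExp (r + s) b) (α u * β v) =
      E.coeff (constExp r b) u * E'.coeff (constExp s b) v := by
  set n := (constExp (r + s) b).degree + 1 with hn
  obtain ⟨F, hF⟩ := E.exists_approx u n
  obtain ⟨G, hG⟩ := E'.exists_approx v n
  have hα : ∀ a ∈ Ideal.span (Set.range x) ^ n, α a ∈ Ideal.span (Set.range z) ^ n := by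
    have : (Ideal.span (Set.range x)).map α ≤ Ideal.span (Set.range z) := by
      rw [Ideal.map_span, Ideal.span_le]
      rintro _ ⟨_, ⟨i, rfl⟩, rfl⟩
      exact Ideal.subset_span ⟨Fin.castAdd s i, by rw [hz]; exact Fin.append_left _ _ _⟩
    intro a ha
    have h1 := Ideal.mem_map_of_mem α ha
    rw [Ideal.map_pow] at h1
    exact Ideal.pow_right_mono this n h1
  have hβ : ∀ a ∈ Ideal.span (Set.range y) ^ n, β a ∈ Ideal.span (Set.range z) ^ n := by
    have : (Ideal.span (Set.range y)).map β ≤ Ideal.span (Set.range z) := by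
      rw [Ideal.map_span, Ideal.span_le]
      rintro _ ⟨_, ⟨i, rfl⟩, rfl⟩
      exact Ideal.subset_span ⟨Fin.natAdd r i, by rw [hz]; exact Fin.append_right _ _ _⟩
    intro a ha
    have h1 := Ideal.mem_map_of_mem β ha
    rw [Ideal.map_pow] at h1
    exact Ideal.pow_right_mono this n h1
  have hFz : MvPolynomial.aeval z (MvPolynomial.rename (Fin.castAdd s) F) =
      α (MvPolynomial.aeval x F) := by
    rw [MvPolynomial.aeval_rename, ← AlgHom.comp_apply, MvPolynomial.comp_aeval]
    congr 2
    funext i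
    rw [hz]
    exact Fin.append_left _ _ _
  have hGz : MvPolynomial.aeval z (MvPolynomial.rename (Fin.natAdd r) G) =
      β (MvPolynomial.aeval y G) := by
    rw [MvPolynomial.aeval_rename, ← AlgHom.comp_apply, MvPolynomial.comp_aeval]
    congr 2
    funext i
    rw [hz]
    exact Fin.append_right _ _ _
  have hmem : α u * β v - MvPolynomial.aeval z (MvPolynomial.rename (Fin.castAdd s) F *
      MvPolynomial.rename (Fin.natAdd r) G) ∈ Ideal.span (Set.range z) ^ n := by
    rw [map_mul, hFz, hGz]
    have : α u * β v - α (MvPolynomial.aeval x F) * β (MvPolynomial.aeval y G) =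
        α (u - MvPolynomial.aeval x F) * β v +
          α (MvPolynomial.aeval x F) * β (v - MvPolynomial.aeval y G) := by
      rw [map_sub, map_sub]
      ring
    rw [this]
    exact add_mem (Ideal.mul_mem_right _ _ (hα _ hF)) (Ideal.mul_mem_left _ _ (hβ _ hG))
  have h1 := E''.coeff_of_mem _ _ hmem
  have hdeg : ∀ {t : ℕ}, t ≤ r + s → (constExp t b).degree + 1 ≤ n := by
    intro t ht
    have h2 : ∀ t, (constExp t b).degree = t * b := fun t => by
      rw [Finsupp.degree_eq_sum]
      simp
    rw [hn, h2, h2]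
    gcongr
  have h2 := E.coeff_of_mem _ _ (Ideal.pow_le_pow_right (hdeg (Nat.le_add_right r s)) hF)
  have h3 := E'.coeff_of_mem _ _ (Ideal.pow_le_pow_right (hdeg (Nat.le_add_left s r)) hG)
  rw [map_sub, sub_eq_zero, PowerExpansion.coeff_aeval] at h1 h2 h3
  rw [h1, h2, h3, MvPolynomial.coeff_constExp_rename_mul]

end

namespace Variety

variable {k : Type u} [Field k] {r s : ℕ}

/-- Local data with exponent `a + n` instead of `a`. -/
noncomputable def LocalData.raise {X : Variety k} {D : Fin r → X.Divisor} {p : X.carrier}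
    (L : LocalData D p) (n : ℕ) : LocalData D p where
  x := L.x
  span_x := L.span_x
  f := L.f
  isLocalEquation := L.isLocalEquation
  a := L.a + n
  a_pos := Nat.add_pos_left L.a_pos n
  R := Matrix.diagonal (fun i => L.x i ^ n) * L.R
  pow_eq i := by
    rw [pow_add, L.pow_eq, Finset.sum_mul]
    refine Finset.sum_congr rfl fun j _ => ?_
    rw [Matrix.diagonal_mul]
    ring

/-- In the definition of a rectifying function the exponent can be increased. -/
theorem RectifiesAt.exists_forall_le {X : Variety k} {D : Fin r → X.Divisor} {p : X.carrier}
    {θ : X.funField} {c : k} (h : RectifiesAt D p θ c) : ∃ N, ∀ a, N ≤ a →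
      ∃ (L : LocalData D p) (t : X.localRing p), L.a = a ∧ X.toFun p t = θ ∧
        L.R.det * t - algebraMap k (X.localRing p) c * ∏ i, L.x i ^ (L.a - 1) ∈
          Ideal.span (Set.range fun i => L.x i ^ L.a) := by
  obtain ⟨L, t, ht, hmem⟩ := h
  refine ⟨L.a, fun a ha => ?_⟩
  obtain ⟨n, rfl⟩ := Nat.exists_eq_add_of_le ha
  refine ⟨L.raise n, t, rfl, ht, ?_⟩
  change (Matrix.diagonal (fun i => L.x i ^ n) * L.R).det * t -
    algebraMap k (X.localRing p) c * ∏ i, L.x i ^ (L.a + n - 1) ∈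
      Ideal.span (Set.range fun i => L.x i ^ (L.a + n))
  have h1 : (Matrix.diagonal (fun i => L.x i ^ n) * L.R).det * t -
      algebraMap k (X.localRing p) c * ∏ i, L.x i ^ (L.a + n - 1) =
      (L.R.det * t - algebraMap k (X.localRing p) c * ∏ i, L.x i ^ (L.a - 1)) *
        ∏ i, L.x i ^ n := by
    have : ∏ i, L.x i ^ (L.a + n - 1) = (∏ i, L.x i ^ (L.a - 1)) * ∏ i, L.x i ^ n := by
      rw [← Finset.prod_mul_distrib]
      refine Finset.prod_congr rfl fun i _ => ?_
      rw [← pow_add]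
      congr 1
      have := L.a_pos
      omega
    rw [Matrix.det_mul, Matrix.det_diagonal, this]
    ring
  rw [h1]
  generalize L.R.det * t - algebraMap k (X.localRing p) c * ∏ i, L.x i ^ (L.a - 1) = g at hmem ⊢
  induction hmem using Submodule.span_induction with
  | mem g hg =>
    obtain ⟨i, rfl⟩ := hg
    rw [← Finset.mul_prod_erase _ _ (Finset.mem_univ i), ← mul_assoc, ← pow_add]
    exact Ideal.mul_mem_right _ _ (Ideal.subset_span ⟨i, rfl⟩)
  | zero => simp
  | add g g' _ _ hg hg' => rw [add_mul]; exact add_mem hg hg'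
  | smul c g _ hg => rw [smul_eq_mul, mul_assoc]; exact Ideal.mul_mem_left _ _ hg

theorem IsProduct.isLocalEquation {X Y Z : Variety k} {p : Z.carrier ⟶ X.carrier}
    {q : Z.carrier ⟶ Y.carrier} (h : IsProduct p q) (hX : SmoothOfRelativeDimension r X.str)
    (hZ : SmoothOfRelativeDimension s Z.str) {B : X.Divisor} {B' : Z.Divisor}
    (hB : ∀ w, B' w = B.coeff (p w.1)) {z : Z.carrier} {f : X.localRing (p z)}
    (hf : IsLocalEquation B (p z) f) : IsLocalEquation B' z (stalkPull p h.fst_str z f) := by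
  refine ⟨?_, fun w hw => ?_⟩
  · rw [Ne, ← map_zero (stalkPull p h.fst_str z), (h.stalkPull_injective z).eq_iff]
    exact hf.1
  · rw [← h.pullFst_toFun, h.ord_pullFst hX hZ, hB]
    unfold Divisor.coeff
    split_ifs with hc
    · exact hf.2 ⟨p w.1, hc⟩ (hw.map p.continuous)
    · exact Scheme.ord_eq_zero_of_coheight_neq_one hc _

section

variable [PerfectField k] {X Y : Variety k} {D : Fin r → X.Divisor} {E : Fin s → Y.Divisor}
  {z : (X.prod Y).carrier}

/-- Local data with the same exponent at closed points of `X` and `Y` give local data on the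
product: one takes the union of the generators and the direct sum of the matrices. -/
noncomputable def LocalData.prod (hX : SmoothOfRelativeDimension r X.str)
    (hY : SmoothOfRelativeDimension s Y.str) (L : LocalData D (prX X Y z))
    (L' : LocalData E (prY X Y z)) (ha : L.a = L'.a) (hx : IsClosed {prX X Y z})
    (hy : IsClosed {prY X Y z}) : LocalData (prodDiv D E) z where
  x := Fin.append (fun i => stalkPull (prX X Y) (prX_str X Y) z (L.x i))
    (fun j => stalkPull (prY X Y) (prY_str X Y) z (L'.x j))
  span_x := by
    rw [(isProduct_prod X Y).maximalIdeal_eq_sup z hx hy, ← L.span_x, ← L'.span_x, Ideal.map_span,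
      Ideal.map_span, ← Ideal.span_union]
    congr 1
    ext t
    rw [Set.mem_range, ← finSumFinEquiv.exists_congr_right, Sum.exists, Set.mem_union,
      ← Set.range_comp, ← Set.range_comp]
    simp only [finSumFinEquiv_apply_left, finSumFinEquiv_apply_right, Fin.append_left,
      Fin.append_right]
    rfl
  f := Fin.append (fun i => stalkPull (prX X Y) (prX_str X Y) z (L.f i))
    (fun j => stalkPull (prY X Y) (prY_str X Y) z (L'.f j))
  isLocalEquation l := by
    have hZ := prod_smooth hX hY
    refine Fin.addCases (fun i => ?_) (fun j => ?_) l
    · rw [Fin.append_left, prodDiv, Fin.append_left]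
      exact (isProduct_prod X Y).isLocalEquation hX hZ (fun _ => rfl) (L.isLocalEquation i)
    · rw [Fin.append_right, prodDiv, Fin.append_right]
      exact (isProduct_prod X Y).swap.isLocalEquation hY hZ (fun _ => rfl) (L'.isLocalEquation j)
  a := L.a
  a_pos := L.a_pos
  R := Matrix.reindex finSumFinEquiv finSumFinEquiv (Matrix.fromBlocks
    (L.R.map (stalkPull (prX X Y) (prX_str X Y) z)) 0 0
    (L'.R.map (stalkPull (prY X Y) (prY_str X Y) z)))
  pow_eq l := by
    refine Fin.addCases (fun i => ?_) (fun j => ?_) l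
    · rw [Fin.append_left, ← map_pow, L.pow_eq, map_sum, Fin.sum_univ_add]
      simp
    · rw [Fin.append_right, ← map_pow, ha, L'.pow_eq, map_sum, Fin.sum_univ_add]
      simp

theorem LocalData.det_prod (hX : SmoothOfRelativeDimension r X.str)
    (hY : SmoothOfRelativeDimension s Y.str) (L : LocalData D (prX X Y z))
    (L' : LocalData E (prY X Y z)) (ha : L.a = L'.a) (hx : IsClosed {prX X Y z})
    (hy : IsClosed {prY X Y z}) : (L.prod hX hY L' ha hx hy).R.det =
      stalkPull (prX X Y) (prX_str X Y) z L.R.det *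
        stalkPull (prY X Y) (prY_str X Y) z L'.R.det := by
  change (Matrix.reindex finSumFinEquiv finSumFinEquiv (Matrix.fromBlocks
    (L.R.map (stalkPull (prX X Y) (prX_str X Y) z)) 0 0
    (L'.R.map (stalkPull (prY X Y) (prY_str X Y) z)))).det = _
  rw [Matrix.det_reindex_self, Matrix.det_fromBlocks_zero₁₂, AlgHom.map_det, AlgHom.map_det]
  rfl

/-- The product of rectifying functions is rectifying, with the product of the constants. -/
theorem RectifiesAt.prod (hX : SmoothOfRelativeDimension r X.str)
    (hY : SmoothOfRelativeDimension s Y.str) (hx : IsClosed {prX X Y z})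
    (hy : IsClosed {prY X Y z}) {θ : X.funField} {lam : Y.funField} {c c' : k}
    (h : RectifiesAt D (prX X Y z) θ c) (h' : RectifiesAt E (prY X Y z) lam c') :
    RectifiesAt (prodDiv D E) z (prodFun θ lam) (c * c') := by
  obtain ⟨N, hN⟩ := h.exists_forall_le
  obtain ⟨N', hN'⟩ := h'.exists_forall_le
  obtain ⟨L, t, ha, ht, hmem⟩ := hN (max N N') (le_max_left _ _)
  obtain ⟨L', t', ha', ht', hmem'⟩ := hN' (max N N') (le_max_right _ _)
  have haa : L.a = L'.a := ha.trans ha'.symm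
  let α := stalkPull (prX X Y) (prX_str X Y) z
  let β := stalkPull (prY X Y) (prY_str X Y) z
  refine ⟨L.prod hX hY L' haa hx hy, α t * β t', ?_, ?_⟩
  · rw [map_mul, ← funPull_toFun, ← funPull_toFun, ht, ht', prodFun]
  rw [LocalData.det_prod]
  change α L.R.det * β L'.R.det * (α t * β t') - algebraMap k _ (c * c') *
      ∏ i, Fin.append (fun i => α (L.x i)) (fun j => β (L'.x j)) i ^ (L.a - 1) ∈
    Ideal.span (Set.range fun i =>
      Fin.append (fun i => α (L.x i)) (fun j => β (L'.x j)) i ^ L.a)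
  set I := Ideal.span (Set.range fun i =>
      Fin.append (fun i => α (L.x i)) (fun j => β (L'.x j)) i ^ L.a) with hI
  have h1 : ∀ g ∈ Ideal.span (Set.range fun i => L.x i ^ L.a), α g ∈ I := by
    intro g hg
    have := Ideal.mem_map_of_mem α hg
    rw [Ideal.map_span] at this
    refine Ideal.span_le.2 ?_ this
    rintro _ ⟨_, ⟨i, rfl⟩, rfl⟩
    refine Ideal.subset_span ⟨Fin.castAdd s i, ?_⟩
    simp
  have h2 : ∀ g ∈ Ideal.span (Set.range fun i => L'.x i ^ L'.a), β g ∈ I := by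
    intro g hg
    have := Ideal.mem_map_of_mem β hg
    rw [Ideal.map_span] at this
    refine Ideal.span_le.2 ?_ this
    rintro _ ⟨_, ⟨i, rfl⟩, rfl⟩
    refine Ideal.subset_span ⟨Fin.natAdd r i, ?_⟩
    simp [haa]
  have h3 : ∏ i, Fin.append (fun i => α (L.x i)) (fun j => β (L'.x j)) i ^ (L.a - 1) =
      α (∏ i, L.x i ^ (L.a - 1)) * β (∏ i, L'.x i ^ (L'.a - 1)) := by
    rw [Fin.prod_univ_add, map_prod, map_prod]
    simp [haa]
  have h4 : α L.R.det * β L'.R.det * (α t * β t') - algebraMap k _ (c * c') *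
      (α (∏ i, L.x i ^ (L.a - 1)) * β (∏ i, L'.x i ^ (L'.a - 1))) =
      α (L.R.det * t - algebraMap k _ c * ∏ i, L.x i ^ (L.a - 1)) * β (L'.R.det * t') +
      α (algebraMap k _ c * ∏ i, L.x i ^ (L.a - 1)) *
        β (L'.R.det * t' - algebraMap k _ c' * ∏ i, L'.x i ^ (L'.a - 1)) := by
    simp only [map_mul, map_sub, AlgHom.commutes]
    ring
  rw [h3, h4]
  exact add_mem (Ideal.mul_mem_right _ _ (h1 _ hmem)) (Ideal.mul_mem_left _ _ (h2 _ hmem'))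

/-- The residue of a product form is the product of the residues. -/
theorem residue_prodForm (hX : SmoothOfRelativeDimension r X.str)
    (hY : SmoothOfRelativeDimension s Y.str) (T : (X.prod Y).RatPoint) (P : X.RatPoint)
    (Q : Y.RatPoint) (hP : P.pt = prX X Y T.pt) (hQ : Q.pt = prY X Y T.pt)
    (hx : IsClosed {prX X Y T.pt}) (hy : IsClosed {prY X Y T.pt})
    (L : LocalData D (prX X Y T.pt)) (L' : LocalData E (prY X Y T.pt)) (ha : L.a = L'.a)
    {ω : X.RForm r} {χ : Y.RForm s} {h : X.localRing (prX X Y T.pt)}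
    {h' : Y.localRing (prY X Y T.pt)}
    (hω : X.toFun _ (∏ l, L.f l) • ω = X.toFun _ h • X.dx L.x)
    (hχ : Y.toFun _ (∏ l, L'.f l) • χ = Y.toFun _ h' • Y.dx L'.x) :
    residue (prodDiv D E) T (prodForm ω χ) = residue D P ω * residue E Q χ := by
  let α := stalkPull (prX X Y) (prX_str X Y) T.pt
  let β := stalkPull (prY X Y) (prY_str X Y) T.pt
  have hZ := prod_smooth hX hY
  have evX : X.localRing (prX X Y T.pt) →ₐ[k] k := T.ev.comp α
  have evY : Y.localRing (prY X Y T.pt) →ₐ[k] k := T.ev.comp β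
  have hcx := isCoordinates_of_span_eq hX evX L.span_x
  have hcy := isCoordinates_of_span_eq hY evY L'.span_x
  obtain ⟨F⟩ := exists_powerExpansion hX evX L.span_x
  obtain ⟨F'⟩ := exists_powerExpansion hY evY L'.span_x
  let M := L.prod hX hY L' ha hx hy
  obtain ⟨F''⟩ := exists_powerExpansion hZ T.ev M.span_x
  obtain ⟨f, rfl⟩ := hcx.exists_eq_smul_dx hX ω
  obtain ⟨g, rfl⟩ := hcy.exists_eq_smul_dx hY χ
  have h1 := hω
  have h2 := hχ
  rw [smul_smul] at h1 h2
  replace h1 := hcx.smul_dx_injective hX h1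
  replace h2 := hcy.smul_dx_injective hY h2
  have hM : (X.prod Y).toFun T.pt (∏ l, M.f l) • prodForm (f • X.dx L.x) (g • Y.dx L'.x) =
      (X.prod Y).toFun T.pt (α h * β h') • (X.prod Y).dx M.x := by
    have h3 : ∏ l, M.f l = α (∏ l, L.f l) * β (∏ l, L'.f l) := by
      rw [Fin.prod_univ_add, map_prod, map_prod]
      congr 1
      · exact Finset.prod_congr rfl fun i _ =>
          Fin.append_left (fun i => α (L.f i)) (fun j => β (L'.f j)) i
      · exact Finset.prod_congr rfl fun i _ =>
          Fin.append_right (fun i => α (L.f i)) (fun j => β (L'.f j)) i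
    rw [prodForm_smul_dx, smul_smul, h3, prodFun, map_mul, map_mul, ← funPull_toFun,
      ← funPull_toFun, ← funPull_toFun, ← funPull_toFun, ← h1, ← h2, map_mul, map_mul,
      mul_mul_mul_comm]
    rfl
  rw [residue_eq_coeff hZ T rfl M F'' hM, residue_eq_coeff hX P hP L F hω,
    residue_eq_coeff hY Q hQ L' F' hχ]
  have h5 : M.R.det * (α h * β h') = α (L.R.det * h) * β (L'.R.det * h') := by
    rw [LocalData.det_prod, map_mul, map_mul]
    ring
  rw [h5, ← ha]
  exact PowerExpansion.coeff_constExp_mul α β F F' rfl F'' (L.a - 1) _ _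

end

end Variety

/-! ### Rational points of products -/

namespace Variety

variable {k : Type u} [Field k] {r s : ℕ} {X Y : Variety k}

theorem RatPoint.prX_pt_prod (P : X.RatPoint) (Q : Y.RatPoint) :
    prX X Y (P.prod Q).pt = P.pt :=
  congrArg (fun f : Spec (CommRingCat.of k) ⟶ X.carrier => f (IsLocalRing.closedPoint k))
    (pullback.lift_fst P.hom Q.hom _)

theorem RatPoint.prY_pt_prod (P : X.RatPoint) (Q : Y.RatPoint) :
    prY X Y (P.prod Q).pt = Q.pt :=
  congrArg (fun f : Spec (CommRingCat.of k) ⟶ Y.carrier => f (IsLocalRing.closedPoint k))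
    (pullback.lift_snd P.hom Q.hom _)

theorem isUnit_of_isUnit_stalkSpecializes {x y : X.carrier} (h : x = y) (a : X.localRing y)
    (ha : IsUnit (X.carrier.presheaf.stalkSpecializes (specializes_of_eq h) a)) : IsUnit a := by
  subst h
  rw [TopCat.Presheaf.stalkSpecializes_refl] at ha
  exact ha

/-- A field-valued point supported at a rational point factors through it. -/
theorem RatPoint.eq_comp (P : X.RatPoint) {F : Type u} [Field F]
    (f : Spec (CommRingCat.of F) ⟶ X.carrier) (hf : f (IsLocalRing.closedPoint F) = P.pt)
    (φ : k →+* F) (hφ : f ≫ X.str = Spec.map (CommRingCat.ofHom φ)) :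
    f = Spec.map (CommRingCat.ofHom φ) ≫ P.hom := by
  let b : X.carrier.presheaf.stalk P.pt ⟶ CommRingCat.of F :=
    X.carrier.presheaf.stalkSpecializes (specializes_of_eq hf) ≫ Scheme.stalkClosedPointTo f
  let e : X.carrier.presheaf.stalk P.pt ⟶ CommRingCat.of k := Scheme.stalkClosedPointTo P.hom
  have hb : Spec.map b ≫ X.carrier.fromSpecStalk P.pt = f := by
    rw [Spec.map_comp, Category.assoc, Scheme.SpecMap_stalkSpecializes_fromSpecStalk,
      Scheme.Spec_stalkClosedPointTo_fromSpecStalk]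
  have he : Spec.map e ≫ X.carrier.fromSpecStalk P.pt = P.hom :=
    Scheme.Spec_stalkClosedPointTo_fromSpecStalk P.hom
  have hconst : CommRingCat.ofHom (X.const P.pt) ≫ b = CommRingCat.ofHom φ := by
    apply Spec.map_injective
    rw [Spec.map_comp, ← fromSpecStalk_str, ← Category.assoc, hb, hφ]
  have hbe : b = e ≫ CommRingCat.ofHom φ := by
    ext a
    have h1 : a - algebraMap k _ (P.ev a) ∈ IsLocalRing.maximalIdeal (X.localRing P.pt) := by
      rw [← ev_eq_zero_iff P.ev, map_sub, AlgHom.commutes]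
      exact sub_self _
    have h2 : b.hom (a - algebraMap k _ (P.ev a)) = 0 := by
      by_contra hne
      have h3 : IsUnit ((Scheme.stalkClosedPointTo f).hom (X.carrier.presheaf.stalkSpecializes
          (specializes_of_eq hf) (a - algebraMap k _ (P.ev a)))) := IsUnit.mk0 _ hne
      have h4 := isUnit_of_isUnit_stalkSpecializes hf _ (isUnit_of_map_unit _ _ h3)
      exact (IsLocalRing.mem_maximalIdeal _).1 h1 h4
    rw [map_sub, sub_eq_zero] at h2
    refine h2.trans ?_
    exact congrArg (fun q => q.hom (P.ev a)) hconst
  rw [← hb, ← he, hbe, Spec.map_comp, Category.assoc]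

/-- `P × Q` is the only point of `X × Y` over the rational points `P` and `Q`. -/
theorem RatPoint.eq_pt_prod (P : X.RatPoint) (Q : Y.RatPoint) (z : (X.prod Y).carrier)
    (hP : prX X Y z = P.pt) (hQ : prY X Y z = Q.pt) : z = (P.prod Q).pt := by
  let F := IsLocalRing.ResidueField ((X.prod Y).localRing z)
  let i : Spec (CommRingCat.of F) ⟶ (X.prod Y).carrier :=
    Spec.map (CommRingCat.ofHom (IsLocalRing.residue ((X.prod Y).localRing z))) ≫
      (X.prod Y).carrier.fromSpecStalk z
  have hi : i (IsLocalRing.closedPoint F) = z := by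
    have h1 : Spec.map (CommRingCat.ofHom (IsLocalRing.residue ((X.prod Y).localRing z)))
        (IsLocalRing.closedPoint F) = IsLocalRing.closedPoint ((X.prod Y).localRing z) :=
      IsLocalRing.comap_closedPoint (IsLocalRing.residue ((X.prod Y).localRing z))
    exact (congrArg ((X.prod Y).carrier.fromSpecStalk z) h1).trans Scheme.fromSpecStalk_closedPoint
  have hstr : i ≫ (X.prod Y).str = Spec.map (CommRingCat.ofHom
      ((IsLocalRing.residue _).comp ((X.prod Y).const z))) := by
    rw [Category.assoc, fromSpecStalk_str, ← Spec.map_comp, ← CommRingCat.ofHom_comp]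
  have h1 := P.eq_comp (i ≫ prX X Y) ((congrArg (prX X Y) hi).trans hP) _
    (by rw [Category.assoc, prX_str]; exact hstr)
  have h2 := Q.eq_comp (i ≫ prY X Y) ((congrArg (prY X Y) hi).trans hQ) _
    (by rw [Category.assoc, prY_str]; exact hstr)
  have h3 : i = Spec.map (CommRingCat.ofHom
      ((IsLocalRing.residue _).comp ((X.prod Y).const z))) ≫ (P.prod Q).hom := by
    apply (isProduct_prod X Y).isPullback.hom_ext
    · rw [Category.assoc]
      refine h1.trans ?_
      exact congrArg _ (pullback.lift_fst P.hom Q.hom _).symm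
    · rw [Category.assoc]
      refine h2.trans ?_
      exact congrArg _ (pullback.lift_snd P.hom Q.hom _).symm
  rw [← hi]
  have h4 := congrArg (fun g : Spec (CommRingCat.of F) ⟶ (X.prod Y).carrier =>
    g (IsLocalRing.closedPoint F)) h3
  refine h4.trans ?_
  have h5 : Spec.map (CommRingCat.ofHom ((IsLocalRing.residue _).comp ((X.prod Y).const z)))
      (IsLocalRing.closedPoint F) = IsLocalRing.closedPoint k :=
    Subsingleton.elim (α := PrimeSpectrum k) _ _
  exact congrArg (P.prod Q).hom h5

theorem mem_supp_of_mem_supp_timesY {D : X.Divisor} {z : (X.prod Y).carrier}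
    (h : z ∈ (timesY D Y).supp) : prX X Y z ∈ D.supp := by
  obtain ⟨w, hw, hwz⟩ := h
  change D.coeff (prX X Y w.1) ≠ 0 at hw
  unfold Divisor.coeff at hw
  split_ifs at hw with hc
  · exact ⟨_, hw, hwz.map (prX X Y).continuous⟩
  · exact absurd rfl hw

theorem mem_supp_of_mem_supp_Xtimes {E : Y.Divisor} {z : (X.prod Y).carrier}
    (h : z ∈ (Xtimes X E).supp) : prY X Y z ∈ E.supp := by
  obtain ⟨w, hw, hwz⟩ := h
  change E.coeff (prY X Y w.1) ≠ 0 at hw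
  unfold Divisor.coeff at hw
  split_ifs at hw with hc
  · exact ⟨_, hw, hwz.map (prY X Y).continuous⟩
  · exact absurd rfl hw

/-! ### Künneth formula for spaces of differential forms -/

theorem timesY_apply (D : X.Divisor) (w : (X.prod Y).PrimeDiv) :
    timesY D Y w = D.coeff (prX X Y w.1) := rfl

theorem Xtimes_apply (E : Y.Divisor) (w : (X.prod Y).PrimeDiv) :
    Xtimes X E w = E.coeff (prY X Y w.1) := rfl

theorem Divisor.coeff_genericPoint (D : X.Divisor) : D.coeff (genericPoint X.carrier) = 0 :=
  dif_neg (by rw [X.coheight_genericPoint]; exact zero_ne_one)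

theorem formCoeff_genericPoint (ω : X.RForm r) : formCoeff ω (genericPoint X.carrier) = 0 :=
  dif_neg (by rw [X.coheight_genericPoint]; exact zero_ne_one)

theorem ord_genericPoint (f : X.funField) : Scheme.ord f (genericPoint X.carrier) = 0 :=
  Scheme.ord_eq_zero_of_coheight_neq_one (by rw [X.coheight_genericPoint]; exact zero_ne_one) _

theorem formCoeff_add_coeff_nonneg {B : X.Divisor} {ω : X.RForm r} (hω : ω ∈ formSpace r B)
    (h0 : ω ≠ 0) (x : X.carrier) : 0 ≤ formCoeff ω x + B.coeff x := by
  unfold formCoeff Divisor.coeff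
  split_ifs with h
  · exact (hω.resolve_left h0) ⟨x, h⟩
  · simp

theorem prodForm_zero_left (χ : Y.RForm s) : prodForm (0 : X.RForm r) χ = 0 := by
  have : RatForm.pull (funPull (prX X Y) (prX_str X Y)) r (0 : X.RForm r) = 0 := by
    rw [← zero_smul X.funField (RatForm.dWedge k (fun _ : Fin r => (0 : X.funField))),
      RatForm.pull_smul_dWedge, map_zero, zero_smul]
  rw [prodForm, this]
  exact Subtype.ext (zero_mul _)

theorem prodForm_zero_right (ω : X.RForm r) : prodForm ω (0 : Y.RForm s) = 0 := by
  have : RatForm.pull (funPull (prY X Y) (prY_str X Y)) s (0 : Y.RForm s) = 0 := by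
    rw [← zero_smul Y.funField (RatForm.dWedge k (fun _ : Fin s => (0 : Y.funField))),
      RatForm.pull_smul_dWedge, map_zero, zero_smul]
  rw [prodForm, this]
  exact Subtype.ext (mul_zero _)

theorem prodForm_mem_formSpace (hX : SmoothOfRelativeDimension r X.str)
    (hY : SmoothOfRelativeDimension s Y.str) {B : X.Divisor} {B' : Y.Divisor} {ω : X.RForm r}
    {χ : Y.RForm s} (hω : ω ∈ formSpace r B) (hχ : χ ∈ formSpace s B') :
    prodForm ω χ ∈ formSpace (r + s) (timesY B Y + Xtimes X B') := by
  by_cases h1 : ω = 0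
  · rw [h1, prodForm_zero_left]
    exact Or.inl rfl
  by_cases h2 : χ = 0
  · rw [h2, prodForm_zero_right]
    exact Or.inl rfl
  refine Or.inr fun w => ?_
  rw [formOrd_prodForm hX hY h1 h2, Finsupp.add_apply, timesY_apply, Xtimes_apply]
  have h3 := formCoeff_add_coeff_nonneg hω h1 (prX X Y w.1)
  have h4 := formCoeff_add_coeff_nonneg hχ h2 (prY X Y w.1)
  linarith

/-- Künneth formula: `Ω^{r+s}(B × Y + X × B')` is spanned by the products of forms in `Ω^r(B)`
and in `Ω^s(B')`. -/
theorem exists_eq_sum_prodForm (hX : SmoothOfRelativeDimension r X.str)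
    (hY : SmoothOfRelativeDimension s Y.str) (B : X.Divisor) (B' : Y.Divisor)
    {ψ : (X.prod Y).RForm (r + s)} (hψ : ψ ∈ formSpace (r + s) (timesY B Y + Xtimes X B')) :
    ∃ (N : ℕ) (ω : Fin N → X.RForm r) (χ : Fin N → Y.RForm s), (∀ i, ω i ∈ formSpace r B) ∧
      (∀ i, χ i ∈ formSpace s B') ∧ ψ = ∑ i, prodForm (ω i) (χ i) := by
  have hZ := prod_smooth hX hY
  let h := isProduct_prod X Y
  let z := genericPoint (X.prod Y).carrier
  obtain ⟨x, hx⟩ := exists_isCoordinates hX (prX X Y z)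
  obtain ⟨y, hy⟩ := exists_isCoordinates hY (prY X Y z)
  have hxy := isCoordinates_append z hx hy
  obtain ⟨g, rfl⟩ := hxy.exists_eq_smul_dx hZ ψ
  have hx0 := hx.dx_ne_zero hX
  have hy0 := hy.dx_ne_zero hY
  have hdxy : prodForm (X.dx x) (Y.dx y) = (X.prod Y).dx
      (Fin.append (fun i => stalkPull (prX X Y) (prX_str X Y) z (x i))
        (fun j => stalkPull (prY X Y) (prY_str X Y) z (y j))) := by
    have := prodForm_smul_dx z x y 1 1
    rwa [one_smul, one_smul, prodFun, map_one, map_one, mul_one, one_smul] at this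
  have hord : ∀ w : (X.prod Y).PrimeDiv, g = 0 ∨ 0 ≤ Scheme.ord g w.1 +
      ((formCoeff (X.dx x) (prX X Y w.1) + B.coeff (prX X Y w.1)) +
      (formCoeff (Y.dx y) (prY X Y w.1) + B'.coeff (prY X Y w.1))) := by
    intro w
    by_cases hg : g = 0
    · exact Or.inl hg
    right
    rw [← hdxy] at hψ
    have hne := prodForm_ne_zero hX hY hx0 hy0
    have h1 := (hψ.resolve_left (smul_ne_zero hg hne)) w
    rw [formOrd_smul hZ w hg hne, formOrd_prodForm hX hY hx0 hy0, Finsupp.add_apply,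
      timesY_apply, Xtimes_apply] at h1
    linarith
  obtain ⟨t, ht⟩ := h.exists_funTensor_eq hZ g fun w hw hw' => by
    rcases hord w with h0 | h0
    · simp [h0]
    · rw [hw, hw', formCoeff_genericPoint, formCoeff_genericPoint, Divisor.coeff_genericPoint,
        Divisor.coeff_genericPoint] at h0
      simpa using h0
  let A : Submodule k X.funField := (formSubmodule hX B).comap
    ((LinearMap.toSpanSingleton X.funField (X.RForm r) (X.dx x)).restrictScalars k)
  let A' : Submodule k Y.funField := (formSubmodule hY B').comap
    ((LinearMap.toSpanSingleton Y.funField (Y.RForm s) (Y.dx y)).restrictScalars k)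
  have hsum : ∀ {N : ℕ} {f : Fin N → X.funField} {b : Fin N → Y.funField},
      t = ∑ i, f i ⊗ₜ b i → g = ∑ i, h.pullFst (f i) * h.pullSnd (b i) := by
    intro N f b hfb
    rw [← ht, hfb, map_sum]
    exact Finset.sum_congr rfl fun i _ => h.funTensor_tmul _ _
  obtain ⟨N, f, b, hf, hb, hfb⟩ := TensorProduct.exists_sum_tmul_mem A A' t
    (fun N f b hli hfb i => by
      change f i • X.dx x ∈ formSpace r B
      rw [mem_formSpace_iff]
      intro v
      obtain ⟨w, hw, hw'⟩ := h.exists_primeDiv hX v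
      have h1 := hord w
      rw [hw', formCoeff_genericPoint, Divisor.coeff_genericPoint, add_zero, add_zero,
        hsum hfb] at h1
      have hne : prX X Y w.1 ≠ genericPoint X.carrier := by
        intro h0
        have h2 := v.2
        rw [← hw, h0, X.coheight_genericPoint] at h2
        exact zero_ne_one h2
      rcases h.ord_nonneg_of_sum hX hZ w hne f b hli _ h1 i with h2 | h2
      · exact Or.inl (by rw [h2, zero_smul])
      · by_cases h0 : f i = 0
        · exact Or.inl (by rw [h0, zero_smul])
        right
        rw [formOrd_smul hX v h0 hx0]
        rw [hw, formCoeff_primeDiv, Divisor.coeff_primeDiv] at h2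
        linarith)
    (fun N f b hli hfb i => by
      change b i • Y.dx y ∈ formSpace s B'
      rw [mem_formSpace_iff]
      intro v
      obtain ⟨w, hw, hw'⟩ := h.swap.exists_primeDiv hY v
      have h1 := hord w
      rw [hw', formCoeff_genericPoint, Divisor.coeff_genericPoint, add_zero, zero_add,
        hsum hfb] at h1
      have hcomm : ∑ i, h.pullFst (f i) * h.pullSnd (b i) =
          ∑ i, h.swap.pullFst (b i) * h.swap.pullSnd (f i) :=
        Finset.sum_congr rfl fun i _ => mul_comm _ _
      rw [hcomm] at h1
      have hne : prY X Y w.1 ≠ genericPoint Y.carrier := by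
        intro h0
        have h2 := v.2
        rw [← hw, h0, Y.coheight_genericPoint] at h2
        exact zero_ne_one h2
      rcases h.swap.ord_nonneg_of_sum hY hZ w hne b f hli _ h1 i with h2 | h2
      · exact Or.inl (by rw [h2, zero_smul])
      · by_cases h0 : b i = 0
        · exact Or.inl (by rw [h0, zero_smul])
        right
        rw [formOrd_smul hY v h0 hy0]
        rw [hw, formCoeff_primeDiv, Divisor.coeff_primeDiv] at h2
        linarith)
  refine ⟨N, fun i => f i • X.dx x, fun i => b i • Y.dx y, hf, hb, ?_⟩
  rw [hsum hfb, Finset.sum_smul]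
  exact Finset.sum_congr rfl fun i _ => (prodForm_smul_dx z x y (f i) (b i)).symm

/-! ### Codes on products -/

theorem sum_prodDiv (D : Fin r → X.Divisor) (E : Fin s → Y.Divisor) :
    ∑ l, prodDiv D E l = ∑ l, timesY (D l) Y + ∑ l, Xtimes X (E l) := by
  rw [Fin.sum_univ_add]
  simp [prodDiv]

theorem coeff_formDivisor (D : Fin r → X.Divisor) (G : X.Divisor) (θ : X.funField) (x : X.carrier) :
    ((∑ l, D l) - G - (X.div θ ⊔ 0)).coeff x =
      ∑ l, (D l).coeff x - G.coeff x - max (Scheme.ord θ x) 0 := by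
  unfold Divisor.coeff
  split_ifs with h
  · simp only [Finsupp.coe_sub, Pi.sub_apply, Finsupp.finsetSum_apply, Finsupp.sup_apply]
    rfl
  · rw [Scheme.ord_eq_zero_of_coheight_neq_one h]
    simp

/-- The divisor that bounds the forms on the product is the sum of the pull-backs of the
divisors on the factors; a prime divisor of `X × Y` is dominant over one of the factors, so the
positive parts of `(θ)` and `(λ)` do not interact. -/
theorem formDivisor_prod (hX : SmoothOfRelativeDimension r X.str)
    (hY : SmoothOfRelativeDimension s Y.str) (D : Fin r → X.Divisor) (E : Fin s → Y.Divisor)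
    (G : X.Divisor) (H : Y.Divisor) {θ : X.funField} {lam : Y.funField} (hθ : θ ≠ 0)
    (hlam : lam ≠ 0) :
    (∑ l, prodDiv D E l) - (timesY G Y + Xtimes X H) - ((X.prod Y).div (prodFun θ lam) ⊔ 0) =
      timesY ((∑ l, D l) - G - (X.div θ ⊔ 0)) Y + Xtimes X ((∑ l, E l) - H - (Y.div lam ⊔ 0)) := by
  ext w
  rw [sum_prodDiv, Finsupp.add_apply, timesY_apply, Xtimes_apply, coeff_formDivisor,
    coeff_formDivisor]
  simp only [Finsupp.coe_sub, Finsupp.coe_add, Pi.sub_apply, Pi.add_apply,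
    Finsupp.finsetSum_apply, Finsupp.sup_apply, timesY_apply, Xtimes_apply]
  change _ - max (Scheme.ord (prodFun θ lam) w.1) 0 = _
  rw [ord_prodFun hX hY hθ hlam]
  by_cases hw : prX X Y w.1 = genericPoint X.carrier
  · rw [hw, ord_genericPoint, zero_add, max_self]
    ring
  · rw [(isProduct_prod X Y).snd_eq_genericPoint w hw, ord_genericPoint, add_zero, max_self]
    ring

/-- The residue as a linear functional on a space of forms. -/
noncomputable def residueLinear (hX : SmoothOfRelativeDimension r X.str) {D : Fin r → X.Divisor}
    {G N : X.Divisor} (hN : 0 ≤ N) (P : X.RatPoint) (hG : P.pt ∉ G.supp) (L : LocalData D P.pt) :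
    formSubmodule hX ((∑ l, D l) - G - N) →ₗ[k] k where
  toFun ω := residue D P ω.1
  map_add' ω χ := by
    obtain ⟨E⟩ := exists_powerExpansion hX P.ev L.span_x
    obtain ⟨g, hg⟩ := exists_smul_eq_smul_dx hX hN ω.2 hG P.ev L
    obtain ⟨h, hh⟩ := exists_smul_eq_smul_dx hX hN χ.2 hG P.ev L
    rw [residue_eq_coeff hX P rfl L E hg, residue_eq_coeff hX P rfl L E hh,
      residue_eq_coeff hX P rfl L E (h := g + h) (by
        rw [Submodule.coe_add, smul_add, hg, hh, map_add, add_smul]), mul_add, map_add]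
  map_smul' c ω := by
    obtain ⟨E⟩ := exists_powerExpansion hX P.ev L.span_x
    obtain ⟨g, hg⟩ := exists_smul_eq_smul_dx hX hN ω.2 hG P.ev L
    rw [residue_eq_coeff hX P rfl L E hg,
      residue_eq_coeff hX P rfl L E (h := c • g) (by
        rw [Submodule.coe_smul, smul_comm, hg, Algebra.smul_def, map_mul, mul_smul,
          ← IsScalarTower.algebraMap_apply]
        exact (algebraMap_smul X.funField c _).symm), mul_smul_comm, map_smul]
    rfl

end Variety

namespace Variety

variable {k : Type u} [Field k] {r s n m : ℕ}

/-- The evaluation map of the code: a form is sent to the vector of its residues. -/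
noncomputable def codeMap {X : Variety k} (hX : SmoothOfRelativeDimension r X.str)
    {D : Fin r → X.Divisor} {P : Fin n → X.RatPoint} (θ : X.funField) {G : X.Divisor}
    (hG : ∀ i, (P i).pt ∉ G.supp) (L : ∀ i, LocalData D (P i).pt) :
    formSubmodule hX ((∑ l, D l) - G - (X.div θ ⊔ 0)) →ₗ[k] (Fin n → k) :=
  LinearMap.pi fun i => residueLinear hX le_sup_right (P i) (hG i) (L i)

theorem coe_range_codeMap {X : Variety k} (hX : SmoothOfRelativeDimension r X.str)
    {D : Fin r → X.Divisor} {P : Fin n → X.RatPoint} (θ : X.funField) {G : X.Divisor}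
    (hG : ∀ i, (P i).pt ∉ G.supp) (L : ∀ i, LocalData D (P i).pt) :
    (LinearMap.range (codeMap hX θ hG L) : Set (Fin n → k)) = code D P θ G := by
  ext v
  constructor
  · rintro ⟨ω, rfl⟩
    exact ⟨ω.1, ω.2, rfl⟩
  · rintro ⟨ω, hω, rfl⟩
    exact ⟨⟨ω, hω⟩, rfl⟩

theorem notMem_supp_prod {X Y : Variety k} {P : X.RatPoint} {Q : Y.RatPoint} {G : X.Divisor}
    {H : Y.Divisor} (hG : P.pt ∉ G.supp) (hH : Q.pt ∉ H.supp) :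
    (P.prod Q).pt ∉ (timesY G Y + Xtimes X H).supp := by
  rintro ⟨w, hw, hwz⟩
  rw [Finsupp.add_apply] at hw
  by_cases h : timesY G Y w = 0
  · rw [h, zero_add] at hw
    have := mem_supp_of_mem_supp_Xtimes (X := X) ⟨w, hw, hwz⟩
    rw [RatPoint.prY_pt_prod] at this
    exact hH this
  · have := mem_supp_of_mem_supp_timesY (Y := Y) ⟨w, h, hwz⟩
    rw [RatPoint.prX_pt_prod] at this
    exact hG this

/-- The point-by-point form of the statement that the product of rectifying functions is
rectifying; `S` is the set of admissible constants, that is, all of `k` or its nonzero elements. -/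
theorem rectifiesAt_prodFun [PerfectField k] {X Y : Variety k}
    (hX : SmoothOfRelativeDimension r X.str) (hY : SmoothOfRelativeDimension s Y.str)
    {D : Fin r → X.Divisor} {E : Fin s → Y.Divisor} (hD : IntersectProperly D)
    (hE : IntersectProperly E) {P : Fin n → X.RatPoint} {Q : Fin m → Y.RatPoint}
    {θ : X.funField} {lam : Y.funField} (S : Set k) (hS : ∀ c ∈ S, ∀ c' ∈ S, c * c' ∈ S)
    (hθ : ∀ p, (∀ l, p ∈ (D l).supp) → ((∃ i, (P i).pt = p) → ∃ c ∈ S, RectifiesAt D p θ c) ∧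
      ((¬ ∃ i, (P i).pt = p) → RectifiesAt D p θ 0))
    (hlam : ∀ p, (∀ l, p ∈ (E l).supp) → ((∃ i, (Q i).pt = p) → ∃ c ∈ S, RectifiesAt E p lam c) ∧
      ((¬ ∃ i, (Q i).pt = p) → RectifiesAt E p lam 0))
    (z : (X.prod Y).carrier) (hz : ∀ l, z ∈ (prodDiv D E l).supp) :
    ((∃ l, (prodPts P Q l).pt = z) → ∃ c ∈ S, RectifiesAt (prodDiv D E) z (prodFun θ lam) c) ∧
      ((¬ ∃ l, (prodPts P Q l).pt = z) → RectifiesAt (prodDiv D E) z (prodFun θ lam) 0) := by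
  have hx : ∀ l, prX X Y z ∈ (D l).supp := fun l => by
    have := hz (Fin.castAdd s l)
    rw [prodDiv, Fin.append_left] at this
    exact mem_supp_of_mem_supp_timesY this
  have hy : ∀ l, prY X Y z ∈ (E l).supp := fun l => by
    have := hz (Fin.natAdd r l)
    rw [prodDiv, Fin.append_right] at this
    exact mem_supp_of_mem_supp_Xtimes this
  have hcx := hD _ hx
  have hcy := hE _ hy
  constructor
  · rintro ⟨l, rfl⟩
    obtain ⟨c, hc, h1⟩ := (hθ _ hx).1 ⟨_, (RatPoint.prX_pt_prod _ _).symm⟩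
    obtain ⟨c', hc', h2⟩ := (hlam _ hy).1 ⟨_, (RatPoint.prY_pt_prod _ _).symm⟩
    exact ⟨c * c', hS c hc c' hc', h1.prod hX hY hcx hcy h2⟩
  · intro hno
    by_cases hi : ∃ i, (P i).pt = prX X Y z
    · obtain ⟨c, -, h1⟩ := (hθ _ hx).1 hi
      have hj : ¬ ∃ j, (Q j).pt = prY X Y z := by
        rintro ⟨j, hj⟩
        obtain ⟨i, hi⟩ := hi
        refine hno ⟨finProdFinEquiv (i, j), ?_⟩
        rw [prodPts, Equiv.symm_apply_apply]
        exact (RatPoint.eq_pt_prod _ _ z hi.symm hj.symm).symm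
      have := h1.prod hX hY hcx hcy ((hlam _ hy).2 hj)
      rwa [mul_zero] at this
    · have h1 := (hθ _ hx).2 hi
      by_cases hj : ∃ j, (Q j).pt = prY X Y z
      · obtain ⟨c, -, h2⟩ := (hlam _ hy).1 hj
        have := h1.prod hX hY hcx hcy h2
        rwa [zero_mul] at this
      · have := h1.prod hX hY hcx hcy ((hlam _ hy).2 hj)
        rwa [zero_mul] at this

end Variety

open Variety in
theorem theorem5p5 {k : Type u} [Field k] [Finite k] (X Y : Variety k) (r s n m : ℕ)
    (hX : SmoothOfRelativeDimension r X.str) (hY : SmoothOfRelativeDimension s Y.str)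
    (hXp : X.IsProjective) (hYp : Y.IsProjective)
    (D : Fin r → X.Divisor) (E : Fin s → Y.Divisor)
    (hD : ∀ l, 0 ≤ D l) (hE : ∀ l, 0 ≤ E l)
    (hDi : Variety.IntersectProperly D) (hEi : Variety.IntersectProperly E)
    (P : Fin n → X.RatPoint) (Q : Fin m → Y.RatPoint)
    (hP : Function.Injective P) (hQ : Function.Injective Q)
    (hPD : ∀ i l, (P i).pt ∈ (D l).supp) (hQE : ∀ j l, (Q j).pt ∈ (E l).supp)
    (G : X.Divisor) (H : Y.Divisor)
    (hG : ∀ i, (P i).pt ∉ G.supp) (hH : ∀ j, (Q j).pt ∉ H.supp)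
    (θ : X.funField) (lam : Y.funField)
    (hθ : Variety.IsRectifying D P θ) (hlam : Variety.IsRectifying E Q lam) :
    -- (a)
    (θ ≠ 0 → lam ≠ 0 → ∀ ω ∈ Variety.formSpace r ((∑ l, D l) - G - (X.div θ ⊔ 0)),
      ∀ χ ∈ Variety.formSpace s ((∑ l, E l) - H - (Y.div lam ⊔ 0)),
        Variety.prodForm ω χ ∈ Variety.formSpace (r + s)
          ((∑ l, Variety.timesY (D l) Y) + (∑ l, Variety.Xtimes X (E l))
            - Variety.timesY G Y - Variety.Xtimes X H
            - ((X.prod Y).div (Variety.prodFun θ lam) ⊔ 0))) ∧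
    -- (b)
    Variety.IsRectifying (Variety.prodDiv D E) (Variety.prodPts P Q) (Variety.prodFun θ lam) ∧
    (Variety.IsStrictlyRectifying D P θ → Variety.IsStrictlyRectifying E Q lam →
      Variety.IsStrictlyRectifying (Variety.prodDiv D E) (Variety.prodPts P Q)
        (Variety.prodFun θ lam)) ∧
    -- (c)
    (θ ≠ 0 → lam ≠ 0 → ∀ ω ∈ Variety.formSpace r ((∑ l, D l) - G - (X.div θ ⊔ 0)),
      ∀ χ ∈ Variety.formSpace s ((∑ l, E l) - H - (Y.div lam ⊔ 0)), ∀ i j,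
        Variety.residue (Variety.prodDiv D E) ((P i).prod (Q j)) (Variety.prodForm ω χ) =
          Variety.residue D (P i) ω * Variety.residue E (Q j) χ) ∧
    -- (d)
    (θ ≠ 0 → lam ≠ 0 →
      Variety.code (Variety.prodDiv D E) (Variety.prodPts P Q) (Variety.prodFun θ lam)
          (Variety.timesY G Y + Variety.Xtimes X H) =
        tensorCode (Variety.code D P θ G) (Variety.code E Q lam H)) := by

  have hZ := prod_smooth hX hY
  have hL : ∀ i, Nonempty (LocalData D (P i).pt) := fun i => by
    obtain ⟨c, L, -⟩ := (hθ _ (hPD i)).1 ⟨i, rfl⟩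
    exact ⟨L⟩
  have hL' : ∀ j, Nonempty (LocalData E (Q j).pt) := fun j => by
    obtain ⟨c, L, -⟩ := (hlam _ (hQE j)).1 ⟨j, rfl⟩
    exact ⟨L⟩
  have hcx : ∀ i j, IsClosed {prX X Y ((P i).prod (Q j)).pt} := fun i j => by
    rw [RatPoint.prX_pt_prod]
    exact hDi _ (hPD i)
  have hcy : ∀ i j, IsClosed {prY X Y ((P i).prod (Q j)).pt} := fun i j => by
    rw [RatPoint.prY_pt_prod]
    exact hEi _ (hQE j)
  -- local data at the two projections of `P × Q`, with the same exponent
  have hLL : ∀ i j, ∃ (L : LocalData D (prX X Y ((P i).prod (Q j)).pt))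
      (L' : LocalData E (prY X Y ((P i).prod (Q j)).pt)), L.a = L'.a := by
    intro i j
    have h1 : Nonempty (LocalData D (prX X Y ((P i).prod (Q j)).pt)) := by
      rw [RatPoint.prX_pt_prod]
      exact hL i
    have h2 : Nonempty (LocalData E (prY X Y ((P i).prod (Q j)).pt)) := by
      rw [RatPoint.prY_pt_prod]
      exact hL' j
    obtain ⟨L⟩ := h1
    obtain ⟨L'⟩ := h2
    exact ⟨L.raise L'.a, L'.raise L.a, Nat.add_comm _ _⟩
  have hc : ∀ ω ∈ formSpace r ((∑ l, D l) - G - (X.div θ ⊔ 0)),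
      ∀ χ ∈ formSpace s ((∑ l, E l) - H - (Y.div lam ⊔ 0)), ∀ i j,
        residue (prodDiv D E) ((P i).prod (Q j)) (prodForm ω χ) =
          residue D (P i) ω * residue E (Q j) χ := by
    intro ω hω χ hχ i j
    obtain ⟨L, L', ha⟩ := hLL i j
    obtain ⟨h, hh⟩ := exists_smul_eq_smul_dx hX le_sup_right hω
      (z := prX X Y ((P i).prod (Q j)).pt) (by rw [RatPoint.prX_pt_prod]; exact hG i)
      (((P i).prod (Q j)).ev.comp (stalkPull (prX X Y) (prX_str X Y) _)) L
    obtain ⟨h', hh'⟩ := exists_smul_eq_smul_dx hY le_sup_right hχ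
      (z := prY X Y ((P i).prod (Q j)).pt) (by rw [RatPoint.prY_pt_prod]; exact hH j)
      (((P i).prod (Q j)).ev.comp (stalkPull (prY X Y) (prY_str X Y) _)) L'
    exact residue_prodForm hX hY _ _ _ (RatPoint.prX_pt_prod _ _).symm
      (RatPoint.prY_pt_prod _ _).symm (hcx i j) (hcy i j) L L' ha hh hh'
  have hcode : ∀ ω ∈ formSpace r ((∑ l, D l) - G - (X.div θ ⊔ 0)),
      ∀ χ ∈ formSpace s ((∑ l, E l) - H - (Y.div lam ⊔ 0)),
      (fun l => residue (prodDiv D E) (prodPts P Q l) (prodForm ω χ)) =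
        fun l => residue D (P (finProdFinEquiv.symm l).1) ω *
          residue E (Q (finProdFinEquiv.symm l).2) χ :=
    fun ω hω χ hχ => funext fun l => hc ω hω χ hχ _ _
  refine ⟨fun hθ0 hlam0 ω hω χ hχ => ?_, ?_, fun hθs hlams => ?_, fun _ _ => hc,
    fun hθ0 hlam0 => ?_⟩
  · have := prodForm_mem_formSpace hX hY hω hχ
    rwa [← formDivisor_prod hX hY D E G H hθ0 hlam0, sum_prodDiv, ← sub_sub] at this
  · intro z hz
    have := rectifiesAt_prodFun hX hY hDi hEi Set.univ (fun _ _ _ _ => trivial)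
      (fun p hp => by simpa using hθ p hp) (fun p hp => by simpa using hlam p hp) z hz
    simpa using this
  · exact rectifiesAt_prodFun hX hY hDi hEi {c | c ≠ 0} (fun c hc c' hc' => mul_ne_zero hc hc')
      hθs hlams
  · have hG' : ∀ l, (prodPts P Q l).pt ∉ (timesY G Y + Xtimes X H).supp := fun l =>
      notMem_supp_prod (hG _) (hH _)
    let Λ := codeMap hZ (D := prodDiv D E) (prodFun θ lam) hG' fun l =>
      (hLL (finProdFinEquiv.symm l).1 (finProdFinEquiv.symm l).2).choose.prod hX hY
        (hLL _ _).choose_spec.choose (hLL _ _).choose_spec.choose_spec (hcx _ _) (hcy _ _)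
    have hΛ : (LinearMap.range Λ : Set (Fin (n * m) → k)) = _ := coe_range_codeMap hZ _ hG' _
    have hmem : ∀ ω ∈ formSpace r ((∑ l, D l) - G - (X.div θ ⊔ 0)),
        ∀ χ ∈ formSpace s ((∑ l, E l) - H - (Y.div lam ⊔ 0)),
          prodForm ω χ ∈ formSubmodule hZ ((∑ l, prodDiv D E l) - (timesY G Y + Xtimes X H) -
            ((X.prod Y).div (prodFun θ lam) ⊔ 0)) := fun ω hω χ hχ => by
      rw [formDivisor_prod hX hY D E G H hθ0 hlam0]
      exact prodForm_mem_formSpace hX hY hω hχ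
    apply Set.Subset.antisymm
    · rintro _ ⟨ψ, hψ, rfl⟩
      have hψ' := hψ
      rw [formDivisor_prod hX hY D E G H hθ0 hlam0] at hψ'
      obtain ⟨N, ω, χ, hω, hχ, hsum⟩ := exists_eq_sum_prodForm hX hY _ _ hψ'
      have h1 : (⟨ψ, hψ⟩ : formSubmodule hZ _) =
          ∑ i, ⟨prodForm (ω i) (χ i), hmem _ (hω i) _ (hχ i)⟩ := by
        apply Subtype.ext
        refine hsum.trans ?_
        rw [Submodule.coe_sum]
      have h2 : (fun l => residue (prodDiv D E) (prodPts P Q l) ψ) =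
          ∑ i, fun l => residue D (P (finProdFinEquiv.symm l).1) (ω i) *
            residue E (Q (finProdFinEquiv.symm l).2) (χ i) := by
        change Λ ⟨ψ, hψ⟩ = _
        rw [h1, map_sum]
        exact Finset.sum_congr rfl fun i _ => hcode _ (hω i) _ (hχ i)
      rw [tensorCode, SetLike.mem_coe]
      change (fun l => residue (prodDiv D E) (prodPts P Q l) ψ) ∈ _
      rw [h2]
      exact Submodule.sum_mem _ fun i _ => Submodule.subset_span
        ⟨_, ⟨ω i, hω i, rfl⟩, _, ⟨χ i, hχ i, rfl⟩, rfl⟩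
    · rw [← hΛ]
      refine Submodule.span_le.2 ?_
      rintro _ ⟨_, ⟨ω, hω, rfl⟩, _, ⟨χ, hχ, rfl⟩, rfl⟩
      exact ⟨⟨_, hmem ω hω χ hχ⟩, hcode ω hω χ hχ⟩
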